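/- **Setting.** Let $t$ be the coordinate of $\mathbb{C}^*$. A *tt\*-structure* $(E,\eta,g,\Phi)$ over $\mathbb{C}^*$ is a holomorphic vector bundle $E$ with a holomorphic nondegenerate symmetric bilinear form $\eta$, a Hermitian metric $g$ and a holomorphic $\mathrm{End}(E)$-valued 1-form $\Phi$ such that $\Phi$ is $\eta$-self-adjoint, the conjugate-linear map $\kappa$ given by $g(a,b)=\eta(\kappa(a),b)$ satisfies $\kappa^2=\mathrm{Id}_E$, and $D+\lambda^{-1}\Phi+\lambda\Phi^{\dagger_g}$ is flat for all $\lambda\in S^1$, where $D=\partial_E^g+\bar\partial_E$ is the Chern connection. The *tt\*-equation* is $[\partial_E^g,\bar\partial_E]=-[\Phi,\Phi^{\dagger_g}]$. An isomorphism of tt\*-structures is a holomorphic bundle isomorphism that preserves $\eta$ and $g$ and intertwines the 1-forms $\Phi$. For $z\in\mathbb{C}$ let $\rho_z(t)=e^zt$ and $\rho_z\cdot(E,\eta,g,\Phi)=(\rho_z^*E,\rho_z^*\eta,\rho_z^*g,e^{-z}\rho_z^*\Phi)$. For $l\in\{0,\dots,n\}$, a solution of the *radial tt\*-Toda equation* with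 anti-symmetry index $l$ is a family of smooth functions $w_j:\mathbb{C}^*\to\mathbb{R}$, $j\in\mathbb{Z}/(n+1)$, with $$(w_j)_{t\bar t}=e^{w_j-w_{j-1}}-e^{w_{j+1}-w_j},\qquad w_j+w_{l-j-1}=0,\qquad w_j(t)=w_j(|t|).$$ For $c\in\mathbb{C}^*$, a *Toda frame* (for $l,c,w$) over an open set $U\subset\mathbb{C}^*$ is a holomorphic frame $e_0,\dots,e_n$ of $E|_U$ such that, in the coordinate $s=ct$ and with indices modulo $n+1$: $\eta(e_i,e_j)=1$ if $i+j\equiv l-1$ and $0$ otherwise; $\Phi(e_j)=e_{j+1}\,ds$; $g(e_i,e_j)=\delta_{ij}e^{w_j(s)}$. **Proposition 4.2.** Let $n\ge 0$ and let $(E,\eta,g,\Phi)$ be a tt\*-structure of rank $n+1$ over $\mathbb{C}^*$ with $\Phi_t\neq0$ for every $t$. Suppose that * $(E,\eta,g,\Phi)$ is isomorphic to $(E,\eta,g,\omega\Phi)$, where $\omega=e^{2\pi\sqrt{-1}/(n+1)}$ (it is a $\mathbb{Z}_{n+1}$-fixed point); * for every $z\in\sqrt{-1}\,\mathbb{R}$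 there is given an isomorphism of tt\*-structures $\mathcal{T}_z:\rho_z\cdot(E,\eta,g,\Phi)\to(E,\eta,g,\Phi)$, and for each $a\in E$ the point $\mathcal{T}_z(a)$ of $E$ depends continuously on $z$. Then the tt\*-equation of $(E,\eta,g,\Phi)$ is equivalent to the radial tt\*-Toda equation, in the following sense. There are $l\in\{0,\dots,n\}$, $c\in\mathbb{C}^*$ and a solution $w=(w_j)$ on $\mathbb{C}^*$ of the radial tt\*-Toda equation with anti-symmetry index $l$, such that: 1. Toda frames for $l,c,w$ exist near every point of $\mathbb{C}^*$, and they can be chosen so that any two of them differ by at most a common sign at each point of the overlap of their domains. For any smooth $u_j:\mathbb{C}^*\to\mathbb{R}$ (without the radial or the anti-symmetry condition), the tt\*-equation at $t$ for the metric with $g(e_i,e_j)=\delta_{ij}e^{u_j(s)}$ in such a frame holds if and only if $(u_j)_{s\bar s}=e^{u_j-u_{j-1}}-e^{u_{j+1}-u_j}$ for all $j$ at $s=ct$. 2. If moreover $\mathcal{T}_{2\pi\sqrt{-1}}=\mathcal{T}_0$ (note that $\rho_{2\pi\sqrt{-1}}=\rho_0=\mathrm{id}$), then there is a Toda frame for $l,c,w$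 over the whole of $\mathbb{C}^*$. -/

import Mathlib

open Bundle Set
open scoped Manifold ContDiff ComplexConjugate Matrix

noncomputable section

/-! The base is `ℂ* = ℂˣ`, with its standard complex coordinate `t`.  It is a complex manifold for
the model `𝓘(ℂ, ℂ)` and a real one for the model `𝓘(ℝ, ℂ)`.  A holomorphic vector bundle is an
analytic (order `ω`) complex vector bundle for the model `𝓘(ℂ, ℂ)`. -/

/-! ### Wirtinger derivatives, rotations -/

/-- The vector field `∂/∂t`. -/
def ddt (t : ℂˣ) : TangentSpace 𝓘(ℂ, ℂ) t := (1 : ℂ)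

/-- The one-form `dt` at the point `t`. -/
def dCoord (t : ℂˣ) : TangentSpace 𝓘(ℂ, ℂ) t →L[ℂ] ℂ :=
  mfderiv 𝓘(ℂ, ℂ) 𝓘(ℂ, ℂ) (fun s : ℂˣ => (s : ℂ)) t

/-- The real differential of `f : ℂ* → ℂ`, in the coordinate `t`. -/
def realDiff (f : ℂˣ → ℂ) (t : ℂˣ) : ℂ →L[ℝ] ℂ :=
  mfderiv 𝓘(ℝ, ℂ) 𝓘(ℝ, ℂ) f t

/-- `∂f/∂t = (∂f/∂x - i ∂f/∂y) / 2`. -/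
def wirt (f : ℂˣ → ℂ) (t : ℂˣ) : ℂ :=
  (1 / 2 : ℂ) * (realDiff f t 1 - Complex.I * realDiff f t Complex.I)

/-- `∂f/∂t̄ = (∂f/∂x + i ∂f/∂y) / 2`. -/
def wirtBar (f : ℂˣ → ℂ) (t : ℂˣ) : ℂ :=
  (1 / 2 : ℂ) * (realDiff f t 1 + Complex.I * realDiff f t Complex.I)

/-- `∂M/∂t` for a matrix-valued function, entry by entry. -/
def matWirt {ι : Type*} (M : ℂˣ → Matrix ι ι ℂ) (t : ℂˣ) : Matrix ι ι ℂ :=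
  Matrix.of fun i j => wirt (fun s => M s i j) t

/-- `∂M/∂t̄` for a matrix-valued function, entry by entry. -/
def matWirtBar {ι : Type*} (M : ℂˣ → Matrix ι ι ℂ) (t : ℂˣ) : Matrix ι ι ℂ :=
  Matrix.of fun i j => wirtBar (fun s => M s i j) t

/-- The number `e^z` as a point of `ℂ*`. -/
def expUnit (z : ℂ) : ℂˣ := Units.mk0 (Complex.exp z) (Complex.exp_ne_zero z)

/-- The holomorphic map `ρ_z : ℂ* → ℂ*`, `ρ_z(t) = e^z t`. -/
def rho (z : ℂ) : ContMDiffMap 𝓘(ℂ, ℂ) 𝓘(ℂ, ℂ) ℂˣ ℂˣ ω :=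
  ⟨fun t => expUnit z * t, contMDiff_mul_left⟩

theorem rho_rho_neg (z : ℂ) (t : ℂˣ) : rho z (rho (-z) t) = t := by
  apply Units.ext
  change Complex.exp z * (Complex.exp (-z) * (t : ℂ)) = t
  rw [← mul_assoc, ← Complex.exp_add, add_neg_cancel, Complex.exp_zero, one_mul]

/-! ### tt*-structures -/

/-- The data `(η, g, Φ)` on a complex vector bundle `E` over `ℂ*`: a bilinear form, a sesquilinear
form (conjugate-linear in the first variable), and an `End(E)`-valued one-form
(`Φ t X` is the endomorphism `Φ_X` of the fibre at `t`). -/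
structure TTData (E : ℂˣ → Type*) [∀ t, AddCommGroup (E t)] [∀ t, Module ℂ (E t)] where
  eta : ∀ t, E t →ₗ[ℂ] E t →ₗ[ℂ] ℂ
  g : ∀ t, E t →ₗ⋆[ℂ] E t →ₗ[ℂ] ℂ
  Phi : ∀ t, TangentSpace 𝓘(ℂ, ℂ) t →ₗ[ℂ] (E t →ₗ[ℂ] E t)

section

variable (F : Type*) [NormedAddCommGroup F] [NormedSpace ℂ F]
  {E : ℂˣ → Type*} [∀ t, AddCommGroup (E t)] [∀ t, Module ℂ (E t)]
  [∀ t, TopologicalSpace (E t)] [TopologicalSpace (TotalSpace F E)]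
  [FiberBundle F E]

/-- `a` is a holomorphic section of `E` over `U`. -/
def IsHolSection (a : ∀ t, E t) (U : Set ℂˣ) : Prop :=
  ContMDiffOn 𝓘(ℂ, ℂ) (𝓘(ℂ, ℂ).prod 𝓘(ℂ, F)) ω (fun t => TotalSpace.mk' F t (a t)) U

/-- `e = (e_i)` is a holomorphic frame of `E` over `U`. -/
def IsHolFrame {ι : Type*} (e : ι → ∀ t, E t) (U : Set ℂˣ) : Prop :=
  IsLocalFrameOn 𝓘(ℂ, ℂ) F ω e U

end

section

variable {E : ℂˣ → Type*} [∀ t, AddCommGroup (E t)] [∀ t, Module ℂ (E t)]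
  {ι : Type*} [Fintype ι] [DecidableEq ι]

/-- The Gram matrix `(g(e_i, e_j))`. -/
def TTData.gram (D : TTData E) (e : ι → ∀ t, E t) (t : ℂˣ) : Matrix ι ι ℂ :=
  Matrix.of fun i j => D.g t (e i t) (e j t)

/-- `A dt` is the matrix of `Φ` with respect to `e` over `U`:
`Φ(e_j) = ∑ i, A_ij e_i dt`. -/
def TTData.IsHiggsMatrix (D : TTData E) (e : ι → ∀ t, E t) (U : Set ℂˣ)
    (A : ℂˣ → Matrix ι ι ℂ) : Prop :=
  ∀ t ∈ U, ∀ j, D.Phi t (ddt t) (e j t) = ∑ i, A t i j • e i t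

/-- The `dt`-part `G⁻¹ ∂G/∂t` of the connection matrix of the Chern connection `D`, in a holomorphic
frame in which the metric has Gram matrix `G`; its `dt̄`-part is zero. -/
def chernMatrix (G : ℂˣ → Matrix ι ι ℂ) (t : ℂˣ) : Matrix ι ι ℂ := (G t)⁻¹ * matWirt G t

/-- The matrix `G⁻¹ Aᴴ G` of the adjoint of `A` for the metric with Gram matrix `G`; if `A dt`
is the matrix of `Φ`, then this times `dt̄` is the matrix of `Φ^†`. -/
def adjMatrix (G A : ℂˣ → Matrix ι ι ℂ) (t : ℂˣ) : Matrix ι ι ℂ := (G t)⁻¹ * (A t)ᴴ * G t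

/-- The connection `d + B dt + C dt̄` has zero curvature over `U`. -/
def IsFlatConn (B C : ℂˣ → Matrix ι ι ℂ) (U : Set ℂˣ) : Prop :=
  ∀ t ∈ U, matWirt C t - matWirtBar B t + (B t * C t - C t * B t) = 0

/-- The tt*-equation `[∂^g, ∂̄] = -[Φ, Φ^†]` at `t`, in a holomorphic frame in which the metric has
Gram matrix `G` and `Φ` has matrix `A dt`; here `[∂^g, ∂̄] = -(∂(chernMatrix G)/∂t̄) dt ∧ dt̄`. -/
def TTEquationAt (G A : ℂˣ → Matrix ι ι ℂ) (t : ℂˣ) : Prop :=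
  -matWirtBar (chernMatrix G) t = -(A t * adjMatrix G A t - adjMatrix G A t * A t)

end

section

variable (F : Type*) [NormedAddCommGroup F] [NormedSpace ℂ F]
  {E : ℂˣ → Type*} [∀ t, AddCommGroup (E t)] [∀ t, Module ℂ (E t)]
  [∀ t, TopologicalSpace (E t)] [TopologicalSpace (TotalSpace F E)]
  [FiberBundle F E]

/-- `(E, η, g, Φ)` is a tt*-structure over `ℂ*`. -/
structure TTData.IsTTStar (D : TTData E) : Prop where
  eta_hol : ∀ U : Set ℂˣ, IsOpen U → ∀ a b : (∀ t, E t), IsHolSection F a U → IsHolSection F b U →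
    ContMDiffOn 𝓘(ℂ, ℂ) 𝓘(ℂ, ℂ) ω (fun t => D.eta t (a t) (b t)) U
  eta_symm : ∀ t a b, D.eta t a b = D.eta t b a
  eta_nondeg : ∀ t a, (∀ b, D.eta t a b = 0) → a = 0
  g_smooth : ∀ U : Set ℂˣ, IsOpen U → ∀ a b : (∀ t, E t), IsHolSection F a U → IsHolSection F b U →
    ContMDiffOn 𝓘(ℝ, ℂ) 𝓘(ℝ, ℂ) ∞ (fun t => D.g t (a t) (b t)) U
  g_herm : ∀ t a b, D.g t b a = conj (D.g t a b)
  g_pos : ∀ t a, a ≠ 0 → 0 < (D.g t a a).re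
  Phi_hol : ∀ U : Set ℂˣ, IsOpen U → ∀ a : (∀ t, E t), IsHolSection F a U →
    IsHolSection F (fun t => D.Phi t (ddt t) (a t)) U
  /-- `Φ` is self-adjoint with respect to `η`. -/
  Phi_self_adj : ∀ t X a b, D.eta t (D.Phi t X a) b = D.eta t a (D.Phi t X b)
  /-- The conjugate-linear map `κ` given by `g(a, b) = η(κ(a), b)` is an involution. -/
  real_structure : ∃ κ : ∀ t, E t →ₗ⋆[ℂ] E t,
    (∀ t a b, D.g t a b = D.eta t (κ t a) b) ∧ ∀ t a, κ t (κ t a) = a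
  /-- The connection `D + lam⁻¹ Φ + lam Φ^†` is flat for all `lam ∈ S¹`, where `D` is the Chern
  connection. -/
  flat : ∀ U : Set ℂˣ, IsOpen U → ∀ (r : ℕ) (e : Fin r → ∀ t, E t), IsHolFrame F e U →
    ∀ A : ℂˣ → Matrix (Fin r) (Fin r) ℂ, D.IsHiggsMatrix e U A → ∀ lam : ℂ, ‖lam‖ = 1 →
      IsFlatConn (fun t => chernMatrix (D.gram e) t + lam⁻¹ • A t)
        (fun t => lam • adjMatrix (D.gram e) A t) U

end

section

variable (F₁ F₂ : Type*) [NormedAddCommGroup F₁] [NormedSpace ℂ F₁]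
  [NormedAddCommGroup F₂] [NormedSpace ℂ F₂]
  {E₁ : ℂˣ → Type*} [∀ t, AddCommGroup (E₁ t)] [∀ t, Module ℂ (E₁ t)]
  [∀ t, TopologicalSpace (E₁ t)] [TopologicalSpace (TotalSpace F₁ E₁)] [FiberBundle F₁ E₁]
  {E₂ : ℂˣ → Type*} [∀ t, AddCommGroup (E₂ t)] [∀ t, Module ℂ (E₂ t)]
  [∀ t, TopologicalSpace (E₂ t)] [TopologicalSpace (TotalSpace F₂ E₂)] [FiberBundle F₂ E₂]

/-- The holomorphic bundle map `T : E₁ → E₂` is an isomorphism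
`(E₁, η₁, g₁, Φ₁) → (E₂, η₂, g₂, Φ₂)` of tt*-structures. -/
structure IsTTIso (D₁ : TTData E₁) (D₂ : TTData E₂) (T : ∀ t, E₁ t ≃ₗ[ℂ] E₂ t) : Prop where
  hol : ContMDiff (𝓘(ℂ, ℂ).prod 𝓘(ℂ, F₁)) (𝓘(ℂ, ℂ).prod 𝓘(ℂ, F₂)) ω
    (fun a : TotalSpace F₁ E₁ => TotalSpace.mk' F₂ a.proj (T a.proj a.2))
  eta_eq : ∀ t a b, D₁.eta t a b = D₂.eta t (T t a) (T t b)
  g_eq : ∀ t a b, D₁.g t a b = D₂.g t (T t a) (T t b)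
  Phi_eq : ∀ t X a, T t (D₁.Phi t X a) = D₂.Phi t X (T t a)

end

/-! ### The two actions -/

section

variable {E : ℂˣ → Type*} [∀ t, AddCommGroup (E t)] [∀ t, Module ℂ (E t)]

/-- `μ · (E, η, g, Φ) = (E, η, g, μ Φ)`. -/
def TTData.scale (μ : ℂ) (D : TTData E) : TTData E where
  eta := D.eta
  g := D.g
  Phi := fun t => μ • D.Phi t

instance pullbackAddCommGroup (f : ℂˣ → ℂˣ) (t : ℂˣ) : AddCommGroup ((f *ᵖ E) t) :=
  inferInstanceAs (AddCommGroup (E (f t)))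

/-- `ρ_z · (E, η, g, Φ) = (ρ_z^* E, ρ_z^* η, ρ_z^* g, e^{-z} ρ_z^* Φ)`, where
`(ρ_z^* Φ)_X = Φ_{dρ_z(X)}`. -/
def TTData.rhoAct (z : ℂ) (D : TTData E) : TTData (rho z *ᵖ E) where
  eta := fun t => D.eta (rho z t)
  g := fun t => D.g (rho z t)
  Phi := fun t => Complex.exp (-z) •
    (D.Phi (rho z t) ∘ₗ (mfderiv 𝓘(ℂ, ℂ) 𝓘(ℂ, ℂ) (rho z) t).toLinearMap)

/-- A vector `a ∈ E_p`, as the vector of `ρ_z^* E` over `ρ_{-z}(p)` that lies over it. -/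
def rhoLift (z : ℂ) (p : ℂˣ) (a : E p) : (rho z *ᵖ E) (rho (-z) p) :=
  cast (congrArg E (rho_rho_neg z p).symm) a

/-- The map `a ↦ T_z(a)` of total spaces `E → E` given by a bundle map
`T_z : ρ_z^* E → E`; it covers `ρ_{-z}`. -/
def totalMap (F : Type*) (z : ℂ) (Tz : ∀ t, (rho z *ᵖ E) t ≃ₗ[ℂ] E t) (a : TotalSpace F E) :
    TotalSpace F E :=
  TotalSpace.mk' F (rho (-z) a.proj) (Tz (rho (-z) a.proj) (rhoLift z a.proj a.2))

end

/-! ### The tt*-Toda equation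

Indices are elements of `Fin (n + 1)`, whose arithmetic is that of integers modulo `n + 1`; this
encodes the periodicity `w_{j+n+1} = w_j`. -/

/-- The equation `(w_j)_{t t̄} = e^{w_j - w_{j-1}} - e^{w_{j+1} - w_j}` at `t`. -/
def TodaAt {n : ℕ} (w : Fin (n + 1) → ℂˣ → ℝ) (j : Fin (n + 1)) (t : ℂˣ) : Prop :=
  wirt (wirtBar fun s => (w j s : ℂ)) t =
    ((Real.exp (w j t - w (j - 1) t) - Real.exp (w (j + 1) t - w j t) : ℝ) : ℂ)

/-- `w` is a (smooth) solution on `ℂ*` of the tt*-Toda equation with the anti-symmetry condition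
`w_j + w_{l-j-1} = 0`. -/
structure IsTTStarTodaSolution {n : ℕ} (l : Fin (n + 1)) (w : Fin (n + 1) → ℂˣ → ℝ) : Prop where
  smooth : ∀ j, ContMDiff 𝓘(ℝ, ℂ) 𝓘(ℝ, ℝ) ∞ (w j)
  toda : ∀ j t, TodaAt w j t
  antisymm : ∀ j t, w j t + w (l - j - 1) t = 0

/-- The radial condition `w_j(t) = w_j(|t|)`. -/
def IsRadial {ι : Type*} (w : ι → ℂˣ → ℝ) : Prop :=
  ∀ j (s t : ℂˣ), ‖(s : ℂ)‖ = ‖(t : ℂ)‖ → w j s = w j t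

/-- `e = (e_0, …, e_n)` is a holomorphic frame over `U` that brings `(E, η, g, Φ)` into the Toda
form with respect to the coordinate `s = c t` of `ℂ*`: `η(e_i, e_j)` is `1` if
`i + j ≡ l - 1` modulo `n + 1` and `0` otherwise, `Φ(e_j) = e_{j+1} ds` (with `e_{n+1} = e_0`), and
`g(e_i, e_j) = δ_ij e^{w_j(s)}`. -/
structure IsTodaFrameOn {n : ℕ} (F : Type*) [NormedAddCommGroup F] [NormedSpace ℂ F]
    {E : ℂˣ → Type*} [∀ t, AddCommGroup (E t)] [∀ t, Module ℂ (E t)]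
    [∀ t, TopologicalSpace (E t)] [TopologicalSpace (TotalSpace F E)] [FiberBundle F E]
    (D : TTData E) (l : Fin (n + 1)) (c : ℂˣ) (w : Fin (n + 1) → ℂˣ → ℝ)
    (e : Fin (n + 1) → ∀ t, E t) (U : Set ℂˣ) : Prop where
  frame : IsHolFrame F e U
  eta_eq : ∀ t ∈ U, ∀ i j, D.eta t (e i t) (e j t) = if i + j = l - 1 then 1 else 0
  Phi_eq : ∀ t ∈ U, ∀ X j, D.Phi t X (e j t) = ((c : ℂ) * dCoord t X) • e (j + 1) t
  g_eq : ∀ t ∈ U, ∀ i j,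
    D.g t (e i t) (e j t) = if i = j then (Real.exp (w j (c * t)) : ℂ) else 0

end

noncomputable section

set_option linter.unusedSectionVars false

open Filter Topology

/-! ### Wirtinger calculus on `ℂ*` -/

/-! Write `Φ = φ dt`. The fixed-point isomorphism `S` satisfies `S φ S⁻¹ = ω φ`, so only the leading
and constant coefficients of the characteristic polynomial of `φ` survive, and `φ^(n+1)` is a scalar
`a(t)` (`exists_pow_eq_smul`). This scalar is holomorphic. In the rotation action the factor
`e^{-z}` cancels the derivative of `ρ_z`, so `a` is constant on circles, hence constant.

The analytic point is that `a ≠ 0` (`not_nilpotent`). Otherwise `φ` is nilpotent and nowhere zero.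
The squared norm `M` of `Φ(t ∂/∂t)` is then positive and rotation invariant, and the Bochner formula
`wirtBar_wirt_trace_adjMatrix` with the tt*-equation bounds `|t|² ∂∂̄M` below by the squared norm of
the commutator of `tφ` with its adjoint. By compactness this is at least `K M²`, because a nonzero
nilpotent matrix is never normal (`exists_le_commNormSq`). In the variable `x = log |t|`, which runs
over the whole line, this reads `M'' ≥ 4 K M²`, and no positive function satisfies it
(`not_entire_of_sq_le_deriv`).

Now choose `c^(n+1) = a` and put `N = φ / c`, so `N^(n+1) = 1`. If `v` is an eigenvector of `S` with
eigenvalue `θ`, the vectors `N^j v` have the distinct eigenvalues `θ ω^j` and form a basis. Since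
`S` preserves `η` and `g`, this basis is orthogonal for `g`, and `η` pairs `N^i v` with `N^j v` only
when `i + j = m` for one index `m`; the index sought is `l = m + 1`. Connectedness of `ℂ*` allows
one `θ` to be used on all fibres (`exists_isCyclic`). Normalizing `η(v, N^m v) = 1` leaves `v`
unique up to sign: these are the Toda vectors. They exist holomorphically near each point
(`exists_todaVec`), and the squared lengths of the `N^j v` define `w`. The tt*-equation becomes the
Toda equation by a computation with diagonal matrices, and `κ² = 1` gives the anti-symmetry.

Radiality is subtle because the `T_z` are not assumed to commute with `S`. They do commute with `N`
and preserve `η`, so the rotated vector has a coefficient matrix of square `1` in a local Toda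
basis. The matrices `±1` are isolated among such involutions, so continuity in `z` keeps a Toda
vector a Toda vector (`isTodaVec_rotMap`).

Finally the Toda vectors form a double covering of `ℂ*`. Lifting `exp : ℂ → ℂ*` to it and comparing
with the rotated paths shows that periodicity of `T` makes the lift periodic, which gives a global
Toda vector (`exists_global_todaVec`). -/

/-- The inverse of the coordinate `ℂ* → ℂ`, with a junk value at `0`. -/
def unitOf : ℂ → ℂˣ := (chartAt ℂ (1 : ℂˣ)).symm

theorem unitOf_coe (t : ℂˣ) : unitOf (t : ℂ) = t :=
  (chartAt ℂ (1 : ℂˣ)).left_inv (mem_univ t)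

theorem coe_unitOf {z : ℂ} (hz : z ≠ 0) : (unitOf z : ℂ) = z := by
  conv_rhs => rw [← Units.val_mk0 hz, ← unitOf_coe (Units.mk0 z hz)]
  rfl

theorem continuous_unitVal : Continuous (fun t : ℂˣ => (t : ℂ)) := Units.continuous_val

theorem continuousAt_unitOf (t : ℂˣ) : ContinuousAt unitOf (t : ℂ) := by
  refine (chartAt ℂ (1 : ℂˣ)).continuousAt_symm ?_
  exact (chartAt ℂ (1 : ℂˣ)).map_source (mem_univ t)

theorem tendsto_unitOf (t : ℂˣ) : Tendsto unitOf (𝓝 (t : ℂ)) (𝓝 t) := by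
  have h := continuousAt_unitOf t
  rwa [ContinuousAt, unitOf_coe] at h

theorem continuousAt_of_comp_unitOf {X : Type*} [TopologicalSpace X] {f : ℂˣ → X} {t : ℂˣ}
    (h : ContinuousAt (f ∘ unitOf) t) : ContinuousAt f t := by
  have : f = (f ∘ unitOf) ∘ (fun s : ℂˣ => (s : ℂ)) := by
    funext s; simp [unitOf_coe]
  rw [this]
  exact ContinuousAt.comp h continuous_unitVal.continuousAt

/-- As `ℂ*` is open in `ℂ`, a single chart serves every point, and germs at `t` never see the junk
value at `0`. The continuity that the manifold notion requires comes back by composing with the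
inclusion. -/
theorem contMDiffAt_units_iff {𝕜 G : Type*} [NontriviallyNormedField 𝕜] [NormedAlgebra 𝕜 ℂ]
    [NormedAddCommGroup G] [NormedSpace 𝕜 G] {n : ℕ∞ω}
    {f : ℂˣ → G} {t : ℂˣ} :
    ContMDiffAt 𝓘(𝕜, ℂ) 𝓘(𝕜, G) n f t ↔ ContDiffAt 𝕜 n (f ∘ unitOf) t := by
  rw [contMDiffAt_iff]
  have e : (extChartAt 𝓘(𝕜, G) (f t) ∘ f ∘ (extChartAt 𝓘(𝕜, ℂ) t).symm) = f ∘ unitOf := by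
    funext z; simp [unitOf]; rfl
  have e' : extChartAt 𝓘(𝕜, ℂ) t t = (t : ℂ) := by simp
  rw [e, e']
  simp only [modelWithCornersSelf_coe, range_id, contDiffWithinAt_univ]
  exact ⟨fun h => h.2, fun h => ⟨continuousAt_of_comp_unitOf h.continuousAt, h⟩⟩

theorem mdifferentiableAt_units_iff {𝕜 G : Type*} [NontriviallyNormedField 𝕜] [NormedAlgebra 𝕜 ℂ]
    [NormedAddCommGroup G] [NormedSpace 𝕜 G]
    {f : ℂˣ → G} {t : ℂˣ} :
    MDifferentiableAt 𝓘(𝕜, ℂ) 𝓘(𝕜, G) f t ↔ DifferentiableAt 𝕜 (f ∘ unitOf) t := by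
  rw [mdifferentiableAt_iff]
  have e : (extChartAt 𝓘(𝕜, G) (f t) ∘ f ∘ (extChartAt 𝓘(𝕜, ℂ) t).symm) = f ∘ unitOf := by
    funext z; simp [unitOf]; rfl
  have e' : extChartAt 𝓘(𝕜, ℂ) t t = (t : ℂ) := by simp
  rw [writtenInExtChartAt, e, e']
  simp only [modelWithCornersSelf_coe, range_id, differentiableWithinAt_univ]
  exact ⟨fun h => h.2, fun h => ⟨continuousAt_of_comp_unitOf h.continuousAt, h⟩⟩

theorem realDiff_eq (f : ℂˣ → ℂ) (t : ℂˣ) : realDiff f t = fderiv ℝ (f ∘ unitOf) (t : ℂ) := by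
  rw [realDiff]
  by_cases h : MDifferentiableAt 𝓘(ℝ, ℂ) 𝓘(ℝ, ℂ) f t
  · rw [h.mfderiv]
    have e : writtenInExtChartAt 𝓘(ℝ, ℂ) 𝓘(ℝ, ℂ) t f = f ∘ unitOf := by
      funext z; simp [writtenInExtChartAt, unitOf]; rfl
    have e' : extChartAt 𝓘(ℝ, ℂ) t t = (t : ℂ) := by simp
    rw [e, e', modelWithCornersSelf_coe, range_id, fderivWithin_univ]
  · rw [mfderiv_zero_of_not_mdifferentiableAt h,
      fderiv_zero_of_not_differentiableAt fun h' => h (mdifferentiableAt_units_iff.2 h')]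
    rfl

/-- `f` is smooth, as a function of a real variable, near `t`. -/
abbrev SmoothAt (f : ℂˣ → ℂ) (t : ℂˣ) : Prop := ContMDiffAt 𝓘(ℝ, ℂ) 𝓘(ℝ, ℂ) ∞ f t

/-- `f` is holomorphic near `t`. -/
abbrev HolAt (f : ℂˣ → ℂ) (t : ℂˣ) : Prop := ContMDiffAt 𝓘(ℂ, ℂ) 𝓘(ℂ, ℂ) ω f t

theorem SmoothAt.contDiffAt {f : ℂˣ → ℂ} {t : ℂˣ} (h : SmoothAt f t) :
    ContDiffAt ℝ ∞ (f ∘ unitOf) t := contMDiffAt_units_iff.1 h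

theorem SmoothAt.differentiableAt {f : ℂˣ → ℂ} {t : ℂˣ} (h : SmoothAt f t) :
    DifferentiableAt ℝ (f ∘ unitOf) t := h.contDiffAt.differentiableAt (by simp)

theorem HolAt.contDiffAt {f : ℂˣ → ℂ} {t : ℂˣ} (h : HolAt f t) :
    ContDiffAt ℂ ω (f ∘ unitOf) t := contMDiffAt_units_iff.1 h

theorem HolAt.smoothAt {f : ℂˣ → ℂ} {t : ℂˣ} (h : HolAt f t) : SmoothAt f t :=
  contMDiffAt_units_iff.2 ((h.contDiffAt.restrict_scalars ℝ).of_le le_top)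

theorem eventually_unitOf {p : ℂˣ → Prop} {t : ℂˣ} (h : ∀ᶠ s in 𝓝 t, p s) :
    ∀ᶠ z in 𝓝 (t : ℂ), p (unitOf z) := (tendsto_unitOf t).eventually h

theorem eventually_coe_unitOf (t : ℂˣ) : ∀ᶠ z in 𝓝 (t : ℂ), (unitOf z : ℂ) = z := by
  filter_upwards [isOpen_ne.mem_nhds t.ne_zero] with z hz using coe_unitOf hz

theorem HolAt.eventually {f : ℂˣ → ℂ} {t : ℂˣ} (h : HolAt f t) :
    ∀ᶠ s in 𝓝 t, HolAt f s := by
  have h' := (h.contDiffAt.eventually (by simp))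
  filter_upwards [continuous_unitVal.continuousAt.eventually h'] with s hs
  exact contMDiffAt_units_iff.2 hs

section calculus

variable {f g : ℂˣ → ℂ} {t : ℂˣ}

theorem realDiff_congr (h : f =ᶠ[𝓝 t] g) : realDiff f t = realDiff g t := by
  rw [realDiff_eq, realDiff_eq]
  exact Filter.EventuallyEq.fderiv_eq (eventually_unitOf h)

theorem wirt_congr (h : f =ᶠ[𝓝 t] g) : wirt f t = wirt g t := by
  simp only [wirt, realDiff_congr h]

theorem wirtBar_congr (h : f =ᶠ[𝓝 t] g) : wirtBar f t = wirtBar g t := by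
  simp only [wirtBar, realDiff_congr h]

theorem realDiff_add (hf : SmoothAt f t) (hg : SmoothAt g t) :
    realDiff (fun s => f s + g s) t = realDiff f t + realDiff g t := by
  simp only [realDiff_eq]
  exact fderiv_add hf.differentiableAt hg.differentiableAt

theorem realDiff_sub (hf : SmoothAt f t) (hg : SmoothAt g t) :
    realDiff (fun s => f s - g s) t = realDiff f t - realDiff g t := by
  simp only [realDiff_eq]
  exact fderiv_sub hf.differentiableAt hg.differentiableAt

theorem realDiff_mul (hf : SmoothAt f t) (hg : SmoothAt g t) :
    realDiff (fun s => f s * g s) t = f t • realDiff g t + g t • realDiff f t := by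
  simp only [realDiff_eq]
  have := fderiv_mul hf.differentiableAt hg.differentiableAt
  simp only [Function.comp_apply, unitOf_coe] at this
  exact this

theorem realDiff_const (c : ℂ) : realDiff (fun _ => c) t = 0 := by
  rw [realDiff_eq]
  exact fderiv_const_apply c

theorem wirt_add (hf : SmoothAt f t) (hg : SmoothAt g t) :
    wirt (fun s => f s + g s) t = wirt f t + wirt g t := by
  simp only [wirt, realDiff_add hf hg, _root_.add_apply]; ring

theorem wirtBar_add (hf : SmoothAt f t) (hg : SmoothAt g t) :
    wirtBar (fun s => f s + g s) t = wirtBar f t + wirtBar g t := by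
  simp only [wirtBar, realDiff_add hf hg, _root_.add_apply]; ring

theorem wirtBar_sub (hf : SmoothAt f t) (hg : SmoothAt g t) :
    wirtBar (fun s => f s - g s) t = wirtBar f t - wirtBar g t := by
  simp only [wirtBar, realDiff_sub hf hg, _root_.sub_apply]; ring

theorem wirt_mul (hf : SmoothAt f t) (hg : SmoothAt g t) :
    wirt (fun s => f s * g s) t = wirt f t * g t + f t * wirt g t := by
  simp only [wirt, realDiff_mul hf hg, _root_.add_apply,
    _root_.smul_apply, smul_eq_mul]; ring

theorem wirtBar_mul (hf : SmoothAt f t) (hg : SmoothAt g t) :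
    wirtBar (fun s => f s * g s) t = wirtBar f t * g t + f t * wirtBar g t := by
  simp only [wirtBar, realDiff_mul hf hg, _root_.add_apply,
    _root_.smul_apply, smul_eq_mul]; ring

theorem wirt_const (c : ℂ) : wirt (fun _ => c) t = 0 := by
  simp [wirt, realDiff_const]

theorem wirtBar_const (c : ℂ) : wirtBar (fun _ => c) t = 0 := by
  simp [wirtBar, realDiff_const]

theorem smoothAt_const (c : ℂ) : SmoothAt (fun _ => c) t := contMDiffAt_const

theorem smoothAt_add (hf : SmoothAt f t) (hg : SmoothAt g t) : SmoothAt (fun s => f s + g s) t :=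
  contMDiffAt_units_iff.2 (hf.contDiffAt.add hg.contDiffAt)

theorem smoothAt_sub (hf : SmoothAt f t) (hg : SmoothAt g t) : SmoothAt (fun s => f s - g s) t :=
  contMDiffAt_units_iff.2 (hf.contDiffAt.sub hg.contDiffAt)

theorem smoothAt_mul (hf : SmoothAt f t) (hg : SmoothAt g t) : SmoothAt (fun s => f s * g s) t :=
  contMDiffAt_units_iff.2 (hf.contDiffAt.mul hg.contDiffAt)

theorem smoothAt_conj (hf : SmoothAt f t) : SmoothAt (fun s => conj (f s)) t :=
  contMDiffAt_units_iff.2 (Complex.conjCLE.contDiff.contDiffAt.comp _ hf.contDiffAt)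

theorem smoothAt_sum {ι : Type*} {u : Finset ι} {f : ι → ℂˣ → ℂ}
    (hf : ∀ i ∈ u, SmoothAt (f i) t) : SmoothAt (fun s => ∑ i ∈ u, f i s) t := by
  classical
  induction u using Finset.induction_on with
  | empty => simpa using smoothAt_const 0
  | insert a u ha ih =>
    simp only [Finset.sum_insert ha]
    exact smoothAt_add (hf a (by simp)) (ih fun i hi => hf i (by simp [hi]))

theorem smoothAt_prod {ι : Type*} {u : Finset ι} {f : ι → ℂˣ → ℂ}
    (hf : ∀ i ∈ u, SmoothAt (f i) t) : SmoothAt (fun s => ∏ i ∈ u, f i s) t := by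
  classical
  induction u using Finset.induction_on with
  | empty => simpa using smoothAt_const 1
  | insert a u ha ih =>
    simp only [Finset.prod_insert ha]
    exact smoothAt_mul (hf a (by simp)) (ih fun i hi => hf i (by simp [hi]))

theorem smoothAt_inv (hf : SmoothAt f t) (h0 : f t ≠ 0) : SmoothAt (fun s => (f s)⁻¹) t :=
  contMDiffAt_units_iff.2 (hf.contDiffAt.inv (by simpa [unitOf_coe] using h0))

theorem smoothAt_coe : SmoothAt (fun s => (s : ℂ)) t := by
  refine contMDiffAt_units_iff.2 (contDiffAt_id.congr_of_eventuallyEq ?_)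
  exact eventually_coe_unitOf t

theorem smoothAt_congr (hf : SmoothAt f t) (h : g =ᶠ[𝓝 t] f) : SmoothAt g t :=
  ContMDiffAt.congr_of_eventuallyEq hf h

theorem wirt_sum {ι : Type*} {u : Finset ι} {f : ι → ℂˣ → ℂ} (hf : ∀ i ∈ u, SmoothAt (f i) t) :
    wirt (fun s => ∑ i ∈ u, f i s) t = ∑ i ∈ u, wirt (f i) t := by
  classical
  induction u using Finset.induction_on with
  | empty => simpa using wirt_const 0
  | insert a u ha ih =>
    simp only [Finset.sum_insert ha]
    rw [wirt_add (hf a (by simp)) (smoothAt_sum fun i hi => hf i (by simp [hi])),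
      ih fun i hi => hf i (by simp [hi])]

theorem wirtBar_sum {ι : Type*} {u : Finset ι} {f : ι → ℂˣ → ℂ} (hf : ∀ i ∈ u, SmoothAt (f i) t) :
    wirtBar (fun s => ∑ i ∈ u, f i s) t = ∑ i ∈ u, wirtBar (f i) t := by
  classical
  induction u using Finset.induction_on with
  | empty => simpa using wirtBar_const 0
  | insert a u ha ih =>
    simp only [Finset.sum_insert ha]
    rw [wirtBar_add (hf a (by simp)) (smoothAt_sum fun i hi => hf i (by simp [hi])),
      ih fun i hi => hf i (by simp [hi])]

theorem realDiff_conj (hf : SmoothAt f t) (v : ℂ) :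
    realDiff (fun s => conj (f s)) t v = conj (realDiff f t v) := by
  simp only [realDiff_eq]
  have h : HasFDerivAt ((fun s => conj (f s)) ∘ unitOf)
      ((Complex.conjCLE : ℂ →L[ℝ] ℂ).comp (fderiv ℝ (f ∘ unitOf) (t : ℂ))) (t : ℂ) :=
    (Complex.conjCLE : ℂ →L[ℝ] ℂ).hasFDerivAt.comp (t : ℂ) hf.differentiableAt.hasFDerivAt
  rw [h.fderiv]
  simp

theorem wirt_conj (hf : SmoothAt f t) : wirt (fun s => conj (f s)) t = conj (wirtBar f t) := by
  simp only [wirt, wirtBar, realDiff_conj hf, map_mul, map_add, Complex.conj_I]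
  rw [show conj (1 / 2 : ℂ) = 1 / 2 from Complex.conj_eq_iff_real.2 ⟨1 / 2, by simp⟩]
  ring

theorem wirtBar_conj (hf : SmoothAt f t) : wirtBar (fun s => conj (f s)) t = conj (wirt f t) := by
  simp only [wirt, wirtBar, realDiff_conj hf, map_mul, map_sub, Complex.conj_I]
  rw [show conj (1 / 2 : ℂ) = 1 / 2 from Complex.conj_eq_iff_real.2 ⟨1 / 2, by simp⟩]
  ring

theorem wirtBar_eq_zero_of_hol (hf : HolAt f t) : wirtBar f t = 0 := by
  have h : DifferentiableAt ℂ (f ∘ unitOf) t := hf.contDiffAt.differentiableAt (by simp)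
  have h2 := (h.hasFDerivAt.restrictScalars ℝ).fderiv
  simp only [wirtBar, realDiff_eq, h2, ContinuousLinearMap.coe_restrictScalars']
  have : fderiv ℂ (f ∘ unitOf) (t : ℂ) Complex.I
      = Complex.I * fderiv ℂ (f ∘ unitOf) (t : ℂ) 1 := by
    rw [← smul_eq_mul, ← map_smul]; simp
  rw [this, ← mul_assoc, Complex.I_mul_I]; ring

/-- The chain rule along the dilation `t ↦ c t`. -/
theorem realDiff_comp_mul (c : ℂˣ) (hf : SmoothAt f (c * t)) (v : ℂ) :
    realDiff (fun s => f (c * s)) t v = realDiff f (c * t) (c * v) := by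
  simp only [realDiff_eq]
  have h1 : HasFDerivAt (f ∘ unitOf) (fderiv ℝ (f ∘ unitOf) ((c : ℂ) * t)) ((c : ℂ) * t) := by
    have := hf.differentiableAt.hasFDerivAt
    rwa [Units.val_mul] at this
  have h2 : HasFDerivAt (fun z : ℂ => (c : ℂ) * z)
      (((c : ℂ) • (1 : ℂ →L[ℂ] ℂ)).restrictScalars ℝ) (t : ℂ) := by
    exact ((hasFDerivAt_id (𝕜 := ℂ) (t : ℂ)).const_mul (c : ℂ)).restrictScalars ℝ
  have h3 := HasFDerivAt.comp (t : ℂ) h1 h2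
  have h4 : ((fun s => f (c * s)) ∘ unitOf) =ᶠ[𝓝 (t : ℂ)]
      ((f ∘ unitOf) ∘ (fun z : ℂ => (c : ℂ) * z)) := by
    filter_upwards [isOpen_ne.mem_nhds t.ne_zero] with z hz
    simp only [Function.comp_apply]
    congr 1
    ext
    rw [Units.val_mul, coe_unitOf hz, coe_unitOf (mul_ne_zero c.ne_zero hz)]
  rw [h4.fderiv_eq, h3.fderiv]
  simp

/-- The splitting `df = f_t dt + f_t̄ dt̄`, which turns the chain rules along dilations, circles and
rays into algebra. -/
theorem realDiff_apply (v : ℂ) : realDiff f t v = v * wirt f t + conj v * wirtBar f t := by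
  have h : v = v.re • (1 : ℂ) + v.im • Complex.I := by
    simp [Complex.re_add_im]
  have h2 : realDiff f t v = v.re * realDiff f t 1 + v.im * realDiff f t Complex.I := by
    conv_lhs => rw [h, map_add, map_smul, map_smul]
    simp
  rw [h2, wirt, wirtBar]
  clear h h2
  generalize realDiff f t 1 = a
  generalize realDiff f t Complex.I = b
  have hv : conj v = v.re - v.im * Complex.I := by
    apply Complex.ext <;> simp
  have hv' : v = v.re + v.im * Complex.I := (Complex.re_add_im v).symm
  rw [hv]
  generalize (v.re : ℂ) = x at *
  generalize (v.im : ℂ) = y at *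
  rw [hv']
  linear_combination (y * b) * Complex.I_mul_I

theorem wirt_comp_mul (c : ℂˣ) (hf : SmoothAt f (c * t)) :
    wirt (fun s => f (c * s)) t = c * wirt f (c * t) := by
  rw [wirt, realDiff_comp_mul c hf, realDiff_comp_mul c hf, realDiff_apply, realDiff_apply]
  simp only [map_mul, Complex.conj_I, map_one]
  linear_combination (-(1 / 2 : ℂ) * c * wirt f (c * t)
    + (1 / 2 : ℂ) * conj (c : ℂ) * wirtBar f (c * t)) * Complex.I_mul_I

theorem wirtBar_comp_mul (c : ℂˣ) (hf : SmoothAt f (c * t)) :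
    wirtBar (fun s => f (c * s)) t = conj (c : ℂ) * wirtBar f (c * t) := by
  rw [wirtBar, realDiff_comp_mul c hf, realDiff_comp_mul c hf, realDiff_apply, realDiff_apply]
  simp only [map_mul, Complex.conj_I, map_one]
  linear_combination ((1 / 2 : ℂ) * c * wirt f (c * t)
    - (1 / 2 : ℂ) * conj (c : ℂ) * wirtBar f (c * t)) * Complex.I_mul_I

theorem smoothAt_comp_mul (c : ℂˣ) (hf : SmoothAt f (c * t)) :
    SmoothAt (fun s => f (c * s)) t :=
  ContMDiffAt.comp t hf (contMDiff_mul_left (I := 𝓘(ℝ, ℂ)) (a := c)).contMDiffAt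

theorem realDiff_comp_unitOf (f : ℂˣ → ℂ) (t : ℂˣ) (v : ℂ) :
    ((fun s => realDiff f s v) ∘ unitOf) =ᶠ[𝓝 (t : ℂ)]
      fun z => fderiv ℝ (f ∘ unitOf) z v := by
  filter_upwards [eventually_coe_unitOf t] with z hz
  simp only [Function.comp_apply, realDiff_eq, hz]

theorem smoothAt_realDiff (hf : SmoothAt f t) (v : ℂ) : SmoothAt (fun s => realDiff f s v) t := by
  refine contMDiffAt_units_iff.2 (ContDiffAt.congr_of_eventuallyEq ?_ (realDiff_comp_unitOf f t v))
  exact (hf.contDiffAt.fderiv_right (m := ∞) (by simp)).clm_apply contDiffAt_const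

theorem smoothAt_wirt (hf : SmoothAt f t) : SmoothAt (wirt f) t :=
  smoothAt_mul (smoothAt_const _) (smoothAt_sub (smoothAt_realDiff hf 1)
    (smoothAt_mul (smoothAt_const _) (smoothAt_realDiff hf Complex.I)))

theorem smoothAt_wirtBar (hf : SmoothAt f t) : SmoothAt (wirtBar f) t :=
  smoothAt_mul (smoothAt_const _) (smoothAt_add (smoothAt_realDiff hf 1)
    (smoothAt_mul (smoothAt_const _) (smoothAt_realDiff hf Complex.I)))

/-- Symmetry of the second real derivative; it is the source of `∂∂̄ = ∂̄∂`. -/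
theorem realDiff_realDiff_comm (hf : SmoothAt f t) (v w : ℂ) :
    realDiff (fun s => realDiff f s v) t w = realDiff (fun s => realDiff f s w) t v := by
  have key : ∀ v w : ℂ, realDiff (fun s => realDiff f s v) t w
      = fderiv ℝ (fderiv ℝ (f ∘ unitOf)) (t : ℂ) w v := by
    intro v w
    rw [realDiff_eq, (realDiff_comp_unitOf f t v).fderiv_eq]
    have h : DifferentiableAt ℝ (fderiv ℝ (f ∘ unitOf)) (t : ℂ) :=
      (hf.contDiffAt.fderiv_right (m := ∞) (by simp)).differentiableAt (by simp)
    have := (h.hasFDerivAt.clm_apply (hasFDerivAt_const v (t : ℂ))).fderiv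
    rw [this]
    simp
  rw [key, key]
  exact hf.contDiffAt.isSymmSndFDerivAt (by simpa using WithTop.coe_le_coe.2 (le_top : (2 : ℕ∞) ≤ ⊤)) w v

theorem wirt_wirtBar_comm (hf : SmoothAt f t) :
    wirt (wirtBar f) t = wirtBar (wirt f) t := by
  have h1 := smoothAt_realDiff hf 1
  have hI := smoothAt_realDiff hf Complex.I
  have hI' := smoothAt_mul (smoothAt_const Complex.I) hI
  have e1 : wirt (wirtBar f) t = (1 / 2 : ℂ) * (wirt (fun s => realDiff f s 1) t
      + Complex.I * wirt (fun s => realDiff f s Complex.I) t) := by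
    change wirt (fun s => (1 / 2 : ℂ) * (realDiff f s 1 + Complex.I * realDiff f s Complex.I)) t = _
    rw [wirt_mul (smoothAt_const _) (smoothAt_add h1 hI'), wirt_const, wirt_add h1 hI',
      wirt_mul (smoothAt_const _) hI, wirt_const]
    ring
  have e2 : wirtBar (wirt f) t = (1 / 2 : ℂ) * (wirtBar (fun s => realDiff f s 1) t
      - Complex.I * wirtBar (fun s => realDiff f s Complex.I) t) := by
    change wirtBar
      (fun s => (1 / 2 : ℂ) * (realDiff f s 1 - Complex.I * realDiff f s Complex.I)) t = _
    rw [wirtBar_mul (smoothAt_const _) (smoothAt_sub h1 hI'), wirtBar_const, wirtBar_sub h1 hI',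
      wirtBar_mul (smoothAt_const _) hI, wirtBar_const]
    ring
  rw [e1, e2]
  simp only [wirt, wirtBar]
  rw [realDiff_realDiff_comm hf Complex.I 1]
  ring

/-- The chain rule for the exponential of a real function. -/
theorem realDiff_cexp (hf : SmoothAt f t) :
    realDiff (fun s => Complex.exp (f s)) t = Complex.exp (f t) • realDiff f t := by
  simp only [realDiff_eq]
  have := hf.differentiableAt.hasFDerivAt.cexp.fderiv
  simp only [Function.comp_apply, unitOf_coe] at this
  exact this

theorem wirt_cexp (hf : SmoothAt f t) :
    wirt (fun s => Complex.exp (f s)) t = Complex.exp (f t) * wirt f t := by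
  simp only [wirt, realDiff_cexp hf, _root_.smul_apply, smul_eq_mul]; ring

theorem smoothAt_ofReal {u : ℂˣ → ℝ} (hu : ContMDiffAt 𝓘(ℝ, ℂ) 𝓘(ℝ, ℝ) ∞ u t) :
    SmoothAt (fun s => (u s : ℂ)) t :=
  contMDiffAt_units_iff.2
    (Complex.ofRealCLM.contDiff.contDiffAt.comp _ (contMDiffAt_units_iff.1 hu))

end calculus

/-! ### Matrix-valued functions on `ℂ*` -/

section matrixCalculus

variable {ι : Type*}

/-- All entries of `M` are smooth near `t`. -/
def MatSmooth (M : ℂˣ → Matrix ι ι ℂ) (t : ℂˣ) : Prop := ∀ i j, SmoothAt (fun s => M s i j) t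

variable {M N : ℂˣ → Matrix ι ι ℂ} {t : ℂˣ}

theorem matWirt_congr (h : M =ᶠ[𝓝 t] N) : matWirt M t = matWirt N t := by
  ext i j
  exact wirt_congr (h.mono fun s hs => by simp only [hs])

theorem matWirtBar_congr (h : M =ᶠ[𝓝 t] N) : matWirtBar M t = matWirtBar N t := by
  ext i j
  exact wirtBar_congr (h.mono fun s hs => by simp only [hs])

theorem MatSmooth.add (hM : MatSmooth M t) (hN : MatSmooth N t) :
    MatSmooth (fun s => M s + N s) t := fun i j => smoothAt_add (hM i j) (hN i j)

theorem MatSmooth.sub (hM : MatSmooth M t) (hN : MatSmooth N t) :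
    MatSmooth (fun s => M s - N s) t := fun i j => smoothAt_sub (hM i j) (hN i j)

theorem MatSmooth.smul {f : ℂˣ → ℂ} (hf : SmoothAt f t) (hM : MatSmooth M t) :
    MatSmooth (fun s => f s • M s) t := fun i j => smoothAt_mul hf (hM i j)

theorem MatSmooth.conjTranspose (hM : MatSmooth M t) : MatSmooth (fun s => (M s)ᴴ) t :=
  fun i j => smoothAt_conj (hM j i)

theorem MatSmooth.matWirt (hM : MatSmooth M t) : MatSmooth (matWirt M) t :=
  fun i j => smoothAt_wirt (hM i j)

theorem matWirt_const (K : Matrix ι ι ℂ) : matWirt (fun _ => K) t = 0 := by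
  ext i j; exact wirt_const _

theorem matWirtBar_const (K : Matrix ι ι ℂ) : matWirtBar (fun _ => K) t = 0 := by
  ext i j; exact wirtBar_const _

theorem matWirtBar_add (hM : MatSmooth M t) (hN : MatSmooth N t) :
    matWirtBar (fun s => M s + N s) t = matWirtBar M t + matWirtBar N t := by
  ext i j; exact wirtBar_add (hM i j) (hN i j)

theorem matWirtBar_sub (hM : MatSmooth M t) (hN : MatSmooth N t) :
    matWirtBar (fun s => M s - N s) t = matWirtBar M t - matWirtBar N t := by
  ext i j; exact wirtBar_sub (hM i j) (hN i j)

theorem matWirt_smul {f : ℂˣ → ℂ} (hf : SmoothAt f t) (hM : MatSmooth M t) :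
    matWirt (fun s => f s • M s) t = wirt f t • M t + f t • matWirt M t := by
  ext i j; exact wirt_mul hf (hM i j)

theorem matWirtBar_smul {f : ℂˣ → ℂ} (hf : SmoothAt f t) (hM : MatSmooth M t) :
    matWirtBar (fun s => f s • M s) t = wirtBar f t • M t + f t • matWirtBar M t := by
  ext i j; exact wirtBar_mul hf (hM i j)

theorem matWirtBar_conjTranspose (hM : MatSmooth M t) :
    matWirtBar (fun s => (M s)ᴴ) t = (matWirt M t)ᴴ := by
  ext i j; exact wirtBar_conj (hM j i)

theorem matWirt_matWirtBar_comm (hM : MatSmooth M t) :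
    matWirt (matWirtBar M) t = matWirtBar (matWirt M) t := by
  ext i j; exact wirt_wirtBar_comm (hM i j)

theorem matWirtBar_eq_zero_of_hol (hM : ∀ i j, HolAt (fun s => M s i j) t) :
    matWirtBar M t = 0 := by
  ext i j; exact wirtBar_eq_zero_of_hol (hM i j)

variable [Fintype ι]

theorem MatSmooth.mul (hM : MatSmooth M t) (hN : MatSmooth N t) :
    MatSmooth (fun s => M s * N s) t := fun i j => by
  simp only [Matrix.mul_apply]
  exact smoothAt_sum fun k _ => smoothAt_mul (hM i k) (hN k j)

theorem MatSmooth.trace (hM : MatSmooth M t) : SmoothAt (fun s => (M s).trace) t :=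
  smoothAt_sum fun i _ => hM i i

theorem matWirt_mul (hM : MatSmooth M t) (hN : MatSmooth N t) :
    matWirt (fun s => M s * N s) t = matWirt M t * N t + M t * matWirt N t := by
  ext i j
  simp only [matWirt, Matrix.of_apply, Matrix.mul_apply, Matrix.add_apply]
  rw [wirt_sum fun k _ => smoothAt_mul (hM i k) (hN k j), ← Finset.sum_add_distrib]
  exact Finset.sum_congr rfl fun k _ => wirt_mul (hM i k) (hN k j)

theorem matWirtBar_mul (hM : MatSmooth M t) (hN : MatSmooth N t) :
    matWirtBar (fun s => M s * N s) t = matWirtBar M t * N t + M t * matWirtBar N t := by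
  ext i j
  simp only [matWirtBar, Matrix.of_apply, Matrix.mul_apply, Matrix.add_apply]
  rw [wirtBar_sum fun k _ => smoothAt_mul (hM i k) (hN k j), ← Finset.sum_add_distrib]
  exact Finset.sum_congr rfl fun k _ => wirtBar_mul (hM i k) (hN k j)

theorem wirt_trace (hM : MatSmooth M t) :
    wirt (fun s => (M s).trace) t = (matWirt M t).trace := wirt_sum fun i _ => hM i i

theorem wirtBar_trace (hM : MatSmooth M t) :
    wirtBar (fun s => (M s).trace) t = (matWirtBar M t).trace := wirtBar_sum fun i _ => hM i i

variable [DecidableEq ι]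

theorem MatSmooth.det (hM : MatSmooth M t) : SmoothAt (fun s => (M s).det) t := by
  simp only [Matrix.det_apply']
  exact smoothAt_sum fun σ _ => smoothAt_mul (smoothAt_const _) (smoothAt_prod fun i _ => hM _ _)

theorem MatSmooth.inv (hM : MatSmooth M t) (h0 : (M t).det ≠ 0) :
    MatSmooth (fun s => (M s)⁻¹) t := fun i j => by
  simp only [Matrix.inv_def, Ring.inverse_eq_inv', Matrix.smul_apply, smul_eq_mul,
    Matrix.adjugate_apply]
  refine smoothAt_mul (smoothAt_inv hM.det h0) (MatSmooth.det fun k l => ?_)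
  by_cases h : k = j
  · subst h; simpa using smoothAt_const _
  · simpa [Matrix.updateRow_ne h] using hM k l

/-- Differentiate `M⁻¹ M = 1`, an identity that has to hold on a neighbourhood for this purpose. -/
theorem matWirtBar_inv (hM : MatSmooth M t) (h0 : ∀ᶠ s in 𝓝 t, (M s).det ≠ 0) :
    matWirtBar (fun s => (M s)⁻¹) t = -((M t)⁻¹ * matWirtBar M t * (M t)⁻¹) := by
  have h1 := hM.inv h0.self_of_nhds
  have h2 : matWirtBar (fun s => (M s)⁻¹ * M s) t = 0 := by
    rw [matWirtBar_congr (N := fun _ => 1), matWirtBar_const]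
    filter_upwards [h0] with s hs using Matrix.nonsing_inv_mul _ (isUnit_iff_ne_zero.2 hs)
  rw [matWirtBar_mul h1 hM] at h2
  have h3 := congrArg (· * (M t)⁻¹) h2
  have h4 : M t * (M t)⁻¹ = 1 := Matrix.mul_nonsing_inv _ (isUnit_iff_ne_zero.2 h0.self_of_nhds)
  simp only [add_mul, mul_assoc, h4, mul_one, zero_mul] at h3
  rw [eq_neg_of_add_eq_zero_left h3, mul_assoc]

end matrixCalculus

/-! ### A Bochner formula -/

section bochner

variable {ι : Type*} [Fintype ι] [DecidableEq ι]

theorem MatSmooth.chernMatrix {G : ℂˣ → Matrix ι ι ℂ} {t : ℂˣ} (hG : MatSmooth G t)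
    (h0 : (G t).det ≠ 0) : MatSmooth (chernMatrix G) t := (hG.inv h0).mul hG.matWirt

theorem MatSmooth.adjMatrix {G A : ℂˣ → Matrix ι ι ℂ} {t : ℂˣ} (hG : MatSmooth G t)
    (h0 : (G t).det ≠ 0) (hA : MatSmooth A t) : MatSmooth (adjMatrix G A) t :=
  ((hG.inv h0).mul hA.conjTranspose).mul hG

/-- For a holomorphic matrix `A`, `∂̄` of the adjoint of `A` is the adjoint of the covariant
derivative of `A`. -/
theorem matWirtBar_adjMatrix {G A : ℂˣ → Matrix ι ι ℂ} {U : Set ℂˣ} (hU : IsOpen U)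
    (hG : ∀ t ∈ U, MatSmooth G t) (hh : ∀ t ∈ U, (G t).IsHermitian) (h0 : ∀ t ∈ U, (G t).det ≠ 0)
    (hA : ∀ t ∈ U, MatSmooth A t) {t : ℂˣ} (ht : t ∈ U) :
    matWirtBar (adjMatrix G A) t =
      (G t)⁻¹ * (matWirt A t + chernMatrix G t * A t - A t * chernMatrix G t)ᴴ * G t := by
  have hUt : ∀ᶠ s in 𝓝 t, s ∈ U := hU.mem_nhds ht
  have hGi := (hG t ht).inv (h0 t ht)
  have hu : IsUnit (G t).det := isUnit_iff_ne_zero.2 (h0 t ht)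
  -- Hermitian symmetry of `G` near `t` exchanges `∂G` and `∂̄G` under the adjoint.
  have e1 : (matWirt G t)ᴴ = matWirtBar G t := by
    rw [← matWirtBar_conjTranspose (hG t ht)]
    exact matWirtBar_congr (hUt.mono fun s hs => hh s hs)
  have e2 : ((G t)⁻¹)ᴴ = (G t)⁻¹ := by
    rw [Matrix.conjTranspose_nonsing_inv, (hh t ht).eq]
  change matWirtBar (fun s => (G s)⁻¹ * (A s)ᴴ * G s) t = _
  rw [matWirtBar_mul (hGi.mul (hA t ht).conjTranspose) (hG t ht),
    matWirtBar_mul hGi (hA t ht).conjTranspose, matWirtBar_conjTranspose (hA t ht),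
    matWirtBar_inv (hG t ht) (hUt.mono fun s hs => h0 s hs)]
  simp only [chernMatrix, Matrix.conjTranspose_sub, Matrix.conjTranspose_add,
    Matrix.conjTranspose_mul, e1, e2]
  have h4 : (G t)⁻¹ * G t = 1 := Matrix.nonsing_inv_mul _ hu
  simp only [mul_add, add_mul, mul_sub, sub_mul, mul_assoc, h4, mul_one, neg_mul]
  abel

/-- The Laplacian of the squared norm of a holomorphic endomorphism is a curvature term plus the
squared norm of its covariant derivative. The second term is nonnegative, so only the curvature term
matters for a lower bound. -/
theorem wirtBar_wirt_trace_adjMatrix {G A : ℂˣ → Matrix ι ι ℂ} {U : Set ℂˣ} (hU : IsOpen U)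
    (hG : ∀ t ∈ U, MatSmooth G t) (hh : ∀ t ∈ U, (G t).IsHermitian) (h0 : ∀ t ∈ U, (G t).det ≠ 0)
    (hA : ∀ t ∈ U, MatSmooth A t) (hAbar : ∀ t ∈ U, matWirtBar A t = 0)
    (hB : ∀ t ∈ U, matWirt (adjMatrix G A) t
      + (chernMatrix G t * adjMatrix G A t - adjMatrix G A t * chernMatrix G t) = 0)
    {t : ℂˣ} (ht : t ∈ U) :
    wirtBar (wirt fun s => (A s * adjMatrix G A s).trace) t =
      (matWirtBar (chernMatrix G) t * (A t * adjMatrix G A t - adjMatrix G A t * A t)).trace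
      + ((matWirt A t + chernMatrix G t * A t - A t * chernMatrix G t) * ((G t)⁻¹ *
        (matWirt A t + chernMatrix G t * A t - A t * chernMatrix G t)ᴴ * G t)).trace := by
  have hBs : ∀ s ∈ U, MatSmooth (adjMatrix G A) s := fun s hs => (hG s hs).adjMatrix (h0 s hs) (hA s hs)
  have hCs : ∀ s ∈ U, MatSmooth (chernMatrix G) s := fun s hs => (hG s hs).chernMatrix (h0 s hs)
  have hP : ∀ s ∈ U, MatSmooth
      (fun s => matWirt A s + chernMatrix G s * A s - A s * chernMatrix G s) s := fun s hs =>
    ((hA s hs).matWirt.add ((hCs s hs).mul (hA s hs))).sub ((hA s hs).mul (hCs s hs))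
  have hUt : ∀ᶠ s in 𝓝 t, s ∈ U := hU.mem_nhds ht
  -- The trace kills the commutator of the Chern matrix with `A A^†`, so `∂` can be replaced by the
  -- covariant derivative, which annihilates `A^†` by `hB`.
  have e1 : ∀ s ∈ U, wirt (fun s => (A s * adjMatrix G A s).trace) s =
      ((matWirt A s + chernMatrix G s * A s - A s * chernMatrix G s) * adjMatrix G A s).trace := by
    intro s hs
    rw [wirt_trace ((hA s hs).mul (hBs s hs)), matWirt_mul (hA s hs) (hBs s hs),
      eq_neg_of_add_eq_zero_left (hB s hs)]
    simp only [add_mul, sub_mul, mul_neg, mul_sub, Matrix.trace_add, Matrix.trace_sub,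
      Matrix.trace_neg]
    have := Matrix.trace_mul_comm (A s * adjMatrix G A s) (chernMatrix G s)
    simp only [mul_assoc] at this ⊢
    rw [this]
    ring
  rw [wirtBar_congr (hUt.mono e1), wirtBar_trace ((hP t ht).mul (hBs t ht)),
    matWirtBar_mul (hP t ht) (hBs t ht), matWirtBar_adjMatrix hU hG hh h0 hA ht,
    Matrix.trace_add]
  congr 1
  -- Since `∂̄A = 0`, only `∂̄` of the Chern matrix survives, in a commutator with `A`; cyclicity of
  -- the trace moves that commutator onto `A` and `A^†`.
  rw [matWirtBar_sub ((hA t ht).matWirt.add ((hCs t ht).mul (hA t ht))) ((hA t ht).mul (hCs t ht)),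
    matWirtBar_add (hA t ht).matWirt ((hCs t ht).mul (hA t ht)),
    matWirtBar_mul (hCs t ht) (hA t ht), matWirtBar_mul (hA t ht) (hCs t ht),
    ← matWirt_matWirtBar_comm (hA t ht), hAbar t ht,
    matWirt_congr (hUt.mono hAbar : matWirtBar A =ᶠ[𝓝 t] fun _ => 0), matWirt_const]
  simp only [mul_zero, add_zero, zero_add, zero_mul, sub_mul, mul_sub, Matrix.trace_sub, mul_assoc]
  congr 1
  have := Matrix.trace_mul_comm (A t) (matWirtBar (chernMatrix G) t * adjMatrix G A t)
  simpa only [mul_assoc] using this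

end bochner

/-! ### Non-existence of entire positive solutions of `m'' ≥ K m²` -/

section blowUp

theorem monotoneOn_Ici_of_hasDerivAt_nonneg {f f' : ℝ → ℝ} {a : ℝ}
    (hf : ∀ x, HasDerivAt f (f' x) x) (h : ∀ x, a ≤ x → 0 ≤ f' x) : MonotoneOn f (Ici a) := by
  refine monotoneOn_of_deriv_nonneg (convex_Ici a)
    (fun x _ => (hf x).continuousAt.continuousWithinAt)
    (fun x _ => (hf x).differentiableAt.differentiableWithinAt) fun x hx => ?_
  rw [(hf x).deriv]
  exact h x (interior_subset hx)

/-- Multiplying `m'' ≥ K m²` by `m' > 0` and integrating gives an energy bound, eventually `m' ≥ k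
m^(3/2)`. Then `m^(-1/2)` decreases at a definite rate and would reach zero at a finite point. -/
theorem not_entire_of_pos_deriv {m r s : ℝ → ℝ} {K x₀ : ℝ} (hK : 0 < K)
    (hm : ∀ x, HasDerivAt m (r x) x) (hr : ∀ x, HasDerivAt r (s x) x) (hpos : ∀ x, 0 < m x)
    (hs : ∀ x, K * m x ^ 2 ≤ s x) (h0 : 0 < r x₀) : False := by
  have hs0 : ∀ x, 0 ≤ s x := fun x => le_trans (by positivity) (hs x)
  have hrm : ∀ x, x₀ ≤ x → r x₀ ≤ r x := fun x hx =>
    monotoneOn_Ici_of_hasDerivAt_nonneg hr (fun x _ => hs0 x) self_mem_Ici hx hx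
  have hE : ∀ x, x₀ ≤ x → r x₀ ^ 2 - 2 * K / 3 * m x₀ ^ 3 ≤ r x ^ 2 - 2 * K / 3 * m x ^ 3 := by
    intro x hx
    refine monotoneOn_Ici_of_hasDerivAt_nonneg (a := x₀)
      (f := fun x => r x ^ 2 - 2 * K / 3 * m x ^ 3)
      (fun x => ((hr x).pow 2).sub (((hm x).pow 3).const_mul (2 * K / 3))) (fun x hx => ?_)
      self_mem_Ici hx hx
    have h1 : 0 < r x := h0.trans_le (hrm x hx)
    have h2 := mul_nonneg h1.le (sub_nonneg.2 (hs x))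
    norm_num
    nlinarith
  have hlin : ∀ x, x₀ ≤ x → r x₀ * (x - x₀) ≤ m x := by
    intro x hx
    have := monotoneOn_Ici_of_hasDerivAt_nonneg (a := x₀) (f := fun x => m x - r x₀ * x)
      (fun x => (hm x).sub ((hasDerivAt_id x).const_mul (r x₀)))
      (fun x hx => by simpa using hrm x hx) self_mem_Ici hx hx
    simp only at this
    nlinarith [hpos x₀]
  set E := r x₀ ^ 2 - 2 * K / 3 * m x₀ ^ 3 with hEdef
  -- Once `m ≥ b`, the constant `E` is absorbed by half of the cubic term; `b ≥ 1` is used for `m ≤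
  -- m³`. Linear growth guarantees `m ≥ b` from `x₁` on.
  set b := max 1 (3 * |E| / K) with hb
  set x₁ := x₀ + b / r x₀ with hx₁
  have hb1 : 1 ≤ b := le_max_left _ _
  have hb2 : |E| ≤ K / 3 * b := by
    have : 3 * |E| / K ≤ b := le_max_right _ _
    rw [div_le_iff₀ hK] at this
    linarith
  have hx01 : x₀ ≤ x₁ := by
    have : 0 ≤ b / r x₀ := by positivity
    linarith
  set k := Real.sqrt (K / 3) with hk
  have hk0 : 0 < k := Real.sqrt_pos.2 (by positivity)
  have hk2 : k ^ 2 = K / 3 := Real.sq_sqrt (by positivity)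
  have hbig : ∀ x, x₁ ≤ x → k * (m x * Real.sqrt (m x)) ≤ r x := by
    intro x hx
    have hx0 := hx01.trans hx
    have h1 : b ≤ m x := by
      refine le_trans ?_ (hlin x hx0)
      have : b / r x₀ ≤ x - x₀ := by linarith
      rw [div_le_iff₀ h0] at this
      linarith
    have h2 : m x ≤ m x ^ 3 := by
      have : 1 ≤ m x := hb1.trans h1
      nlinarith [mul_nonneg (sub_nonneg.2 this) (hpos x).le, mul_nonneg (mul_nonneg (sub_nonneg.2 this) (hpos x).le) (hpos x).le]
    have h3 : K / 3 * m x ^ 3 ≤ r x ^ 2 := by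
      have := hE x hx0
      have h4 : -E ≤ K / 3 * m x ^ 3 := by
        refine (neg_le_abs E).trans (hb2.trans ?_)
        have : b ≤ m x ^ 3 := h1.trans h2
        gcongr
      linarith
    refine abs_le_of_sq_le_sq' ?_ (h0.le.trans (hrm x hx0)) |>.2
    have h5 : Real.sqrt (m x) ^ 2 = m x := Real.sq_sqrt (hpos x).le
    calc (k * (m x * Real.sqrt (m x))) ^ 2 = k ^ 2 * (m x ^ 2 * Real.sqrt (m x) ^ 2) := by ring
      _ = K / 3 * m x ^ 3 := by rw [hk2, h5]; ring
      _ ≤ _ := h3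
  have hsq : ∀ x, 0 < Real.sqrt (m x) := fun x => Real.sqrt_pos.2 (hpos x)
  -- The derivative of `-m^(-1/2)` is `m' / (2 m^(3/2))`, at least `k / 2` beyond `x₁`.
  have hf : ∀ x, HasDerivAt (fun x => -(Real.sqrt (m x))⁻¹ - k / 2 * x)
      (-(-(r x / (2 * Real.sqrt (m x))) / Real.sqrt (m x) ^ 2) - k / 2 * 1) x := fun x =>
    ((((hm x).sqrt (hpos x).ne').inv (hsq x).ne').neg).sub ((hasDerivAt_id x).const_mul (k / 2))
  have hmono := monotoneOn_Ici_of_hasDerivAt_nonneg (a := x₁) hf fun x hx => by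
    have h1 := hbig x hx
    have h5 : Real.sqrt (m x) ^ 2 = m x := Real.sq_sqrt (hpos x).le
    have h6 : k / 2 ≤ r x / (2 * Real.sqrt (m x)) / Real.sqrt (m x) ^ 2 := by
      rw [h5, div_div, le_div_iff₀ (mul_pos (mul_pos two_pos (hsq x)) (hpos x))]
      linarith
    rw [neg_div, neg_neg]
    linarith
  -- The length after which an increase at rate `k / 2` brings `-m^(-1/2)` up to zero.
  set T := 2 / k * (Real.sqrt (m x₁))⁻¹ with hT
  have hT0 : 0 ≤ T := by positivity
  have h7 := hmono (a := x₁) self_mem_Ici (b := x₁ + T) (by simpa using hT0) (by simpa using hT0)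
  simp only at h7
  have h8 : k / 2 * T = (Real.sqrt (m x₁))⁻¹ := by
    rw [hT]; field_simp
  have h9 : 0 < (Real.sqrt (m (x₁ + T)))⁻¹ := inv_pos.2 (hsq _)
  have h10 : k / 2 * (x₁ + T) = k / 2 * x₁ + (Real.sqrt (m x₁))⁻¹ := by rw [mul_add, h8]
  linarith

/-- There is no positive function `m` on the real line with `m'' ≥ K m²`, where `K > 0`. -/
theorem not_entire_of_sq_le_deriv {m r s : ℝ → ℝ} {K : ℝ} (hK : 0 < K)
    (hm : ∀ x, HasDerivAt m (r x) x) (hr : ∀ x, HasDerivAt r (s x) x) (hpos : ∀ x, 0 < m x)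
    (hs : ∀ x, K * m x ^ 2 ≤ s x) : False := by
  -- The reflection `x ↦ -x` preserves the inequality and reverses the sign of the slope.
  have hne : ∀ x, ¬ r x < 0 := fun x hx => by
    refine not_entire_of_pos_deriv (m := fun x => m (-x)) (r := fun x => -r (-x))
      (s := fun x => s (-x)) (x₀ := -x) hK (fun y => ?_) (fun y => ?_) (fun y => hpos _)
      (fun y => hs _) (by simpa using hx)
    · simpa [Function.comp_def] using (hm (-y)).comp y (hasDerivAt_neg y)
    · convert! ((hr (-y)).comp y (hasDerivAt_neg y)).neg using 1
      ring
  have hz : ∀ x, r x = 0 := fun x => le_antisymm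
    (not_lt.1 fun h => not_entire_of_pos_deriv hK hm hr hpos hs h) (not_lt.1 (hne x))
  -- What remains is constant `m`, where the second derivative vanishes although `K m² > 0`.
  have h1 : HasDerivAt r 0 0 := by
    rw [show r = fun _ => 0 from funext hz]; exact hasDerivAt_const _ _
  have h2 := (hr 0).unique h1
  have h3 := hs 0
  have h4 := hpos 0
  rw [h2] at h3
  nlinarith [mul_pos hK (pow_pos h4 2)]

end blowUp

/-! ### Commutators of nilpotent matrices with their adjoints -/

section nilpotentCommutator

open scoped ComplexOrder

variable {ι : Type*} [Fintype ι]

theorem trace_mul_conjTranspose_re (A : Matrix ι ι ℂ) :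
    (A * Aᴴ).trace = ((∑ i, ∑ j, ‖A i j‖ ^ 2 : ℝ) : ℂ) := by
  simp [Matrix.trace, Matrix.mul_apply, Complex.mul_conj, Complex.normSq_eq_norm_sq]

theorem eq_zero_of_trace_mul_conjTranspose_re {A : Matrix ι ι ℂ} (h : (A * Aᴴ).trace.re = 0) :
    A = 0 := by
  rw [trace_mul_conjTranspose_re, Complex.ofReal_re,
    Finset.sum_eq_zero_iff_of_nonneg fun i _ => Finset.sum_nonneg fun j _ => by positivity] at h
  ext i j
  have := h i (Finset.mem_univ i)
  rw [Finset.sum_eq_zero_iff_of_nonneg fun j _ => by positivity] at this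
  simpa using this j (Finset.mem_univ j)

theorem trace_mul_conjTranspose_re_nonneg (A : Matrix ι ι ℂ) : 0 ≤ (A * Aᴴ).trace.re := by
  rw [trace_mul_conjTranspose_re, Complex.ofReal_re]
  positivity

/-- The squared norm of the commutator of `A` and `Aᴴ`. -/
def commNormSq (A : Matrix ι ι ℂ) : ℝ := ((A * Aᴴ - Aᴴ * A) * (A * Aᴴ - Aᴴ * A)).trace.re

theorem commNormSq_eq (A : Matrix ι ι ℂ) :
    commNormSq A = ((A * Aᴴ - Aᴴ * A) * (A * Aᴴ - Aᴴ * A)ᴴ).trace.re := by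
  rw [commNormSq, Matrix.conjTranspose_sub, Matrix.conjTranspose_mul, Matrix.conjTranspose_mul,
    Matrix.conjTranspose_conjTranspose]

variable [DecidableEq ι]

/-- If `A` is normal, then `A Aᴴ` is nilpotent as well as Hermitian. A Hermitian matrix with zero
square is zero, so repeated halving of the exponent `2^k` gives `A Aᴴ = 0`. -/
theorem eq_zero_of_nilpotent_of_commute_conjTranspose {A : Matrix ι ι ℂ} {k : ℕ} (hA : A ^ k = 0)
    (hc : Commute A Aᴴ) : A = 0 := by
  have h1 : ∀ (j : ℕ) (H : Matrix ι ι ℂ), H.IsHermitian → H ^ (2 ^ j) = 0 → H = 0 := by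
    intro j
    induction j with
    | zero => intro H _ h; simpa using h
    | succ j ih =>
      intro H hH h
      refine ih H hH (Matrix.self_mul_conjTranspose_eq_zero.1 ?_)
      rw [(hH.pow _).eq, ← pow_add, ← two_mul, ← pow_succ']
      exact h
  have h2 : (A * Aᴴ) ^ (2 ^ k) = 0 := by
    rw [hc.mul_pow, ← Nat.sub_add_cancel (Nat.lt_two_pow_self (n := k)).le, pow_add, hA]
    simp
  exact Matrix.self_mul_conjTranspose_eq_zero.1 (h1 k _ (Matrix.isHermitian_mul_conjTranspose_self A) h2)

/-- On the compact set of nilpotent matrices of norm one the commutator with the adjoint never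
vanishes, so its squared norm has a positive minimum. Both sides are homogeneous of degree four. -/
theorem exists_le_commNormSq (ι : Type*) [Fintype ι] [DecidableEq ι] (k : ℕ) :
    ∃ K : ℝ, 0 < K ∧ ∀ A : Matrix ι ι ℂ, A ^ k = 0 →
      K * (A * Aᴴ).trace.re ^ 2 ≤ commNormSq A := by
  let S : Set (Matrix ι ι ℂ) := {A | A ^ k = 0 ∧ (A * Aᴴ).trace.re = 1}
  have hct : Continuous fun A : Matrix ι ι ℂ => (A * Aᴴ).trace.re :=
    Complex.continuous_re.comp (continuous_id.matrix_mul continuous_id.matrix_conjTranspose).matrix_trace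
  have hcc : Continuous (commNormSq : Matrix ι ι ℂ → ℝ) := by
    have h : Continuous fun A : Matrix ι ι ℂ => A * Aᴴ - Aᴴ * A :=
      (continuous_id.matrix_mul continuous_id.matrix_conjTranspose).sub
        (continuous_id.matrix_conjTranspose.matrix_mul continuous_id)
    exact Complex.continuous_re.comp (h.matrix_mul h).matrix_trace
  have hS : IsClosed S := (isClosed_eq (continuous_pow k) continuous_const).inter
    (isClosed_eq hct continuous_const)
  have hSc : IsCompact S := by
    have hbig : IsCompact (Set.pi univ fun _ : ι => Set.pi univ fun _ : ι =>
        Metric.closedBall (0 : ℂ) 1) :=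
      isCompact_univ_pi fun _ => isCompact_univ_pi fun _ => isCompact_closedBall 0 1
    refine IsCompact.of_isClosed_subset (X := Matrix ι ι ℂ) hbig hS ?_
    intro A hA i _ j _
    have h1 := hA.2
    rw [trace_mul_conjTranspose_re, Complex.ofReal_re] at h1
    have h2 : ‖A i j‖ ^ 2 ≤ 1 := by
      rw [← h1]
      refine (Finset.single_le_sum (f := fun j => ‖A i j‖ ^ 2) (fun j _ => by positivity)
        (Finset.mem_univ j)).trans ?_
      exact Finset.single_le_sum (f := fun i => ∑ j, ‖A i j‖ ^ 2) (fun i _ => by positivity)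
        (Finset.mem_univ i)
    rw [mem_closedBall_zero_iff]
    nlinarith [norm_nonneg (A i j)]
  have hpos : ∀ A ∈ S, 0 < commNormSq A := by
    intro A hA
    rw [commNormSq_eq]
    refine lt_of_le_of_ne (trace_mul_conjTranspose_re_nonneg _) fun h => ?_
    have h1 := eq_zero_of_trace_mul_conjTranspose_re h.symm
    have h2 := eq_zero_of_nilpotent_of_commute_conjTranspose hA.1 (sub_eq_zero.1 h1)
    have h3 := hA.2
    simp [h2] at h3
  obtain ⟨K, hK, hKS⟩ : ∃ K : ℝ, 0 < K ∧ ∀ A ∈ S, K ≤ commNormSq A := by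
    -- The set is empty, for example, when `k ≤ 1`; any positive constant then works.
    rcases S.eq_empty_or_nonempty with h | h
    · exact ⟨1, one_pos, by simp [h]⟩
    · obtain ⟨A, hA, hmin⟩ := hSc.exists_isMinOn h hcc.continuousOn
      exact ⟨_, hpos A hA, fun B hB => hmin hB⟩
  refine ⟨K, hK, fun A hA => ?_⟩
  rcases (trace_mul_conjTranspose_re_nonneg A).eq_or_lt with h | h
  · rw [← h, commNormSq_eq]
    simpa using trace_mul_conjTranspose_re_nonneg (A * Aᴴ - Aᴴ * A)
  · set N := (A * Aᴴ).trace.re with hN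
    -- The scalar that normalizes `A` to norm one.
    set x : ℝ := (Real.sqrt N)⁻¹ with hx
    have hx2 : x ^ 2 * N = 1 := by
      rw [hx, inv_pow, Real.sq_sqrt h.le, inv_mul_cancel₀ h.ne']
    have hmem : (x : ℂ) • A ∈ S := by
      refine ⟨by rw [smul_pow, hA, smul_zero], ?_⟩
      rw [Matrix.conjTranspose_smul, Matrix.smul_mul, Matrix.mul_smul, smul_smul,
        Matrix.trace_smul, Complex.star_def, Complex.conj_ofReal, ← Complex.ofReal_mul, smul_eq_mul,
        Complex.re_ofReal_mul, ← hN, ← hx2]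
      ring
    have h1 := hKS _ hmem
    have h2 : commNormSq ((x : ℂ) • A) = x ^ 4 * commNormSq A := by
      simp only [commNormSq, Matrix.conjTranspose_smul, Matrix.smul_mul, Matrix.mul_smul,
        Complex.star_def, Complex.conj_ofReal, smul_smul, ← smul_sub, Matrix.trace_smul,
        ← Complex.ofReal_mul, smul_eq_mul, Complex.re_ofReal_mul]
      ring
    rw [h2] at h1
    have h3 : K * N ^ 2 ≤ (x ^ 4 * commNormSq A) * N ^ 2 := by gcongr
    have h4 : x ^ 4 * commNormSq A * N ^ 2 = commNormSq A * (x ^ 2 * N) ^ 2 := by ring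
    rw [h4, hx2] at h3
    simpa using h3

open scoped MatrixOrder in
theorem exists_conjTranspose_mul_self {G : Matrix ι ι ℂ} (hG : G.PosDef) :
    ∃ L : Matrix ι ι ℂ, IsUnit L.det ∧ G = Lᴴ * L := by
  obtain ⟨L, hL⟩ := CStarAlgebra.nonneg_iff_eq_star_mul_self.mp hG.posSemidef.nonneg
  refine ⟨L, ?_, hL⟩
  have h := (Matrix.isUnit_iff_isUnit_det _).1 hG.isUnit
  rw [hL, Matrix.det_mul] at h
  exact isUnit_of_mul_isUnit_right h

variable {G L : Matrix ι ι ℂ}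

/-- Passing to a unitary frame: conjugation by `L` turns the adjoint for `G` into the conjugate
transpose, so the estimates for standard matrices apply to every metric with the same constant. -/
theorem adjoint_conj (hL : IsUnit L.det) (hG : G = Lᴴ * L) (A : Matrix ι ι ℂ) :
    L * (G⁻¹ * Aᴴ * G) * L⁻¹ = (L * A * L⁻¹)ᴴ := by
  have hL' : IsUnit (Lᴴ).det := by rw [Matrix.det_conjTranspose]; exact hL.star
  rw [hG, Matrix.mul_inv_rev, Matrix.conjTranspose_mul, Matrix.conjTranspose_mul,
    Matrix.conjTranspose_nonsing_inv]
  simp only [mul_assoc, Matrix.mul_nonsing_inv _ hL, mul_one, Matrix.mul_nonsing_inv_cancel_left _ _ hL]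

theorem trace_conj (hL : IsUnit L.det) (A : Matrix ι ι ℂ) : (L * A * L⁻¹).trace = A.trace := by
  rw [Matrix.trace_mul_comm, Matrix.nonsing_inv_mul_cancel_left _ _ hL]

theorem conj_mul_conj (hL : IsUnit L.det) (A B : Matrix ι ι ℂ) :
    (L * A * L⁻¹) * (L * B * L⁻¹) = L * (A * B) * L⁻¹ := by
  simp only [mul_assoc, Matrix.nonsing_inv_mul_cancel_left _ _ hL]

theorem trace_mul_adjoint_eq (hL : IsUnit L.det) (hG : G = Lᴴ * L) (A : Matrix ι ι ℂ) :
    (A * (G⁻¹ * Aᴴ * G)).trace = ((L * A * L⁻¹) * (L * A * L⁻¹)ᴴ).trace := by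
  rw [← adjoint_conj hL hG, conj_mul_conj hL, trace_conj hL]

theorem trace_mul_adjoint_re_nonneg (hG : G.PosDef) (A : Matrix ι ι ℂ) :
    0 ≤ (A * (G⁻¹ * Aᴴ * G)).trace.re := by
  obtain ⟨L, hL, hGL⟩ := exists_conjTranspose_mul_self hG
  rw [trace_mul_adjoint_eq hL hGL]
  exact trace_mul_conjTranspose_re_nonneg _

theorem eq_zero_of_trace_mul_adjoint (hG : G.PosDef) {A : Matrix ι ι ℂ}
    (h : (A * (G⁻¹ * Aᴴ * G)).trace.re = 0) : A = 0 := by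
  obtain ⟨L, hL, hGL⟩ := exists_conjTranspose_mul_self hG
  rw [trace_mul_adjoint_eq hL hGL] at h
  have h1 := eq_zero_of_trace_mul_conjTranspose_re h
  have h2 : L⁻¹ * (L * A * L⁻¹) * L = A := by
    simp only [mul_assoc, Matrix.nonsing_inv_mul_cancel_left _ _ hL, Matrix.nonsing_inv_mul _ hL,
      mul_one]
  rw [← h2, h1]; simp

theorem le_trace_commutator_sq {K : ℝ} {k : ℕ} (hK : ∀ A : Matrix ι ι ℂ, A ^ k = 0 →
      K * (A * Aᴴ).trace.re ^ 2 ≤ commNormSq A) (hG : G.PosDef) {A : Matrix ι ι ℂ}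
    (hA : A ^ k = 0) :
    K * (A * (G⁻¹ * Aᴴ * G)).trace.re ^ 2 ≤
      ((A * (G⁻¹ * Aᴴ * G) - (G⁻¹ * Aᴴ * G) * A) *
        (A * (G⁻¹ * Aᴴ * G) - (G⁻¹ * Aᴴ * G) * A)).trace.re := by
  obtain ⟨L, hL, hGL⟩ := exists_conjTranspose_mul_self hG
  have h1 : (L * A * L⁻¹) ^ k = 0 := by
    have : ∀ j : ℕ, (L * A * L⁻¹) ^ j = L * A ^ j * L⁻¹ := by
      intro j
      induction j with
      | zero => simp [Matrix.mul_nonsing_inv _ hL]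
      | succ j ih => rw [pow_succ, ih, conj_mul_conj hL, ← pow_succ]
    rw [this, hA]; simp
  have h2 := hK _ h1
  rw [← trace_mul_adjoint_eq hL hGL, commNormSq, ← adjoint_conj hL hGL, conj_mul_conj hL,
    conj_mul_conj hL, ← sub_mul, ← mul_sub, conj_mul_conj hL, trace_conj hL] at h2
  exact h2

end nilpotentCommutator

/-! ### Holomorphic sections -/

section sections

variable (F : Type*) [NormedAddCommGroup F] [NormedSpace ℂ F]
  {E : ℂˣ → Type*} [∀ t, AddCommGroup (E t)] [∀ t, Module ℂ (E t)]
  [∀ t, TopologicalSpace (E t)] [TopologicalSpace (TotalSpace F E)]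
  [FiberBundle F E]

/-- `a` is a holomorphic section near `t`. -/
def HolSecAt (a : ∀ t, E t) (t : ℂˣ) : Prop :=
  ContMDiffAt 𝓘(ℂ, ℂ) (𝓘(ℂ, ℂ).prod 𝓘(ℂ, F)) ω (fun t => TotalSpace.mk' F t (a t)) t

variable {F} {a b : ∀ t, E t} {U : Set ℂˣ} {t : ℂˣ}

theorem isHolSection_iff (hU : IsOpen U) : IsHolSection F a U ↔ ∀ t ∈ U, HolSecAt F a t :=
  ⟨fun h t ht => (h t ht).contMDiffAt (hU.mem_nhds ht),
    fun h t ht => (h t ht).contMDiffWithinAt⟩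

theorem HolSecAt.congr (ha : HolSecAt F a t) (h : ∀ᶠ s in 𝓝 t, b s = a s) : HolSecAt F b t :=
  ContMDiffAt.congr_of_eventuallyEq ha (h.mono fun s hs => by simp only [hs])

theorem holAt_iff {f : ℂˣ → ℂ} (hU : IsOpen U) :
    ContMDiffOn 𝓘(ℂ, ℂ) 𝓘(ℂ, ℂ) ω f U ↔ ∀ t ∈ U, HolAt f t :=
  ⟨fun h t ht => (h t ht).contMDiffAt (hU.mem_nhds ht),
    fun h t ht => (h t ht).contMDiffWithinAt⟩

theorem TTData.IsTTStar.holAt_eta {D : TTData E} (hD : D.IsTTStar F) (hU : IsOpen U)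
    (ha : IsHolSection F a U) (hb : IsHolSection F b U) (ht : t ∈ U) :
    HolAt (fun t => D.eta t (a t) (b t)) t := (holAt_iff hU).1 (hD.eta_hol U hU a b ha hb) t ht

theorem TTData.IsTTStar.smoothAt_g {D : TTData E} (hD : D.IsTTStar F) (hU : IsOpen U)
    (ha : IsHolSection F a U) (hb : IsHolSection F b U) (ht : t ∈ U) :
    SmoothAt (fun t => D.g t (a t) (b t)) t :=
  (hD.g_smooth U hU a b ha hb t ht).contMDiffAt (hU.mem_nhds ht)

variable [VectorBundle ℂ F E]

theorem HolSecAt.smul {f : ℂˣ → ℂ} (hf : HolAt f t) (ha : HolSecAt F a t) :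
    HolSecAt F (fun s => f s • a s) t := ContMDiffAt.smul_section hf ha

theorem HolSecAt.const_smul (c : ℂ) (ha : HolSecAt F a t) :
    HolSecAt F (fun s => c • a s) t := HolSecAt.smul (f := fun _ => c) contMDiffAt_const ha

theorem HolSecAt.sum {ι : Type*} {u : Finset ι} {a : ι → ∀ t, E t}
    (ha : ∀ i ∈ u, HolSecAt F (a i) t) : HolSecAt F (fun s => ∑ i ∈ u, a i s) t :=
  ContMDiffAt.sum_section ha

variable [ContMDiffVectorBundle ω F E 𝓘(ℂ, ℂ)] {ι : Type*} (bF : Module.Basis ι ℂ F)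

theorem isHolFrame_localFrame (p : ℂˣ) :
    IsHolFrame F ((trivializationAt F E p).localFrame bF) (trivializationAt F E p).baseSet :=
  Trivialization.isLocalFrameOn_localFrame_baseSet 𝓘(ℂ, ℂ) ω _ bF

/-- The coordinates of a vector of `E` in the frame given by the standard trivialization at `p`. -/
def frameCoord (p : ℂˣ) (i : ι) (v : TotalSpace F E) : ℂ :=
  bF.repr (trivializationAt F E p v).2 i

theorem sum_frameCoord [Fintype ι] (p : ℂˣ) {t : ℂˣ} (ht : t ∈ (trivializationAt F E p).baseSet)
    (v : E t) : v = ∑ i, frameCoord bF p i (TotalSpace.mk' F t v) •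
      (trivializationAt F E p).localFrame bF i t := by
  have h := ((trivializationAt F E p).basisAt bF ht).sum_repr v
  conv_lhs => rw [← h]
  refine Finset.sum_congr rfl fun i _ => ?_
  rw [Trivialization.localFrame_apply_of_mem_baseSet _ _ ht]
  congr 1

theorem holAt_frameCoord [FiniteDimensional ℂ F] (p : ℂˣ) (i : ι) {a : ∀ t, E t} {t : ℂˣ}
    (ht : t ∈ (trivializationAt F E p).baseSet) (ha : HolSecAt F a t) :
    HolAt (fun s => frameCoord bF p i (TotalSpace.mk' F s (a s))) t := by
  have h : ContMDiffAt 𝓘(ℂ, ℂ) 𝓘(ℂ, F) ω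
      (fun s => (trivializationAt F E p (TotalSpace.mk' F s (a s))).2) t :=
    (Trivialization.contMDiffAt_section_iff (trivializationAt F E p) ht).1 ha
  have h2 : ContDiff ℂ ω (fun v : F => bF.repr v i) :=
    (LinearMap.toContinuousLinearMap (bF.coord i)).contDiff
  exact h2.contMDiff.contMDiffAt.comp t h

theorem continuousAt_frameCoord [FiniteDimensional ℂ F] (p : ℂˣ) (i : ι) {v : TotalSpace F E}
    (hv : v.proj ∈ (trivializationAt F E p).baseSet) :
    ContinuousAt (frameCoord bF p i) v := by
  have h1 : ContinuousAt (trivializationAt F E p) v :=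
    (trivializationAt F E p).continuousAt ((trivializationAt F E p).mem_source.2 hv)
  exact (LinearMap.toContinuousLinearMap (bF.coord i)).continuous.continuousAt.comp
    (continuousAt_snd.comp h1)

/-- Along a continuous path in `E`, the pairing with a holomorphic section is continuous. -/
theorem TTData.IsTTStar.continuousAt_eta [FiniteDimensional ℂ F] {D : TTData E} (hD : D.IsTTStar F)
    {X : Type*} [TopologicalSpace X] {γ : X → TotalSpace F E} {x : X} (hγ : ContinuousAt γ x)
    {b : ∀ t, E t} (hU : IsOpen U) (hb : IsHolSection F b U) (hx : (γ x).proj ∈ U) :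
    ContinuousAt (fun y => D.eta (γ y).proj (γ y).2 (b (γ y).proj)) x := by
  let bF := Module.finBasis ℂ F
  let p := (γ x).proj
  let e := trivializationAt F E p
  have hp : p ∈ e.baseSet := FiberBundle.mem_baseSet_trivializationAt' p
  have hproj : ContinuousAt (fun y => (γ y).proj) x :=
    (FiberBundle.continuous_proj F E).continuousAt.comp hγ
  have hev : ∀ᶠ y in 𝓝 x, (γ y).proj ∈ e.baseSet :=
    hproj.eventually (e.open_baseSet.mem_nhds hp)
  -- The path need not come from a section, so it is expanded in a local holomorphic frame: its
  -- coordinates are continuous, and `η` of frame sections is holomorphic.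
  have h : (fun y => D.eta (γ y).proj (γ y).2 (b (γ y).proj)) =ᶠ[𝓝 x]
      fun y => ∑ i, frameCoord bF p i (γ y) *
        D.eta (γ y).proj (e.localFrame bF i (γ y).proj) (b (γ y).proj) := by
    filter_upwards [hev] with y hy
    conv_lhs => rw [sum_frameCoord bF p hy (γ y).2]
    simp only [map_sum, map_smul, LinearMap.sum_apply, LinearMap.smul_apply, smul_eq_mul]
    rfl
  refine ContinuousAt.congr ?_ h.symm
  refine tendsto_finsetSum _ fun i _ => ?_
  refine ContinuousAt.mul ((continuousAt_frameCoord bF p i hp).comp hγ) ?_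
  have hfr := isHolFrame_localFrame (E := E) bF p
  have h3 := hD.holAt_eta (a := e.localFrame bF i) (b := b) (hU.inter e.open_baseSet)
    ((hfr.contMDiffOn i).mono inter_subset_right) (hb.mono inter_subset_left) ⟨hx, hp⟩
  exact ContinuousAt.comp (f := fun y => (γ y).proj) h3.continuousAt hproj

end sections

/-! ### Frames -/

section frames

open scoped ComplexOrder

variable {F : Type*} [NormedAddCommGroup F] [NormedSpace ℂ F]
  {E : ℂˣ → Type*} [∀ t, AddCommGroup (E t)] [∀ t, Module ℂ (E t)]
  [∀ t, TopologicalSpace (E t)] [TopologicalSpace (TotalSpace F E)]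
  [FiberBundle F E] {D : TTData E} {U : Set ℂˣ} {ι : Type*}

/-- The basis of the fibre at `t` given by a holomorphic frame. -/
def IsHolFrame.basisAt {e : ι → ∀ t, E t} (he : IsHolFrame F e U) {t : ℂˣ} (ht : t ∈ U) :
    Module.Basis ι ℂ (E t) := IsLocalFrameOn.toBasisAt he ht

theorem IsHolFrame.basisAt_apply {e : ι → ∀ t, E t} (he : IsHolFrame F e U) {t : ℂˣ} (ht : t ∈ U)
    (i : ι) : he.basisAt ht i = e i t := IsLocalFrameOn.toBasisAt_coe he ht i

theorem TTData.IsTTStar.gram_posDef [Fintype ι] [DecidableEq ι] (hD : D.IsTTStar F)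
    {e : ι → ∀ t, E t} {t : ℂˣ} (he : LinearIndependent ℂ fun i => e i t) :
    (D.gram e t).PosDef := by
  refine Matrix.PosDef.of_dotProduct_mulVec_pos ?_ fun x hx => ?_
  · ext i j
    simp only [TTData.gram, Matrix.conjTranspose_apply, Matrix.of_apply]
    exact (hD.g_herm t _ _).symm
  · have h1 : star x ⬝ᵥ (D.gram e t).mulVec x = D.g t (∑ i, x i • e i t) (∑ i, x i • e i t) := by
      simp only [map_sum, LinearMap.sum_apply, map_smulₛₗ, LinearMap.smul_apply, dotProduct,
        Matrix.mulVec, TTData.gram, Matrix.of_apply, smul_eq_mul, Finset.mul_sum, Pi.star_apply,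
        RingHom.id_apply]
      rw [Finset.sum_comm]
      refine Finset.sum_congr rfl fun i _ => Finset.sum_congr rfl fun j _ => ?_
      simp only [Complex.star_def]
      ring
    have h2 : ∑ i, x i • e i t ≠ 0 := fun h => by
      refine hx (funext fun i => ?_)
      exact Fintype.linearIndependent_iff.1 he x h i
    rw [h1, Complex.lt_def]
    refine ⟨hD.g_pos t _ h2, ?_⟩
    have := hD.g_herm t (∑ i, x i • e i t) (∑ i, x i • e i t)
    simpa using (Complex.conj_eq_iff_im.1 this.symm).symm

theorem TTData.IsTTStar.matSmooth_gram (hD : D.IsTTStar F) (hU : IsOpen U)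
    {e : ι → ∀ t, E t} (he : ∀ i, IsHolSection F (e i) U) {t : ℂˣ} (ht : t ∈ U) :
    MatSmooth (D.gram e) t := fun i j => hD.smoothAt_g hU (he i) (he j) ht

/-- Flatness for `lam = ±1`: the tt*-equation, and `Φ^†` is parallel along `∂^g`. -/
theorem TTData.IsTTStar.structure_equations (hD : D.IsTTStar F) (hU : IsOpen U) {r : ℕ}
    {e : Fin r → ∀ t, E t} (he : IsHolFrame F e U) {A : ℂˣ → Matrix (Fin r) (Fin r) ℂ}
    (hA : D.IsHiggsMatrix e U A) (hAh : ∀ t ∈ U, ∀ i j, HolAt (fun s => A s i j) t) {t : ℂˣ}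
    (ht : t ∈ U) :
    matWirtBar (chernMatrix (D.gram e)) t =
        A t * adjMatrix (D.gram e) A t - adjMatrix (D.gram e) A t * A t ∧
      matWirt (adjMatrix (D.gram e) A) t + (chernMatrix (D.gram e) t * adjMatrix (D.gram e) A t
        - adjMatrix (D.gram e) A t * chernMatrix (D.gram e) t) = 0 := by
  have hG := hD.matSmooth_gram hU (e := e) he.contMDiffOn ht
  have h0 : (D.gram e t).det ≠ 0 :=
    ((Matrix.isUnit_iff_isUnit_det _).1 (hD.gram_posDef (he.linearIndependent ht)).isUnit).ne_zero
  have hAs : MatSmooth A t := fun i j => (hAh t ht i j).smoothAt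
  have hB := hG.adjMatrix h0 hAs
  have hC := hG.chernMatrix h0
  have hbar := matWirtBar_eq_zero_of_hol (hAh t ht)
  -- Holomorphy of `A` removes the `lam⁻¹` term, and the factors cancel in the commutator of `Φ`
  -- with `Φ^†`. The curvature is therefore affine in `lam`, and its values at `1` and `-1`
  -- determine both coefficients.
  have key : ∀ lam : ℂ, ‖lam‖ = 1 → lam • matWirt (adjMatrix (D.gram e) A) t
      - matWirtBar (chernMatrix (D.gram e)) t
      + ((chernMatrix (D.gram e) t + lam⁻¹ • A t) * (lam • adjMatrix (D.gram e) A t)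
        - (lam • adjMatrix (D.gram e) A t) * (chernMatrix (D.gram e) t + lam⁻¹ • A t)) = 0 := by
    intro lam hlam
    have h := hD.flat U hU r e he A hA lam hlam t ht
    rw [matWirt_smul (smoothAt_const lam) hB, wirt_const, matWirtBar_add hC
      (MatSmooth.smul (smoothAt_const lam⁻¹) hAs), matWirtBar_smul (smoothAt_const lam⁻¹) hAs,
      hbar, wirtBar_const] at h
    simpa using h
  have k1 := key 1 (by simp)
  have k2 := key (-1) (by simp)
  simp only [inv_one, one_smul, inv_neg, neg_smul] at k1 k2
  generalize adjMatrix (D.gram e) A t = B at *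
  generalize chernMatrix (D.gram e) t = C at *
  generalize matWirt (adjMatrix (D.gram e) A) t = B' at *
  generalize matWirtBar (chernMatrix (D.gram e)) t = C' at *
  generalize A t = A at *
  have s1 : (2 : ℂ) • C' = (2 : ℂ) • (A * B - B * A) := by
    have := congrArg₂ (· + ·) k1 k2
    simp only [add_zero] at this
    rw [← sub_eq_zero, ← neg_eq_zero, ← this]
    simp only [two_smul]
    noncomm_ring
  have s2 : (2 : ℂ) • (B' + (C * B - B * C)) = 0 := by
    have := congrArg₂ (· - ·) k1 k2
    simp only [sub_zero] at this
    rw [← this]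
    simp only [two_smul]
    noncomm_ring
  exact ⟨smul_right_injective _ two_ne_zero s1, (smul_eq_zero.1 s2).resolve_left two_ne_zero⟩

end frames

/-! ### The endomorphism `Φ(∂/∂t)` and the isomorphisms of tt*-structures on fibres -/

section mfderivs

theorem mfderiv_complex_units (f : ℂˣ → ℂ) (t : ℂˣ) (hf : HolAt f t) :
    (mfderiv 𝓘(ℂ, ℂ) 𝓘(ℂ, ℂ) f t : ℂ →L[ℂ] ℂ) = fderiv ℂ (f ∘ unitOf) (t : ℂ) := by
  have h : MDifferentiableAt 𝓘(ℂ, ℂ) 𝓘(ℂ, ℂ) f t := hf.mdifferentiableAt (by simp)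
  rw [h.mfderiv]
  have e : writtenInExtChartAt 𝓘(ℂ, ℂ) 𝓘(ℂ, ℂ) t f = f ∘ unitOf := by
    funext z; simp [writtenInExtChartAt, unitOf]; rfl
  have e' : extChartAt 𝓘(ℂ, ℂ) t t = (t : ℂ) := by simp
  rw [e, e', modelWithCornersSelf_coe, range_id, fderivWithin_univ]

theorem holAt_coe (t : ℂˣ) : HolAt (fun s => (s : ℂ)) t :=
  contMDiffAt_units_iff.2 (contDiffAt_id.congr_of_eventuallyEq (eventually_coe_unitOf t))

theorem fderiv_coe_unitOf (t : ℂˣ) :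
    fderiv ℂ ((fun s : ℂˣ => (s : ℂ)) ∘ unitOf) (t : ℂ) = ContinuousLinearMap.id ℂ ℂ :=
  (Filter.EventuallyEq.fderiv_eq (eventually_coe_unitOf t)).trans fderiv_id

theorem dCoord_apply (t : ℂˣ) (X : ℂ) : dCoord t X = X := by
  have h := mfderiv_complex_units _ t (holAt_coe t)
  rw [fderiv_coe_unitOf] at h
  exact congrArg (fun L : ℂ →L[ℂ] ℂ => L X) h

/-- Composing with the coordinate, whose differential is the identity, reduces this to the linear
map `w ↦ e^z w`. -/
theorem mfderiv_rho_apply (z : ℂ) (t : ℂˣ) (X : ℂ) :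
    (mfderiv 𝓘(ℂ, ℂ) 𝓘(ℂ, ℂ) (rho z) t : ℂ →L[ℂ] ℂ) X = Complex.exp z * X := by
  have hr : MDifferentiableAt 𝓘(ℂ, ℂ) 𝓘(ℂ, ℂ) (rho z) t :=
    ((rho z).contMDiff t).mdifferentiableAt (by simp)
  have hc : MDifferentiableAt 𝓘(ℂ, ℂ) 𝓘(ℂ, ℂ) (fun s : ℂˣ => (s : ℂ)) (rho z t) :=
    (holAt_coe _).mdifferentiableAt (by simp)
  have h1 := mfderiv_comp t hc hr
  have h2 : HolAt ((fun s : ℂˣ => (s : ℂ)) ∘ rho z) t :=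
    ContMDiffAt.comp t (holAt_coe _) (rho z).contMDiff.contMDiffAt
  have h3 := mfderiv_complex_units _ t h2
  have h4 : (((fun s : ℂˣ => (s : ℂ)) ∘ rho z) ∘ unitOf) =ᶠ[𝓝 (t : ℂ)]
      fun w => Complex.exp z * w := by
    filter_upwards [eventually_coe_unitOf t] with w hw
    change Complex.exp z * (unitOf w : ℂ) = _
    rw [hw]
  have h5 : fderiv ℂ (fun w => Complex.exp z * w) (t : ℂ) X = Complex.exp z * X := by
    have : fderiv ℂ (fun w => Complex.exp z * w) (t : ℂ) = _ :=
      ((hasFDerivAt_id (𝕜 := ℂ) (t : ℂ)).const_mul (Complex.exp z)).fderiv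
    rw [this]
    simp
  rw [h4.fderiv_eq] at h3
  rw [h1] at h3
  have h6 := congrArg (fun L : ℂ →L[ℂ] ℂ => L X) h3
  simp only [h5] at h6
  rw [← h6]
  exact (dCoord_apply (rho z t) _).symm

end mfderivs

section phi

variable {E : ℂˣ → Type*} [∀ t, AddCommGroup (E t)] [∀ t, Module ℂ (E t)]

/-- The endomorphism `Φ(∂/∂t)` of the fibre at `t`. -/
def TTData.phi (D : TTData E) (t : ℂˣ) : E t →ₗ[ℂ] E t := D.Phi t (ddt t)

theorem TTData.Phi_eq_smul (D : TTData E) (t : ℂˣ) (X : TangentSpace 𝓘(ℂ, ℂ) t) :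
    D.Phi t X = (show ℂ from X) • D.phi t := by
  rw [TTData.phi, ← map_smul]
  congr 1
  exact (mul_one (show ℂ from X)).symm

theorem TTData.phi_ne_zero {D : TTData E} {t : ℂˣ} (h : D.Phi t ≠ 0) : D.phi t ≠ 0 := fun h0 =>
  h (LinearMap.ext fun X => by rw [D.Phi_eq_smul, h0, smul_zero, LinearMap.zero_apply])

/-- The identification of the fibres over equal points. -/
def fibreCast {p q : ℂˣ} (h : p = q) : E p ≃ₗ[ℂ] E q := by
  subst h
  exact LinearEquiv.refl ℂ _

theorem cast_eq_fibreCast {p q : ℂˣ} (h : p = q) (a : E p) :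
    cast (congrArg E h) a = fibreCast h a := by
  subst h; rfl

theorem TTData.eta_fibreCast (D : TTData E) {p q : ℂˣ} (h : p = q) (a b : E p) :
    D.eta q (fibreCast h a) (fibreCast h b) = D.eta p a b := by
  subst h; rfl

theorem TTData.g_fibreCast (D : TTData E) {p q : ℂˣ} (h : p = q) (a b : E p) :
    D.g q (fibreCast h a) (fibreCast h b) = D.g p a b := by
  subst h; rfl

theorem TTData.phi_fibreCast (D : TTData E) {p q : ℂˣ} (h : p = q) (a : E p) :
    D.phi q (fibreCast h a) = fibreCast h (D.phi p a) := by
  subst h; rfl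

/-- The isomorphism `E_p → E_{e^{-z} p}` given by a bundle map `ρ_z^* E → E`. -/
def rotMap (z : ℂ) (Tz : ∀ t, (rho z *ᵖ E) t ≃ₗ[ℂ] E t) (p : ℂˣ) : E p ≃ₗ[ℂ] E (rho (-z) p) :=
  LinearEquiv.trans (M₂ := (rho z *ᵖ E) (rho (-z) p)) (fibreCast (rho_rho_neg z p).symm)
    (Tz (rho (-z) p))

theorem totalMap_mk (F : Type*) (z : ℂ) (Tz : ∀ t, (rho z *ᵖ E) t ≃ₗ[ℂ] E t) (p : ℂˣ) (a : E p) :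
    totalMap F z Tz (TotalSpace.mk' F p a) = TotalSpace.mk' F (rho (-z) p) (rotMap z Tz p a) := by
  have h := cast_eq_fibreCast (E := E) (rho_rho_neg z p).symm a
  change TotalSpace.mk' F (rho (-z) p) (Tz (rho (-z) p) (cast _ a)) = _
  exact congrArg (fun v => TotalSpace.mk' F (rho (-z) p) (Tz (rho (-z) p) v)) h

variable (F : Type*) [NormedAddCommGroup F] [NormedSpace ℂ F]
  [∀ t, TopologicalSpace (E t)] [TopologicalSpace (TotalSpace F E)]
  [FiberBundle F E] {D : TTData E} {z : ℂ} {Tz : ∀ t, (rho z *ᵖ E) t ≃ₗ[ℂ] E t}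

variable {F}

theorem IsTTIso.eta_rotMap (h : IsTTIso F F (D.rhoAct z) D Tz) (p : ℂˣ) (a b : E p) :
    D.eta (rho (-z) p) (rotMap z Tz p a) (rotMap z Tz p b) = D.eta p a b := by
  refine Eq.trans ?_ (D.eta_fibreCast (rho_rho_neg z p).symm a b)
  exact (h.eta_eq (rho (-z) p) (fibreCast (rho_rho_neg z p).symm a)
    (fibreCast (rho_rho_neg z p).symm b)).symm

theorem IsTTIso.g_rotMap (h : IsTTIso F F (D.rhoAct z) D Tz) (p : ℂˣ) (a b : E p) :
    D.g (rho (-z) p) (rotMap z Tz p a) (rotMap z Tz p b) = D.g p a b := by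
  refine Eq.trans ?_ (D.g_fibreCast (rho_rho_neg z p).symm a b)
  exact (h.g_eq (rho (-z) p) (fibreCast (rho_rho_neg z p).symm a)
    (fibreCast (rho_rho_neg z p).symm b)).symm

/-- The `e^{-z}` of the action cancels the `e^z` of `dρ_z`. Hence rotation isomorphisms intertwine
the endomorphisms `φ` with no scalar factor. -/
theorem TTData.rhoAct_Phi_ddt (D : TTData E) (z : ℂ) (t : ℂˣ) (a : E (rho z t)) :
    (D.rhoAct z).Phi t (ddt t) a = D.phi (rho z t) a := by
  have h : (mfderiv 𝓘(ℂ, ℂ) 𝓘(ℂ, ℂ) (rho z) t : ℂ →L[ℂ] ℂ) (1 : ℂ) = Complex.exp z := by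
    rw [mfderiv_rho_apply z t 1, mul_one]
  have h2 := D.Phi_eq_smul (rho z t) (Complex.exp z)
  change Complex.exp (-z) • D.Phi (rho z t)
    ((mfderiv 𝓘(ℂ, ℂ) 𝓘(ℂ, ℂ) (rho z) t : ℂ →L[ℂ] ℂ) (1 : ℂ)) a = _
  rw [h, h2, LinearMap.smul_apply, smul_smul, ← Complex.exp_add, neg_add_cancel,
    Complex.exp_zero, one_smul]

theorem IsTTIso.phi_rotMap (h : IsTTIso F F (D.rhoAct z) D Tz) (p : ℂˣ) (a : E p) :
    D.phi (rho (-z) p) (rotMap z Tz p a) = rotMap z Tz p (D.phi p a) := by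
  have h1 := h.Phi_eq (rho (-z) p) (ddt _) (fibreCast (rho_rho_neg z p).symm a)
  rw [D.rhoAct_Phi_ddt z (rho (-z) p), D.phi_fibreCast] at h1
  exact h1.symm

theorem IsTTIso.phi_scale {D : TTData E} {μ : ℂ} {S : ∀ t, E t ≃ₗ[ℂ] E t} (h : IsTTIso F F D (D.scale μ) S)
    (t : ℂˣ) (a : E t) : S t (D.phi t a) = μ • D.phi t (S t a) := h.Phi_eq t (ddt t) a

theorem IsTTIso.holSecAt {E' : ℂˣ → Type*} [∀ t, AddCommGroup (E' t)] [∀ t, Module ℂ (E' t)]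
    [∀ t, TopologicalSpace (E' t)] [TopologicalSpace (TotalSpace F E')] [FiberBundle F E']
    {D' : TTData E'} {S : ∀ t, E t ≃ₗ[ℂ] E' t} (h : IsTTIso F F D D' S)
    {a : ∀ t, E t} {t : ℂˣ} (ha : HolSecAt F a t) : HolSecAt F (fun s => S s (a s)) t :=
  ContMDiffAt.comp t h.hol.contMDiffAt ha

end phi

/-! ### Functions on `ℂ*` that are invariant under rotations -/

section rotations

theorem expUnit_val (z : ℂ) : (expUnit z : ℂ) = Complex.exp z := rfl

theorem rho_val (z : ℂ) (t : ℂˣ) : (rho z t : ℂ) = Complex.exp z * t := rfl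

theorem unitOf_exp (z : ℂ) : unitOf (Complex.exp z) = expUnit z := unitOf_coe (expUnit z)

theorem exists_expUnit (t : ℂˣ) : ∃ z, expUnit z = t :=
  ⟨Complex.log t, Units.ext (Complex.exp_log t.ne_zero)⟩

/-- A holomorphic function on `ℂ*` that is constant on circles is constant. -/
theorem eq_of_holAt_of_rotation_invariant {f : ℂˣ → ℂ} (hf : ∀ t, HolAt f t)
    (hrot : ∀ (y : ℝ) t, f (rho (-((y : ℂ) * Complex.I)) t) = f t) (s t : ℂˣ) : f s = f t := by
  have hd : ∀ z, DifferentiableAt ℂ (fun z => f (expUnit z)) z := by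
    intro z
    have h1 : DifferentiableAt ℂ (f ∘ unitOf) (Complex.exp z) :=
      (hf (expUnit z)).contDiffAt.differentiableAt (by simp)
    have h2 := h1.comp z Complex.differentiableAt_exp
    refine h2.congr_of_eventuallyEq (Eventually.of_forall fun w => ?_)
    simp [unitOf_exp]
  -- In the logarithmic coordinate the function is constant in imaginary directions, which
  -- determines the complex derivative.
  have h0 : ∀ z, deriv (fun z => f (expUnit z)) z = 0 := by
    intro z
    have h1 : HasDerivAt (fun y : ℝ => z + -((y : ℂ) * Complex.I)) (-(1 * Complex.I)) 0 := by
      have : HasDerivAt (fun y : ℝ => (y : ℂ)) 1 0 := Complex.ofRealCLM.hasDerivAt (x := (0 : ℝ))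
      exact ((this.mul_const Complex.I).neg).const_add z
    have h2 : HasDerivAt (fun z => f (expUnit z)) (deriv (fun z => f (expUnit z)) z)
        (z + -(((0 : ℝ) : ℂ) * Complex.I)) := by
      simpa using (hd z).hasDerivAt
    have h3 := HasDerivAt.comp (0 : ℝ) h2 h1
    have h4 : ((fun z => f (expUnit z)) ∘ fun y : ℝ => z + -((y : ℂ) * Complex.I))
        = fun _ => f (expUnit z) := by
      funext y
      rw [← hrot y (expUnit z)]
      simp only [Function.comp_apply]
      congr 1
      ext
      rw [rho_val, expUnit_val, expUnit_val, ← Complex.exp_add, add_comm]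
    rw [h4] at h3
    have h5 := h3.unique (hasDerivAt_const _ _)
    simpa using h5
  obtain ⟨z, rfl⟩ := exists_expUnit s
  obtain ⟨w, rfl⟩ := exists_expUnit t
  exact is_const_of_deriv_eq_zero (fun z => hd z) h0 z w

variable {M : ℂˣ → ℂ}

/-- The angular derivative is `i (t ∂ - t̄ ∂̄)`, and it vanishes. -/
theorem mul_wirt_eq_of_rotation_invariant (hM : ∀ t, SmoothAt M t)
    (hrot : ∀ (y : ℝ) t, M (rho (-((y : ℂ) * Complex.I)) t) = M t) (t : ℂˣ) :
    (t : ℂ) * wirt M t = conj (t : ℂ) * wirtBar M t := by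
  have h1 : HasDerivAt (fun y : ℝ => Complex.exp (-((y : ℂ) * Complex.I)) * t)
      (Complex.exp (-(((0 : ℝ) : ℂ) * Complex.I)) * -(1 * Complex.I) * t) 0 := by
    have : HasDerivAt (fun y : ℝ => (y : ℂ)) 1 0 := Complex.ofRealCLM.hasDerivAt (x := (0 : ℝ))
    exact (((this.mul_const Complex.I).neg).cexp).mul_const _
  have h2 : HasFDerivAt (M ∘ unitOf) (fderiv ℝ (M ∘ unitOf) (t : ℂ))
      (Complex.exp (-(((0 : ℝ) : ℂ) * Complex.I)) * t) := by
    simpa using (hM t).differentiableAt.hasFDerivAt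
  have h3 := h2.comp_hasDerivAt (0 : ℝ) h1
  have h4 : ((M ∘ unitOf) ∘ fun y : ℝ => Complex.exp (-((y : ℂ) * Complex.I)) * t)
      = fun _ => M t := by
    funext y
    rw [← hrot y t]
    simp only [Function.comp_apply]
    rw [← rho_val, unitOf_coe]
  rw [h4, ← realDiff_eq] at h3
  have h5 := h3.unique (hasDerivAt_const _ _)
  rw [realDiff_apply] at h5
  simp only [Complex.ofReal_zero, zero_mul, neg_zero, Complex.exp_zero, one_mul, map_mul, map_neg,
    Complex.conj_I] at h5
  have h6 : Complex.I * ((t : ℂ) * wirt M t - conj (t : ℂ) * wirtBar M t) = 0 := by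
    linear_combination -h5
  exact sub_eq_zero.1 ((mul_eq_zero.1 h6).resolve_left Complex.I_ne_zero)

theorem hasDerivAt_exp_ray (hM : ∀ t, SmoothAt M t) (x : ℝ) :
    HasDerivAt (fun x : ℝ => M (expUnit x))
      ((expUnit x : ℂ) * wirt M (expUnit x)
        + conj (expUnit x : ℂ) * wirtBar M (expUnit x)) x := by
  have h1 : HasDerivAt (fun x : ℝ => Complex.exp (x : ℂ)) (Complex.exp (x : ℂ) * 1) x :=
    (Complex.ofRealCLM.hasDerivAt (x := x)).cexp
  have h2 := (hM (expUnit x)).differentiableAt.hasFDerivAt.comp_hasDerivAt x h1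
  rw [← realDiff_eq, realDiff_apply, mul_one, ← expUnit_val] at h2
  refine h2.congr_of_eventuallyEq (Eventually.of_forall fun y => ?_)
  simp [unitOf_exp]

/-- On a ray, the Laplacian of a rotation-invariant function is a second derivative. -/
theorem hasDerivAt_ray_of_rotation_invariant (hM : ∀ t, SmoothAt M t)
    (hrot : ∀ (y : ℝ) t, M (rho (-((y : ℂ) * Complex.I)) t) = M t) (x : ℝ) :
    HasDerivAt (fun x : ℝ => M (expUnit x)) (2 * ((expUnit x : ℂ) * wirt M (expUnit x))) x ∧
    HasDerivAt (fun x : ℝ => 2 * ((expUnit x : ℂ) * wirt M (expUnit x)))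
      (4 * ((expUnit x : ℂ) * conj (expUnit x : ℂ) * wirtBar (wirt M) (expUnit x))) x := by
  have hc := mul_wirt_eq_of_rotation_invariant hM hrot
  have hR : ∀ t, SmoothAt (fun t : ℂˣ => (t : ℂ) * wirt M t) t := fun t =>
    smoothAt_mul smoothAt_coe (smoothAt_wirt (hM t))
  have hcoe : ∀ t : ℂˣ, wirtBar (fun t : ℂˣ => (t : ℂ)) t = 0 := fun t =>
    wirtBar_eq_zero_of_hol (holAt_coe t)
  have hcc : ∀ t : ℂˣ, wirt (fun t : ℂˣ => conj (t : ℂ)) t = 0 := fun t => by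
    rw [wirt_conj smoothAt_coe, hcoe, map_zero]
  constructor
  · have h := hasDerivAt_exp_ray hM x
    rwa [← hc, ← two_mul] at h
  · have h := (hasDerivAt_exp_ray hR x).const_mul 2
    have e1 : wirtBar (fun t : ℂˣ => (t : ℂ) * wirt M t) (expUnit x)
        = (expUnit x : ℂ) * wirtBar (wirt M) (expUnit x) := by
      rw [wirtBar_mul smoothAt_coe (smoothAt_wirt (hM _)), hcoe]; ring
    -- Replacing `t ∂M` by `t̄ ∂̄M` first makes the two terms of the chain rule equal, whence the
    -- factor `4`.
    have e2 : wirt (fun t : ℂˣ => (t : ℂ) * wirt M t) (expUnit x)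
        = conj (expUnit x : ℂ) * wirtBar (wirt M) (expUnit x) := by
      rw [wirt_congr (Eventually.of_forall hc : _ =ᶠ[𝓝 (expUnit x)] _),
        wirt_mul (smoothAt_conj smoothAt_coe) (smoothAt_wirtBar (hM _)), hcc,
        wirt_wirtBar_comm (hM _)]
      ring
    rw [e1, e2] at h
    convert! h using 1
    ring

end rotations

/-! ### The adjoint of `Φ(∂/∂t)` -/

section adjoint

open scoped ComplexOrder

variable {F : Type*} [NormedAddCommGroup F] [NormedSpace ℂ F]
  {E : ℂˣ → Type*} [∀ t, AddCommGroup (E t)] [∀ t, Module ℂ (E t)]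
  [∀ t, TopologicalSpace (E t)] [TopologicalSpace (TotalSpace F E)]
  [FiberBundle F E] {D : TTData E} {ι : Type*} [Fintype ι] [DecidableEq ι]

/-- `ψ` is the adjoint of `Φ(∂/∂t)` for the metric. -/
def TTData.IsPhiAdjoint (D : TTData E) (t : ℂˣ) (ψ : E t →ₗ[ℂ] E t) : Prop :=
  ∀ a b, D.g t (ψ a) b = D.g t a (D.phi t b)

theorem TTData.IsTTStar.ext_g (hD : D.IsTTStar F) {t : ℂˣ} {a a' : E t}
    (h : ∀ b, D.g t a b = D.g t a' b) : a = a' := by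
  by_contra hne
  have h1 := hD.g_pos t (a - a') (sub_ne_zero.2 hne)
  rw [(D.g t).map_sub a a', LinearMap.sub_apply, h, sub_self, Complex.zero_re] at h1
  exact lt_irrefl _ h1

/-- Because of uniqueness, an adjoint computed in one frame can be compared with one computed in
another frame or transported by a rotation. -/
theorem TTData.IsTTStar.phiAdjoint_unique (hD : D.IsTTStar F) {t : ℂˣ} {ψ ψ' : E t →ₗ[ℂ] E t}
    (h : D.IsPhiAdjoint t ψ) (h' : D.IsPhiAdjoint t ψ') : ψ = ψ' :=
  LinearMap.ext fun a => hD.ext_g fun b => by rw [h, h']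

/-- By sesquilinearity it is enough to test basis vectors, where the claim is the hypothesis read
entry by entry. -/
theorem TTData.gram_mulVec_mul (D : TTData E) {e : ι → ∀ t, E t} {t : ℂˣ} (ψ χ : E t →ₗ[ℂ] E t)
    (b : Module.Basis ι ℂ (E t)) (hb : ∀ i, b i = e i t)
    (h : (LinearMap.toMatrix b b ψ)ᴴ * D.gram e t = D.gram e t * LinearMap.toMatrix b b χ)
    (x y : E t) : D.g t (ψ x) y = D.g t x (χ y) := by
  have hG : ∀ i j, D.gram e t i j = D.g t (b i) (b j) := fun i j => by
    simp [TTData.gram, hb]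
  have key : ∀ i j, D.g t (ψ (b i)) (b j) = D.g t (b i) (χ (b j)) := by
    intro i j
    have h1 := congrFun (congrFun h i) j
    simp only [Matrix.mul_apply, Matrix.conjTranspose_apply, hG] at h1
    conv_lhs => rw [← b.sum_repr (ψ (b i))]
    conv_rhs => rw [← b.sum_repr (χ (b j))]
    simp only [map_sum, LinearMap.sum_apply, map_smulₛₗ, LinearMap.smul_apply, smul_eq_mul,
      RingHom.id_apply]
    simp only [LinearMap.toMatrix_apply] at h1
    refine h1.trans (Finset.sum_congr rfl fun k _ => mul_comm _ _)
  conv_lhs => rw [← b.sum_repr x, ← b.sum_repr y]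
  conv_rhs => rw [← b.sum_repr x, ← b.sum_repr y]
  simp only [map_sum, LinearMap.sum_apply, map_smulₛₗ, LinearMap.smul_apply, RingHom.id_apply, key]

theorem TTData.IsTTStar.isPhiAdjoint_toLin (hD : D.IsTTStar F) {e : ι → ∀ t, E t} {t : ℂˣ}
    (b : Module.Basis ι ℂ (E t)) (hb : ∀ i, b i = e i t) {A : Matrix ι ι ℂ}
    (hA : LinearMap.toMatrix b b (D.phi t) = A) :
    D.IsPhiAdjoint t (Matrix.toLin b b ((D.gram e t)⁻¹ * Aᴴ * D.gram e t)) := by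
  have hli : LinearIndependent ℂ fun i => e i t := by
    have := b.linearIndependent
    rwa [show (b : ι → E t) = fun i => e i t from funext hb] at this
  have hG := hD.gram_posDef hli
  have hu := (Matrix.isUnit_iff_isUnit_det _).1 hG.isUnit
  refine D.gram_mulVec_mul _ _ b hb ?_
  rw [LinearMap.toMatrix_toLin, hA, Matrix.conjTranspose_mul, Matrix.conjTranspose_mul,
    Matrix.conjTranspose_nonsing_inv, hG.isHermitian.eq, Matrix.conjTranspose_conjTranspose]
  simp only [mul_assoc, Matrix.nonsing_inv_mul _ hu, mul_one]

end adjoint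

/-! ### A rotation-invariant tt*-structure with nilpotent `Φ` has a zero of `Φ` -/

section nilpotent

open scoped ComplexOrder

theorem IsTTIso.isPhiAdjoint_rotMap {F : Type*} [NormedAddCommGroup F] [NormedSpace ℂ F]
    {E : ℂˣ → Type*} [∀ t, AddCommGroup (E t)] [∀ t, Module ℂ (E t)]
    [∀ t, TopologicalSpace (E t)] [TopologicalSpace (TotalSpace F E)]
    [FiberBundle F E] {D : TTData E} {z : ℂ} {Tz : ∀ t, (rho z *ᵖ E) t ≃ₗ[ℂ] E t}
    (h : IsTTIso F F (D.rhoAct z) D Tz) {p : ℂˣ} {ψ : E p →ₗ[ℂ] E p} (hψ : D.IsPhiAdjoint p ψ) :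
    D.IsPhiAdjoint (rho (-z) p) ((rotMap z Tz p).conj ψ) := by
  intro a b
  obtain ⟨a, rfl⟩ := (rotMap z Tz p).surjective a
  obtain ⟨b, rfl⟩ := (rotMap z Tz p).surjective b
  rw [LinearEquiv.conj_apply_apply, LinearEquiv.symm_apply_apply, h.g_rotMap, h.phi_rotMap,
    h.g_rotMap, hψ]

variable {F : Type*} [NormedAddCommGroup F] [NormedSpace ℂ F] [FiniteDimensional ℂ F]
  {E : ℂˣ → Type*} [∀ t, AddCommGroup (E t)] [∀ t, Module ℂ (E t)]
  [∀ t, TopologicalSpace (E t)] [TopologicalSpace (TotalSpace F E)]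
  [FiberBundle F E] [VectorBundle ℂ F E] [ContMDiffVectorBundle ω F E 𝓘(ℂ, ℂ)] {D : TTData E}
  {n : ℕ} (bF : Module.Basis (Fin n) ℂ F)

/-- The matrix of `Φ(∂/∂t)` in the frame given by the standard trivialization at `p`. -/
def TTData.higgsMatrix (D : TTData E) (p t : ℂˣ) : Matrix (Fin n) (Fin n) ℂ :=
  Matrix.of fun i j => frameCoord bF p i
    (TotalSpace.mk' F t (D.phi t ((trivializationAt F E p).localFrame bF j t)))

theorem TTData.isHiggsMatrix_higgsMatrix (D : TTData E) (p : ℂˣ) :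
    D.IsHiggsMatrix ((trivializationAt F E p).localFrame bF) (trivializationAt F E p).baseSet
      (D.higgsMatrix bF p) := fun t ht j =>
  sum_frameCoord bF p ht (D.phi t ((trivializationAt F E p).localFrame bF j t))

theorem TTData.IsTTStar.holSecAt_phi (hD : D.IsTTStar F) {U : Set ℂˣ} (hU : IsOpen U)
    {a : ∀ t, E t} (ha : IsHolSection F a U) : IsHolSection F (fun t => D.phi t (a t)) U :=
  hD.Phi_hol U hU a ha

theorem TTData.IsTTStar.holAt_higgsMatrix (hD : D.IsTTStar F) (p : ℂˣ) {t : ℂˣ}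
    (ht : t ∈ (trivializationAt F E p).baseSet) (i j : Fin n) :
    HolAt (fun s => D.higgsMatrix bF p s i j) t :=
  holAt_frameCoord bF p i ht ((isHolSection_iff (trivializationAt F E p).open_baseSet).1
    (hD.holSecAt_phi (trivializationAt F E p).open_baseSet
      ((isHolFrame_localFrame bF p).contMDiffOn j)) t ht)

theorem TTData.toMatrix_phi (D : TTData E) (p : ℂˣ) {t : ℂˣ}
    (ht : t ∈ (trivializationAt F E p).baseSet) :
    LinearMap.toMatrix ((isHolFrame_localFrame (E := E) bF p).basisAt ht)
      ((isHolFrame_localFrame (E := E) bF p).basisAt ht) (D.phi t) = D.higgsMatrix bF p t := by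
  set b := (isHolFrame_localFrame (E := E) bF p).basisAt ht with hb
  rw [← LinearEquiv.eq_symm_apply, LinearMap.toMatrix_symm]
  refine b.ext fun j => ?_
  rw [Matrix.toLin_self]
  have h := D.isHiggsMatrix_higgsMatrix bF p t ht j
  simp only [hb, IsHolFrame.basisAt_apply]
  exact h

variable (F) in
/-- The squared norm of `Φ(t ∂/∂t)`. -/
def TTData.normSqPhi (D : TTData E) (ψ : ∀ t, E t →ₗ[ℂ] E t) (t : ℂˣ) : ℂ :=
  (t : ℂ) * conj (t : ℂ) * LinearMap.trace ℂ (E t) (D.phi t ∘ₗ ψ t)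

theorem adjMatrix_smul {G A : ℂˣ → Matrix (Fin n) (Fin n) ℂ} (f : ℂˣ → ℂ) (t : ℂˣ) :
    adjMatrix G (fun s => f s • A s) t = conj (f t) • adjMatrix G A t := by
  simp [adjMatrix, Matrix.conjTranspose_smul]

theorem TTData.IsTTStar.normSqPhi_eq (hD : D.IsTTStar F) {ψ : ∀ t, E t →ₗ[ℂ] E t}
    (hψ : ∀ t, D.IsPhiAdjoint t (ψ t)) (p : ℂˣ) {t : ℂˣ}
    (ht : t ∈ (trivializationAt F E p).baseSet) :
    D.normSqPhi ψ t = (((t : ℂ) • D.higgsMatrix bF p t) *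
      adjMatrix (D.gram ((trivializationAt F E p).localFrame bF))
        (fun s => (s : ℂ) • D.higgsMatrix bF p s) t).trace := by
  have h1 := hD.isPhiAdjoint_toLin _ (fun i => IsHolFrame.basisAt_apply _ ht i)
    (D.toMatrix_phi bF p ht)
  rw [TTData.normSqPhi, hD.phiAdjoint_unique (hψ t) h1,
    LinearMap.trace_eq_matrix_trace ℂ ((isHolFrame_localFrame (E := E) bF p).basisAt ht),
    LinearMap.toMatrix_comp _ ((isHolFrame_localFrame (E := E) bF p).basisAt ht),
    LinearMap.toMatrix_toLin, D.toMatrix_phi bF p ht, adjMatrix_smul]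
  simp only [Matrix.smul_mul, Matrix.mul_smul, smul_smul, Matrix.trace_smul, smul_eq_mul]
  rw [mul_comm (conj (t : ℂ))]
  rfl

-- The squared norm of `Φ(t ∂/∂t)` would be a positive function of `x = log |t|` on the whole line
-- with second derivative at least `4 K` times its square. Rotations make it a function of `x`;
-- Bochner's formula and the commutator estimate give the inequality.
include bF in
theorem TTData.IsTTStar.not_nilpotent (hD : D.IsTTStar F) {k : ℕ}
    (hnil : ∀ t, D.phi t ^ k = 0) (hne : ∀ t, D.phi t ≠ 0)
    (T : ∀ (y : ℝ) (t : ℂˣ), (rho ((y : ℂ) * Complex.I) *ᵖ E) t ≃ₗ[ℂ] E t)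
    (hT : ∀ y : ℝ, IsTTIso F F (D.rhoAct ((y : ℂ) * Complex.I)) D (T y)) : False := by
  obtain ⟨K, hK, hKineq⟩ := exists_le_commNormSq (Fin n) k
  have hmem : ∀ t : ℂˣ, t ∈ (trivializationAt F E t).baseSet :=
    fun t => FiberBundle.mem_baseSet_trivializationAt' t
  choose ψ hψ using fun t : ℂˣ => (⟨_, hD.isPhiAdjoint_toLin _
    (fun i => IsHolFrame.basisAt_apply _ (hmem t) i) (D.toMatrix_phi bF t (hmem t))⟩ :
    ∃ ψ, D.IsPhiAdjoint t ψ)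
  set M := D.normSqPhi ψ with hMdef
  -- A rotation conjugates `φ` and, by uniqueness, its adjoint, so the trace is unchanged; the
  -- factor `t t̄` is unchanged since the rotation number has modulus one.
  have hrot : ∀ (y : ℝ) t, M (rho (-((y : ℂ) * Complex.I)) t) = M t := by
    intro y t
    have h1 := hD.phiAdjoint_unique (hψ (rho (-((y : ℂ) * Complex.I)) t))
      ((hT y).isPhiAdjoint_rotMap (hψ t))
    have h2 : D.phi (rho (-((y : ℂ) * Complex.I)) t) =
        (rotMap ((y : ℂ) * Complex.I) (T y) t).conj (D.phi t) := by
      refine LinearMap.ext fun a => ?_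
      obtain ⟨a, rfl⟩ := (rotMap ((y : ℂ) * Complex.I) (T y) t).surjective a
      rw [(hT y).phi_rotMap, LinearEquiv.conj_apply_apply, LinearEquiv.symm_apply_apply]
    rw [hMdef, TTData.normSqPhi, TTData.normSqPhi, h1, h2, ← LinearEquiv.conj_comp,
      LinearMap.trace_conj', rho_val]
    congr 1
    have h3 : Complex.exp (-((y : ℂ) * Complex.I)) * conj (Complex.exp (-((y : ℂ) * Complex.I)))
        = 1 := by
      rw [← Complex.exp_conj, ← Complex.exp_add]
      simp
    rw [map_mul]
    linear_combination (t : ℂ) * conj (t : ℂ) * h3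
  have hloc : ∀ p, SmoothAt M p ∧ 0 < (M p).re ∧
      K * (M p).re ^ 2 ≤ ((p : ℂ) * conj (p : ℂ) * wirtBar (wirt M) p).re := by
    intro p
    set e := trivializationAt F E p with he
    set fr := e.localFrame bF with hfr
    have hfrm : IsHolFrame F fr e.baseSet := isHolFrame_localFrame bF p
    set A := D.higgsMatrix bF p with hA
    -- The matrix of `Φ(t ∂/∂t)`: still holomorphic and nilpotent, and adapted to the coordinate
    -- `log t`.
    set At : ℂˣ → Matrix (Fin n) (Fin n) ℂ := fun s => (s : ℂ) • A s with hAt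
    set G := D.gram fr with hG
    have hUo := e.open_baseSet
    have hAh : ∀ t ∈ e.baseSet, ∀ i j, HolAt (fun s => A s i j) t := fun t ht i j =>
      hD.holAt_higgsMatrix bF p ht i j
    have hAs : ∀ t ∈ e.baseSet, MatSmooth A t := fun t ht i j => (hAh t ht i j).smoothAt
    have hAts : ∀ t ∈ e.baseSet, MatSmooth At t := fun t ht => (hAs t ht).smul smoothAt_coe
    have hGs : ∀ t ∈ e.baseSet, MatSmooth G t := fun t ht =>
      hD.matSmooth_gram hUo (e := fr) hfrm.contMDiffOn ht
    have hGp : ∀ t ∈ e.baseSet, (G t).PosDef := fun t ht => hD.gram_posDef (hfrm.linearIndependent ht)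
    have hG0 : ∀ t ∈ e.baseSet, (G t).det ≠ 0 := fun t ht =>
      ((Matrix.isUnit_iff_isUnit_det _).1 (hGp t ht).isUnit).ne_zero
    have hAbar : ∀ t ∈ e.baseSet, matWirtBar At t = 0 := fun t ht => by
      rw [hAt, matWirtBar_smul smoothAt_coe (hAs t ht), matWirtBar_eq_zero_of_hol (hAh t ht),
        wirtBar_eq_zero_of_hol (holAt_coe t)]
      simp
    have hst := fun t (ht : t ∈ e.baseSet) =>
      hD.structure_equations hUo hfrm (D.isHiggsMatrix_higgsMatrix bF p) hAh ht
    have hadj : ∀ t, adjMatrix G At t = conj (t : ℂ) • adjMatrix G A t := fun t =>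
      adjMatrix_smul _ t
    have hBs : ∀ t ∈ e.baseSet, MatSmooth (adjMatrix G A) t := fun t ht =>
      (hGs t ht).adjMatrix (hG0 t ht) (hAs t ht)
    -- The extra factor in the adjoint is `t̄`, which `∂` annihilates.
    have hB : ∀ t ∈ e.baseSet, matWirt (adjMatrix G At) t
        + (chernMatrix G t * adjMatrix G At t - adjMatrix G At t * chernMatrix G t) = 0 := by
      intro t ht
      rw [show adjMatrix G At = fun s : ℂˣ => conj (s : ℂ) • adjMatrix G A s from funext hadj,
        matWirt_smul (smoothAt_conj smoothAt_coe) (hBs t ht), wirt_conj smoothAt_coe,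
        wirtBar_eq_zero_of_hol (holAt_coe t)]
      simp only [map_zero, zero_smul, zero_add, Matrix.mul_smul, Matrix.smul_mul, ← smul_sub,
        ← smul_add]
      rw [(hst t ht).2, smul_zero]
    have hp : p ∈ e.baseSet := hmem p
    have hMeq : ∀ t ∈ e.baseSet, M t = (At t * adjMatrix G At t).trace := fun t ht =>
      hD.normSqPhi_eq bF hψ p ht
    have hMev : M =ᶠ[𝓝 p] fun t => (At t * adjMatrix G At t).trace := by
      filter_upwards [hUo.mem_nhds hp] with t ht using hMeq t ht
    have hAtne : At p ≠ 0 := by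
      intro h0
      have h1 : A p = 0 := (smul_eq_zero.1 h0).resolve_left p.ne_zero
      refine hne p ?_
      have h2 := D.toMatrix_phi bF p hp
      rw [← hA, h1] at h2
      exact (LinearEquiv.map_eq_zero_iff _).1 h2
    have hAtnil : At p ^ k = 0 := by
      have h1 : A p ^ k = 0 := by
        rw [hA, ← D.toMatrix_phi bF p hp, LinearMap.toMatrix_pow, hnil, map_zero]
      rw [hAt]
      simp only [smul_pow, h1, smul_zero]
    refine ⟨smoothAt_congr ((hAts p hp).mul
      ((hGs p hp).adjMatrix (hG0 p hp) (hAts p hp))).trace hMev, ?_, ?_⟩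
    · rw [hMeq p hp]
      refine lt_of_le_of_ne (trace_mul_adjoint_re_nonneg (hGp p hp) _) fun h => hAtne ?_
      exact eq_zero_of_trace_mul_adjoint (hGp p hp) h.symm
    · have hbo := wirtBar_wirt_trace_adjMatrix hUo hGs (fun t ht => (hGp t ht).isHermitian) hG0
        hAts hAbar hB hp
      have hev2 : ∀ᶠ t in 𝓝 p, wirt M t = wirt (fun t => (At t * adjMatrix G At t).trace) t := by
        filter_upwards [hUo.mem_nhds hp] with t ht
        refine wirt_congr ?_
        filter_upwards [hUo.mem_nhds ht] with s hs using hMeq s hs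
      rw [wirtBar_congr hev2, hbo, (hst p hp).1, mul_add, Complex.add_re]
      have hc : (p : ℂ) * conj (p : ℂ) = ((‖(p : ℂ)‖ ^ 2 : ℝ) : ℂ) := by
        rw [Complex.mul_conj, Complex.normSq_eq_norm_sq]
      have h1 := trace_mul_adjoint_re_nonneg (hGp p hp)
        (matWirt At p + chernMatrix G p * At p - At p * chernMatrix G p)
      have h2 := le_trace_commutator_sq hKineq (hGp p hp) hAtnil
      -- The curvature is a commutator of `A`, while the other factor belongs to `At`; the weight
      -- `|p|²` is just what converts the former into the latter.
      have h3 : (p : ℂ) * conj (p : ℂ) * ((A p * adjMatrix G A p - adjMatrix G A p * A p) *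
          (At p * adjMatrix G At p - adjMatrix G At p * At p)).trace =
          ((At p * adjMatrix G At p - adjMatrix G At p * At p) *
            (At p * adjMatrix G At p - adjMatrix G At p * At p)).trace := by
        have h4 : At p * adjMatrix G At p - adjMatrix G At p * At p =
            ((p : ℂ) * conj (p : ℂ)) • (A p * adjMatrix G A p - adjMatrix G A p * A p) := by
          rw [hadj]
          simp only [hAt, Matrix.mul_smul, Matrix.smul_mul, smul_smul, smul_sub]
          rw [mul_comm (conj (p : ℂ))]
        rw [← smul_eq_mul, ← Matrix.trace_smul, ← Matrix.smul_mul, ← h4]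
      have h5 : 0 ≤ ((p : ℂ) * conj (p : ℂ) *
          ((matWirt At p + chernMatrix G p * At p - At p * chernMatrix G p) * ((G p)⁻¹ *
          (matWirt At p + chernMatrix G p * At p - At p * chernMatrix G p)ᴴ * G p)).trace).re := by
        rw [hc, Complex.re_ofReal_mul]
        exact mul_nonneg (sq_nonneg _) h1
      have h6 : K * (M p).re ^ 2 ≤ ((At p * adjMatrix G At p - adjMatrix G At p * At p) *
            (At p * adjMatrix G At p - adjMatrix G At p * At p)).trace.re := by
        rw [hMeq p hp]; exact h2
      rw [h3]
      linarith
  have hsm := fun t => (hloc t).1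
  have hre : ∀ {f : ℝ → ℂ} {f' : ℂ} {x : ℝ}, HasDerivAt f f' x →
      HasDerivAt (fun x => (f x).re) f'.re x := fun h =>
    (Complex.reCLM.hasFDerivAt.comp_hasDerivAt _ h)
  refine not_entire_of_sq_le_deriv (K := 4 * K) (by positivity)
    (fun x => hre (hasDerivAt_ray_of_rotation_invariant hsm hrot x).1)
    (fun x => hre (hasDerivAt_ray_of_rotation_invariant hsm hrot x).2)
    (fun x => (hloc (expUnit x)).2.1) fun x => ?_
  have h := (hloc (expUnit x)).2.2
  have h2 : ∀ w : ℂ, (4 * w).re = 4 * w.re := fun w => by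
    simp
  rw [h2]
  linarith

end nilpotent

/-! ### Linear algebra of a `ℤ/(n+1)`-graded cyclic endomorphism -/

section linearAlgebra

variable {V : Type*} [AddCommGroup V] [Module ℂ V] [FiniteDimensional ℂ V] {n : ℕ} {ω₀ : ℂ}

/-- Homogeneity of the determinant applied to `w x - w M = w (x - M)`. -/
theorem det_scalar_sub_smul {ι : Type*} [Fintype ι] [DecidableEq ι] (M : Matrix ι ι ℂ) (w x : ℂ) :
    (w • M).charpoly.eval (w * x) = w ^ Fintype.card ι * M.charpoly.eval x := by
  rw [Matrix.eval_charpoly, Matrix.eval_charpoly, ← Matrix.det_smul]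
  congr 1
  rw [smul_sub, Matrix.scalar_apply, Matrix.scalar_apply]
  congr 1
  ext i j
  by_cases h : i = j
  · subst h; simp
  · simp [h]

/-- An endomorphism that is conjugate to its multiple by a primitive root of unity of order the
dimension is a root of a scalar. -/
theorem exists_pow_eq_smul (hdim : Module.finrank ℂ V = n + 1) (hω : IsPrimitiveRoot ω₀ (n + 1))
    {φ : V →ₗ[ℂ] V} {S : V ≃ₗ[ℂ] V} (hS : ∀ a, S (φ a) = ω₀ • φ (S a)) :
    ∃ a : ℂ, φ ^ (n + 1) = a • 1 := by
  let b := Module.finBasisOfFinrankEq ℂ V hdim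
  have hconj : S.conj φ = ω₀ • φ := by
    refine LinearMap.ext fun x => ?_
    rw [LinearEquiv.conj_apply_apply, hS, LinearEquiv.apply_symm_apply, LinearMap.smul_apply]
  have hcp : (ω₀ • φ).charpoly = φ.charpoly := by rw [← hconj, LinearEquiv.charpoly_conj]
  have hev : ∀ x, φ.charpoly.eval (ω₀ * x) = φ.charpoly.eval x := by
    intro x
    have h := det_scalar_sub_smul (LinearMap.toMatrix b b φ) ω₀ x
    rw [← map_smul, LinearMap.charpoly_toMatrix, LinearMap.charpoly_toMatrix, hcp, Fintype.card_fin,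
      hω.pow_eq_one, one_mul] at h
    exact h
  have hcomp : φ.charpoly.comp (Polynomial.C ω₀ * Polynomial.X) = φ.charpoly :=
    Polynomial.funext fun x => by simpa using hev x
  -- Invariance under `x ↦ ω₀ x` multiplies the coefficient of degree `k` by `ω₀^k`, which is not
  -- `1` in this range.
  have hcoeff : ∀ k, k ≠ 0 → k < n + 1 → φ.charpoly.coeff k = 0 := by
    intro k h0 hk
    have h := congrArg (fun p => Polynomial.coeff p k) hcomp
    simp only [Polynomial.comp_C_mul_X_coeff] at h
    have h1 : φ.charpoly.coeff k * (ω₀ ^ k - 1) = 0 := by linear_combination h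
    refine (mul_eq_zero.1 h1).resolve_right fun h2 => ?_
    exact hω.pow_ne_one_of_pos_of_lt h0 hk (sub_eq_zero.1 h2)
  have hdeg : φ.charpoly.natDegree = n + 1 := by rw [LinearMap.charpoly_natDegree, hdim]
  have hlead : φ.charpoly.coeff (n + 1) = 1 := by
    rw [← hdeg]; exact LinearMap.charpoly_monic φ
  -- Cayley–Hamilton for a polynomial with just a leading and a constant term.
  have hCH := LinearMap.aeval_self_charpoly φ
  rw [Polynomial.aeval_eq_sum_range, hdeg, Finset.sum_range_succ, hlead, one_smul,
    Finset.sum_eq_single_of_mem 0 (by simp)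
      (fun k hk h0 => by rw [hcoeff k h0 (Finset.mem_range.1 hk), zero_smul]), pow_zero] at hCH
  exact ⟨-φ.charpoly.coeff 0, by rw [neg_smul]; exact eq_neg_of_add_eq_zero_right hCH⟩

/-- The vectors `N^j v`, where `N^(n+1) = 1`. -/
def powVec (n : ℕ) (N : V →ₗ[ℂ] V) (v : V) (j : Fin (n + 1)) : V := (N ^ (j : ℕ)) v

variable {N : V →ₗ[ℂ] V} {S : V ≃ₗ[ℂ] V} {v : V} {θ : ℂ}

theorem powVec_zero : powVec n N v 0 = v := by simp [powVec]

/-- Wrap-around in `Fin (n + 1)` agrees with reduction of exponents by `N^(n+1) = 1`. -/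
theorem pow_powVec (hN : N ^ (n + 1) = 1) (i j : Fin (n + 1)) :
    (N ^ (i : ℕ)) (powVec n N v j) = powVec n N v (i + j) := by
  rw [powVec, powVec, Fin.val_add, ← pow_eq_pow_mod _ hN, pow_add]
  rfl

theorem apply_powVec (hN : N ^ (n + 1) = 1) (j : Fin (n + 1)) :
    N (powVec n N v j) = powVec n N v (j + 1) := by
  have h : powVec n N v (j + 1) = (N ^ ((j : ℕ) + 1)) v := by
    rw [powVec, Fin.val_add, Fin.val_one', Nat.add_mod_mod, ← pow_eq_pow_mod _ hN]
  rw [h, powVec, pow_succ']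
  rfl

theorem powVec_smul (x : ℂ) (j : Fin (n + 1)) : powVec n N (x • v) j = x • powVec n N v j := by
  simp [powVec]

theorem powVec_neg (j : Fin (n + 1)) : powVec n N (-v) j = -powVec n N v j := by
  simp [powVec]

theorem powVec_ne_zero (hN : N ^ (n + 1) = 1) (hv : v ≠ 0) (j : Fin (n + 1)) :
    powVec n N v j ≠ 0 := fun h => hv <| by
  have h1 := pow_powVec (v := v) hN (-j) j
  rw [neg_add_cancel, powVec_zero, h, map_zero] at h1
  exact h1.symm

theorem apply_pow_eigen (hS : ∀ a, S (N a) = ω₀ • N (S a)) (hv : S v = θ • v) (k : ℕ) :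
    S ((N ^ k) v) = (θ * ω₀ ^ k) • (N ^ k) v := by
  induction k with
  | zero => simpa using hv
  | succ k ih =>
    rw [pow_succ', Module.End.mul_apply, hS, ih, map_smul, smul_smul]
    congr 1
    ring

theorem apply_powVec_eigen (hS : ∀ a, S (N a) = ω₀ • N (S a)) (hv : S v = θ • v)
    (j : Fin (n + 1)) : S (powVec n N v j) = (θ * ω₀ ^ (j : ℕ)) • powVec n N v j :=
  apply_pow_eigen hS hv j

theorem eigen_ne_zero (hv0 : v ≠ 0) (hv : S v = θ • v) : θ ≠ 0 := fun h => hv0 <| by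
  rw [h, zero_smul] at hv
  exact (LinearEquiv.map_eq_zero_iff S).1 hv

theorem eigenvalues_injective (hω : IsPrimitiveRoot ω₀ (n + 1)) (hθ : θ ≠ 0) :
    Function.Injective fun j : Fin (n + 1) => θ * ω₀ ^ (j : ℕ) := fun i j h =>
  Fin.ext (hω.pow_inj i.2 j.2 (mul_left_cancel₀ hθ h))

/-- Each application of `N` multiplies the eigenvalue of `S` by `ω₀`, so these are eigenvectors for
`n + 1` distinct eigenvalues. -/
theorem linearIndependent_powVec (hω : IsPrimitiveRoot ω₀ (n + 1))
    (hS : ∀ a, S (N a) = ω₀ • N (S a)) (hN : N ^ (n + 1) = 1) (hv0 : v ≠ 0) (hv : S v = θ • v) :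
    LinearIndependent ℂ (powVec n N v) := by
  refine Module.End.eigenvectors_linearIndependent' (S : V →ₗ[ℂ] V)
    (fun j : Fin (n + 1) => θ * ω₀ ^ (j : ℕ)) (eigenvalues_injective hω (eigen_ne_zero hv0 hv)) _
    fun j => ⟨?_, powVec_ne_zero hN hv0 j⟩
  rw [Module.End.mem_eigenspace_iff]
  exact apply_powVec_eigen hS hv j

/-- The basis `N^j v` given by an eigenvector `v` of `S`. -/
def powBasis (hdim : Module.finrank ℂ V = n + 1) (hω : IsPrimitiveRoot ω₀ (n + 1))
    (hS : ∀ a, S (N a) = ω₀ • N (S a)) (hN : N ^ (n + 1) = 1) (hv0 : v ≠ 0) (hv : S v = θ • v) :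
    Module.Basis (Fin (n + 1)) ℂ V :=
  basisOfLinearIndependentOfCardEqFinrank (linearIndependent_powVec hω hS hN hv0 hv)
    (by rw [Fintype.card_fin, hdim])

theorem powBasis_apply (hdim : Module.finrank ℂ V = n + 1) (hω : IsPrimitiveRoot ω₀ (n + 1))
    (hS : ∀ a, S (N a) = ω₀ • N (S a)) (hN : N ^ (n + 1) = 1) (hv0 : v ≠ 0) (hv : S v = θ • v)
    (j : Fin (n + 1)) : powBasis hdim hω hS hN hv0 hv j = powVec n N v j := by
  simp [powBasis]

variable (hdim : Module.finrank ℂ V = n + 1) (hω : IsPrimitiveRoot ω₀ (n + 1))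
    (hS : ∀ a, S (N a) = ω₀ • N (S a)) (hN : N ^ (n + 1) = 1) (hv0 : v ≠ 0) (hv : S v = θ • v)

include hdim hω hS hN hv0 hv

theorem pow_eigen_eq_smul : ∀ a : V, ((S : V →ₗ[ℂ] V) ^ (n + 1)) a = θ ^ (n + 1) • a := by
  have h : (S : V →ₗ[ℂ] V) ^ (n + 1) = θ ^ (n + 1) • (1 : V →ₗ[ℂ] V) := by
    refine (powBasis hdim hω hS hN hv0 hv).ext fun j => ?_
    rw [powBasis_apply]
    have h1 : ∀ k : ℕ, ((S : V →ₗ[ℂ] V) ^ k) (powVec n N v j)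
        = (θ * ω₀ ^ (j : ℕ)) ^ k • powVec n N v j := by
      intro k
      induction k with
      | zero => simp
      | succ k ih =>
        rw [pow_succ', Module.End.mul_apply, ih, map_smul, LinearEquiv.coe_coe,
          apply_powVec_eigen hS hv, smul_smul, ← pow_succ]
    rw [h1, mul_pow, ← pow_mul, mul_comm (j : ℕ), pow_mul, hω.pow_eq_one, one_pow, mul_one]
    rfl
  intro a
  rw [h]
  rfl

/-- The eigenspace of `S` is one-dimensional. -/
theorem eq_smul_of_eigen {u : V} (hu : S u = θ • u) : ∃ x : ℂ, u = x • v := by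
  set b := powBasis hdim hω hS hN hv0 hv with hb
  -- `S` is diagonal in this basis; comparison with `θ` kills every coordinate except the one at
  -- `0`.
  have hcoord : ∀ a : V, ∀ j, b.repr (S a) j = θ * ω₀ ^ (j : ℕ) * b.repr a j := by
    intro a j
    conv_lhs => rw [← b.sum_repr a]
    simp only [map_sum, map_smul, hb, powBasis_apply, apply_powVec_eigen hS hv]
    simp only [← powBasis_apply hdim hω hS hN hv0 hv, Module.Basis.repr_self, Finsupp.coe_finsetSum,
      Finset.sum_apply, Finsupp.smul_apply, smul_eq_mul, Finsupp.single_apply]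
    simp [mul_comm]
  refine ⟨b.repr u 0, ?_⟩
  conv_lhs => rw [← b.sum_repr u]
  rw [Finset.sum_eq_single 0, hb, powBasis_apply, powVec_zero]
  · intro j _ hj
    have h := hcoord u j
    rw [hu, map_smul, Finsupp.smul_apply, smul_eq_mul] at h
    have hθ := eigen_ne_zero hv0 hv
    have h2 : θ * b.repr u j * (ω₀ ^ (j : ℕ) - 1) = 0 := by linear_combination -h
    have h3 : ω₀ ^ (j : ℕ) - 1 ≠ 0 := sub_ne_zero.2
      (hω.pow_ne_one_of_pos_of_lt (fun h0 => hj (Fin.ext h0)) j.2)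
    have h4 := (mul_eq_zero.1 ((mul_eq_zero.1 h2).resolve_right h3)).resolve_left hθ
    rw [h4, zero_smul]
  · simp

/-- Every solution of `x^(n+1) = θ^(n+1)` is an eigenvalue of `S`. -/
theorem exists_eigen_of_pow_eq {x : ℂ} (hx : x ^ (n + 1) = θ ^ (n + 1)) :
    ∃ u : V, u ≠ 0 ∧ S u = x • u := by
  have hθ := eigen_ne_zero hv0 hv
  have h1 : (x / θ) ^ (n + 1) = 1 := by
    rw [div_pow, hx, div_self (pow_ne_zero _ hθ)]
  obtain ⟨i, hi, h2⟩ := hω.eq_pow_of_pow_eq_one h1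
  refine ⟨powVec n N v ⟨i, hi⟩, powVec_ne_zero hN hv0 _, ?_⟩
  rw [apply_powVec_eigen hS hv]
  congr 1
  simp only
  rw [h2]
  field_simp

/-! ### Invariant bilinear and Hermitian forms in the basis of powers -/

variable {η : V →ₗ[ℂ] V →ₗ[ℂ] ℂ} (hηS : ∀ a b, η (S a) (S b) = η a b)
    (hηN : ∀ a b, η (N a) b = η a (N b)) (hnd : ∀ a, (∀ b, η a b = 0) → a = 0)

omit hdim hω hS hv0 hv in
include hηN in
theorem eta_powVec {u : V} (i j : Fin (n + 1)) :
    η (powVec n N u i) (powVec n N v j) = η u (powVec n N v (i + j)) := by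
  have h : ∀ (k : ℕ) (a b : V), η ((N ^ k) a) b = η a ((N ^ k) b) := by
    intro k
    induction k with
    | zero => simp
    | succ k ih =>
      intro a b
      rw [pow_succ', Module.End.mul_apply, hηN, ih, ← Module.End.mul_apply, ← pow_succ, pow_succ']
  rw [← pow_powVec hN, ← h]
  rfl

include hnd in
theorem exists_eta_powVec_ne_zero : ∃ m : Fin (n + 1), η v (powVec n N v m) ≠ 0 := by
  by_contra! h
  refine hv0 (hnd v fun b => ?_)
  rw [← (powBasis hdim hω hS hN hv0 hv).sum_repr b]
  simp only [map_sum, map_smul, powBasis_apply, h, smul_zero, Finset.sum_const_zero]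

-- `S` preserves `η`, so eigenvectors can pair nontrivially only if their eigenvalues, here `θ` and
-- `θ ω₀^m`, have product `1`.
omit hdim hω hN hv0 in
include hηS in
theorem eigenvalue_of_eta_ne_zero {m : Fin (n + 1)} (hm : η v (powVec n N v m) ≠ 0) :
    θ ^ 2 * ω₀ ^ (m : ℕ) = 1 := by
  have h := hηS v (powVec n N v m)
  rw [hv, apply_powVec_eigen hS hv, map_smul, map_smul, LinearMap.smul_apply, smul_eq_mul,
    smul_eq_mul] at h
  have h2 : (θ ^ 2 * ω₀ ^ (m : ℕ) - 1) * η v (powVec n N v m) = 0 := by linear_combination h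
  exact sub_eq_zero.1 ((mul_eq_zero.1 h2).resolve_right hm)

-- The eigenvalues `θ ω₀^j` are distinct, so at most one of them is inverse to `θ`.
include hηS in
theorem eta_powVec_eq_zero {m : Fin (n + 1)} (hm : θ ^ 2 * ω₀ ^ (m : ℕ) = 1) {j : Fin (n + 1)}
    (hj : j ≠ m) : η v (powVec n N v j) = 0 := by
  by_contra h
  have h1 := eigenvalue_of_eta_ne_zero hS hv hηS h
  have hθ := eigen_ne_zero hv0 hv
  exact hj (eigenvalues_injective hω (pow_ne_zero 2 hθ) (h1.trans hm.symm))

include hηS hnd in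
theorem eta_powVec_ne_zero {m : Fin (n + 1)} (hm : θ ^ 2 * ω₀ ^ (m : ℕ) = 1) :
    η v (powVec n N v m) ≠ 0 := by
  obtain ⟨j, hj⟩ := exists_eta_powVec_ne_zero hdim hω hS hN hv0 hv hnd
  by_cases h : j = m
  · rwa [← h]
  · exact absurd (eta_powVec_eq_zero hdim hω hS hN hv0 hv hηS hm h) hj

-- `S` is unitary: its eigenvalues have modulus one, and eigenvectors for distinct eigenvalues are
-- orthogonal.
omit hdim hN in
theorem g_powVec_eq_zero {g : V →ₗ⋆[ℂ] V →ₗ[ℂ] ℂ} (hgS : ∀ a b, g (S a) (S b) = g a b)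
    (hgpos : ∀ a, a ≠ 0 → 0 < (g a a).re) {i j : Fin (n + 1)} (hij : i ≠ j) :
    g (powVec n N v i) (powVec n N v j) = 0 := by
  have h1 := hgS v v
  rw [hv, map_smul, LinearMap.map_smulₛₗ, LinearMap.smul_apply, smul_eq_mul, smul_eq_mul] at h1
  have hg0 : g v v ≠ 0 := fun h => by
    have := hgpos v hv0
    rw [h] at this
    simp at this
  have hθ : conj θ * θ = 1 := by
    refine mul_right_cancel₀ hg0 ?_
    linear_combination h1
  have hω1 : conj ω₀ * ω₀ = 1 := by
    rw [mul_comm, Complex.mul_conj, Complex.normSq_eq_norm_sq,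
      hω.norm'_eq_one (Nat.succ_ne_zero n)]
    simp
  have h2 := hgS (powVec n N v i) (powVec n N v j)
  rw [apply_powVec_eigen hS hv, apply_powVec_eigen hS hv, map_smul, LinearMap.map_smulₛₗ,
    LinearMap.smul_apply, smul_eq_mul, smul_eq_mul] at h2
  by_contra h
  have h3 : conj (θ * ω₀ ^ (i : ℕ)) * (θ * ω₀ ^ (j : ℕ)) = 1 := by
    refine mul_right_cancel₀ h ?_
    linear_combination h2
  have h4 : conj (θ * ω₀ ^ (i : ℕ)) * (θ * ω₀ ^ (i : ℕ)) = 1 := by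
    rw [map_mul, map_pow, mul_mul_mul_comm, hθ, one_mul, ← mul_pow, hω1, one_pow]
  have h5 : conj (θ * ω₀ ^ (i : ℕ)) ≠ 0 := left_ne_zero_of_mul_eq_one h4
  exact hij (eigenvalues_injective hω (eigen_ne_zero hv0 hv)
    (mul_left_cancel₀ h5 (h4.trans h3.symm)))

end linearAlgebra

/-! ### Holomorphic functions and connectedness of `ℂ*` -/

section holFunctions

variable {f g : ℂˣ → ℂ} {t : ℂˣ}

theorem HolAt.mul (hf : HolAt f t) (hg : HolAt g t) : HolAt (fun s => f s * g s) t :=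
  contMDiffAt_units_iff.2 (hf.contDiffAt.mul hg.contDiffAt)

theorem HolAt.inv (hf : HolAt f t) (h0 : f t ≠ 0) : HolAt (fun s => (f s)⁻¹) t :=
  contMDiffAt_units_iff.2 (hf.contDiffAt.inv (by simpa [unitOf_coe] using h0))

theorem HolAt.congr (hf : HolAt f t) (h : g =ᶠ[𝓝 t] f) : HolAt g t :=
  ContMDiffAt.congr_of_eventuallyEq hf h

/-- A holomorphic function that does not vanish at `t` has a holomorphic square root near `t`. -/
theorem HolAt.exists_sqrt (hf : HolAt f t) (h0 : f t ≠ 0) :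
    ∃ q : ℂˣ → ℂ, HolAt q t ∧ ∀ᶠ s in 𝓝 t, q s ^ 2 = f s ∧ q s ≠ 0 := by
  obtain ⟨r, hr⟩ := IsAlgClosed.exists_pow_nat_eq (f t) (n := 2) two_pos
  have hr0 : r ≠ 0 := fun h => h0 (by rw [← hr, h]; simp)
  -- Dividing by `f t` puts the argument of the logarithm near `1`, away from the branch cut. The
  -- square identity itself needs only `f s ≠ 0`.
  refine ⟨fun s => r * Complex.exp (2⁻¹ * Complex.log (f s * (f t)⁻¹)), ?_, ?_⟩
  · refine contMDiffAt_units_iff.2 ?_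
    have h1 : ContDiffAt ℂ ω (fun z => (f ∘ unitOf) z * (f t)⁻¹) (t : ℂ) :=
      hf.contDiffAt.mul contDiffAt_const
    have h2 : (f ∘ unitOf) (t : ℂ) * (f t)⁻¹ ∈ Complex.slitPlane := by
      simp [unitOf_coe, h0]
    exact contDiffAt_const.mul (contDiffAt_const.mul
      (ContDiffAt.comp (t : ℂ) (Complex.contDiffAt_log h2) h1)).cexp
  · have hne : ∀ᶠ s in 𝓝 t, f s ≠ 0 := hf.continuousAt.eventually_ne h0
    filter_upwards [hne] with s hs
    refine ⟨?_, mul_ne_zero hr0 (Complex.exp_ne_zero _)⟩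
    rw [mul_pow, hr, ← Complex.exp_nat_mul]
    have : ((2 : ℕ) : ℂ) * (2⁻¹ * Complex.log (f s * (f t)⁻¹)) = Complex.log (f s * (f t)⁻¹) := by
      push_cast; ring
    rw [this, Complex.exp_log (mul_ne_zero hs (inv_ne_zero h0))]
    field_simp

theorem continuous_expUnit : Continuous expUnit := by
  rw [Units.isOpenEmbedding_val.isInducing.continuous_iff]
  exact Complex.continuous_exp

theorem isPreconnected_univ_units : IsPreconnected (univ : Set ℂˣ) := by
  have h := isPreconnected_univ.image expUnit continuous_expUnit.continuousOn
  rwa [image_univ, Function.Surjective.range_eq (fun t => exists_expUnit t)] at h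

end holFunctions

/-! ### The cyclic structure on the fibres -/

section cyclic

variable {F : Type*} [NormedAddCommGroup F] [NormedSpace ℂ F] [FiniteDimensional ℂ F]
  {E : ℂˣ → Type*} [∀ t, AddCommGroup (E t)] [∀ t, Module ℂ (E t)]
  [∀ t, TopologicalSpace (E t)] [TopologicalSpace (TotalSpace F E)]
  [FiberBundle F E] [VectorBundle ℂ F E] [ContMDiffVectorBundle ω F E 𝓘(ℂ, ℂ)] {D : TTData E}
  {n : ℕ} (bF : Module.Basis (Fin (n + 1)) ℂ F)

/-- The basis of the fibre at `t` given by the standard trivialization. -/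
def fibreBasis (t : ℂˣ) : Module.Basis (Fin (n + 1)) ℂ (E t) :=
  (isHolFrame_localFrame bF t).basisAt (FiberBundle.mem_baseSet_trivializationAt' t)

/-- Every vector of `E` extends to a local holomorphic section. -/
theorem exists_holSection_eq {t : ℂˣ} (v : E t) : ∃ (U : Set ℂˣ) (a : ∀ s, E s),
    IsOpen U ∧ t ∈ U ∧ IsHolSection F a U ∧ a t = v := by
  let bF := Module.finBasis ℂ F
  let e := trivializationAt F E t
  have ht : t ∈ e.baseSet := FiberBundle.mem_baseSet_trivializationAt' t
  refine ⟨e.baseSet, fun s => ∑ i, frameCoord bF t i (TotalSpace.mk' F t v) • e.localFrame bF i s,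
    e.open_baseSet, ht, ?_, (sum_frameCoord bF t ht v).symm⟩
  rw [isHolSection_iff e.open_baseSet]
  intro s hs
  exact HolSecAt.sum fun i _ => HolSecAt.const_smul _
    ((isHolSection_iff e.open_baseSet).1 ((isHolFrame_localFrame bF t).contMDiffOn i) s hs)

/-- Nondegeneracy supplies sections with `η(a, b) ≠ 0`, and `f` is the quotient of `η(Ψ a, b)` by
`η(a, b)`. -/
theorem TTData.IsTTStar.holAt_scalar (hD : D.IsTTStar F) (hnt : ∀ t, Nontrivial (E t))
    {Ψ : ∀ t, E t → E t} {f : ℂˣ → ℂ}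
    (hΨ : ∀ (U : Set ℂˣ) (a : ∀ t, E t), IsOpen U → IsHolSection F a U →
      IsHolSection F (fun t => Ψ t (a t)) U) (hf : ∀ t a, Ψ t a = f t • a) (t : ℂˣ) :
    HolAt f t := by
  obtain ⟨v, hv⟩ := @exists_ne _ (hnt t) (0 : E t)
  obtain ⟨w, hw⟩ : ∃ w, D.eta t v w ≠ 0 := by
    by_contra! h
    exact hv (hD.eta_nondeg t v h)
  obtain ⟨U, a, hU, htU, ha, rfl⟩ := exists_holSection_eq (F := F) v
  obtain ⟨W, b, hW, htW, hb, rfl⟩ := exists_holSection_eq (F := F) w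
  have hUW := hU.inter hW
  have ha' := ha.mono (inter_subset_left : U ∩ W ⊆ U)
  have hb' := hb.mono (inter_subset_right : U ∩ W ⊆ W)
  have h1 := hD.holAt_eta hUW ha' hb' ⟨htU, htW⟩
  have h2 := hD.holAt_eta hUW (hΨ _ a hUW ha') hb' ⟨htU, htW⟩
  refine (h2.mul (h1.inv hw)).congr ?_
  filter_upwards [h1.continuousAt.eventually_ne hw] with s hs
  rw [hf, map_smul, LinearMap.smul_apply, smul_eq_mul, mul_assoc, mul_inv_cancel₀ hs, mul_one]

theorem isHolSection_pow {Ψ : ∀ t, E t →ₗ[ℂ] E t}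
    (hΨ : ∀ (U : Set ℂˣ) (a : ∀ t, E t), IsOpen U → IsHolSection F a U →
      IsHolSection F (fun t => Ψ t (a t)) U) (k : ℕ) (U : Set ℂˣ) (a : ∀ t, E t) (hU : IsOpen U)
    (ha : IsHolSection F a U) : IsHolSection F (fun t => (Ψ t ^ k) (a t)) U := by
  induction k with
  | zero => simpa using ha
  | succ k ih =>
    simp only [pow_succ', Module.End.mul_apply]
    exact hΨ U _ hU ih

variable [∀ t, FiniteDimensional ℂ (E t)]

include bF in
/-- In the cyclic case, `Φ(∂/∂t)^(n+1)` is a nonzero constant. -/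
theorem TTData.IsTTStar.exists_phi_pow_eq (hD : D.IsTTStar F)
    (hdim : ∀ t, Module.finrank ℂ (E t) = n + 1) (hPhi : ∀ t, D.Phi t ≠ 0) {ω₀ : ℂ}
    (hω : IsPrimitiveRoot ω₀ (n + 1)) {S : ∀ t, E t ≃ₗ[ℂ] E t}
    (hS : IsTTIso F F D (D.scale ω₀) S)
    (T : ∀ (y : ℝ) (t : ℂˣ), (rho ((y : ℂ) * Complex.I) *ᵖ E) t ≃ₗ[ℂ] E t)
    (hT : ∀ y : ℝ, IsTTIso F F (D.rhoAct ((y : ℂ) * Complex.I)) D (T y)) :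
    ∃ a : ℂ, a ≠ 0 ∧ ∀ t, D.phi t ^ (n + 1) = a • 1 := by
  have hnt : ∀ t, Nontrivial (E t) := fun t =>
    Module.nontrivial_of_finrank_pos (R := ℂ) (by rw [hdim]; exact Nat.succ_pos n)
  choose a ha using fun t => exists_pow_eq_smul (hdim t) hω (hS.phi_scale t)
  have haa : ∀ t v, (D.phi t ^ (n + 1)) v = a t • v := fun t v => by rw [ha]; rfl
  have hhol : ∀ t, HolAt a t := hD.holAt_scalar hnt
    (isHolSection_pow (fun U a hU ha => hD.holSecAt_phi hU ha) (n + 1)) haa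
  have hrot : ∀ (y : ℝ) t, a (rho (-((y : ℂ) * Complex.I)) t) = a t := by
    intro y t
    obtain ⟨v, hv⟩ := @exists_ne _ (hnt t) (0 : E t)
    have h1 : ∀ k : ℕ, (D.phi (rho (-((y : ℂ) * Complex.I)) t) ^ k)
        (rotMap ((y : ℂ) * Complex.I) (T y) t v) =
        rotMap ((y : ℂ) * Complex.I) (T y) t ((D.phi t ^ k) v) := by
      intro k
      induction k with
      | zero => rfl
      | succ k ih => rw [pow_succ', Module.End.mul_apply, ih, (hT y).phi_rotMap, pow_succ',
          Module.End.mul_apply]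
    have h2 := h1 (n + 1)
    rw [haa, haa, map_smul] at h2
    exact smul_left_injective ℂ
      ((LinearEquiv.map_ne_zero_iff (rotMap ((y : ℂ) * Complex.I) (T y) t)).2 hv) h2
  have hconst := eq_of_holAt_of_rotation_invariant hhol hrot
  -- A vanishing constant would make `φ` nilpotent on every fibre.
  refine ⟨a 1, fun h0 => ?_, fun t => by rw [ha t, hconst t 1]⟩
  exact hD.not_nilpotent bF (fun t => by rw [ha t, hconst t 1, h0, zero_smul])
    (fun t => TTData.phi_ne_zero (hPhi t)) T hT

/-- The endomorphisms `N_t` and `S_t` of the fibres satisfy `N^(n+1) = 1` and `S N = ω₀ N S`, they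
are compatible with the tt*-structure, and `θ` is an eigenvalue of every `S_t`, with
`θ² ω₀^m = 1`. -/
structure IsCyclicTT (D : TTData E) (N : ∀ t, E t →ₗ[ℂ] E t) (S : ∀ t, E t ≃ₗ[ℂ] E t) (ω₀ θ : ℂ)
    (m : Fin (n + 1)) : Prop where
  dim : ∀ t, Module.finrank ℂ (E t) = n + 1
  prim : IsPrimitiveRoot ω₀ (n + 1)
  comm : ∀ t a, S t (N t a) = ω₀ • N t (S t a)
  pow : ∀ t, N t ^ (n + 1) = 1
  eta_S : ∀ t a b, D.eta t (S t a) (S t b) = D.eta t a b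
  eta_N : ∀ t a b, D.eta t (N t a) b = D.eta t a (N t b)
  g_S : ∀ t a b, D.g t (S t a) (S t b) = D.g t a b
  eigen : ∀ t, ∃ v, v ≠ 0 ∧ S t v = θ • v
  theta : θ ^ 2 * ω₀ ^ (m : ℕ) = 1

/-- The fibrewise eigenvalue of `S` is not canonical, but its power `θ^(n+1)`, the scalar by which
`S^(n+1)` acts, is. That power is continuous with square `1`, hence constant, and then every root of
it is an eigenvalue on every fibre. -/
theorem TTData.IsTTStar.exists_isCyclic (hD : D.IsTTStar F)
    (hdim : ∀ t, Module.finrank ℂ (E t) = n + 1) {ω₀ : ℂ}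
    (hω : IsPrimitiveRoot ω₀ (n + 1)) {S : ∀ t, E t ≃ₗ[ℂ] E t}
    (hS : IsTTIso F F D (D.scale ω₀) S) {c : ℂ} (hc : c ≠ 0)
    (hpow : ∀ t, D.phi t ^ (n + 1) = c ^ (n + 1) • 1) :
    ∃ (θ : ℂ) (m : Fin (n + 1)), IsCyclicTT D (fun t => c⁻¹ • D.phi t) S ω₀ θ m := by
  have hnt : ∀ t, Nontrivial (E t) := fun t =>
    Module.nontrivial_of_finrank_pos (R := ℂ) (by rw [hdim]; exact Nat.succ_pos n)
  have hcomm : ∀ t a, S t ((c⁻¹ • D.phi t) a) = ω₀ • (c⁻¹ • D.phi t) (S t a) := fun t a => by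
    rw [LinearMap.smul_apply, LinearMap.smul_apply, map_smul, hS.phi_scale, smul_comm]
  have hN : ∀ t, (c⁻¹ • D.phi t) ^ (n + 1) = 1 := fun t => by
    rw [smul_pow, hpow, smul_smul, inv_pow, inv_mul_cancel₀ (pow_ne_zero _ hc), one_smul]
  have hηS : ∀ t a b, D.eta t (S t a) (S t b) = D.eta t a b := fun t a b => (hS.eta_eq t a b).symm
  have hex : ∀ t, ∃ (θ : ℂ) (v : E t), v ≠ 0 ∧ S t v = θ • v := by
    intro t
    have := hnt t
    obtain ⟨θ, hθ⟩ := Module.End.exists_eigenvalue (S t : E t →ₗ[ℂ] E t)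
    obtain ⟨v, hv⟩ := hθ.exists_hasEigenvector
    exact ⟨θ, v, hv.2, Module.End.mem_eigenspace_iff.1 hv.1⟩
  choose θ v hv0 hv using hex
  have hf : ∀ t a, ((S t : E t →ₗ[ℂ] E t) ^ (n + 1)) a = θ t ^ (n + 1) • a := fun t =>
    pow_eigen_eq_smul (hdim t) hω (hcomm t) (hN t) (hv0 t) (hv t)
  have hhol : ∀ t, HolAt (fun t => θ t ^ (n + 1)) t := hD.holAt_scalar hnt
    (isHolSection_pow (Ψ := fun t => (S t : E t →ₗ[ℂ] E t))
      (fun U a hU ha => (isHolSection_iff hU).2 fun t ht =>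
        hS.holSecAt ((isHolSection_iff hU).1 ha t ht)) (n + 1)) hf
  -- `S^(n+1)` is a scalar that preserves the nonzero form `η`.
  have hsq : ∀ t, (θ t ^ (n + 1)) ^ 2 = 1 := by
    intro t
    have h1 : ∀ (k : ℕ) (a b : E t), D.eta t (((S t : E t →ₗ[ℂ] E t) ^ k) a)
        (((S t : E t →ₗ[ℂ] E t) ^ k) b) = D.eta t a b := by
      intro k
      induction k with
      | zero => simp
      | succ k ih =>
        intro a b
        rw [pow_succ', Module.End.mul_apply, Module.End.mul_apply, LinearEquiv.coe_coe, hηS, ih]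
    obtain ⟨w, hw⟩ : ∃ w, D.eta t (v t) w ≠ 0 := by
      by_contra! h
      exact hv0 t (hD.eta_nondeg t _ h)
    have h2 := h1 (n + 1) (v t) w
    rw [hf, hf, map_smul, map_smul, LinearMap.smul_apply, smul_smul, smul_eq_mul, ← sq] at h2
    exact mul_right_cancel₀ hw (h2.trans (one_mul _).symm)
  -- On a connected set, functions with equal nonvanishing squares agree up to one global sign,
  -- which is settled at `1`.
  have hconst : ∀ t, θ t ^ (n + 1) = θ 1 ^ (n + 1) := by
    have hcont : ContinuousOn (fun t => θ t ^ (n + 1)) univ := fun t _ =>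
      (hhol t).continuousAt.continuousWithinAt
    have h1 := isPreconnected_univ_units.eq_or_eq_neg_of_sq_eq hcont
      (continuousOn_const (c := θ 1 ^ (n + 1)))
      (fun t _ => by simp only [Pi.pow_apply]; rw [hsq, hsq])
      (fun _ h0 => by have := hsq 1; rw [h0] at this; simp at this)
    rcases h1 with h1 | h1
    · exact fun t => h1 (mem_univ t)
    · have h2 := h1 (mem_univ (1 : ℂˣ))
      simp only [Pi.neg_apply] at h2
      have h3 := hsq 1
      rw [self_eq_neg.1 h2] at h3
      simp at h3
  obtain ⟨m, hm⟩ := exists_eta_powVec_ne_zero (hdim 1) hω (hcomm 1) (hN 1) (hv0 1) (hv 1)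
    (hD.eta_nondeg 1)
  refine ⟨θ 1, m, hdim, hω, hcomm, hN, hηS, fun t a b => ?_, fun t a b => (hS.g_eq t a b).symm,
    fun t => ?_, eigenvalue_of_eta_ne_zero (hcomm 1) (hv 1) (hηS 1) hm⟩
  · rw [LinearMap.smul_apply, LinearMap.smul_apply, map_smul, map_smul, LinearMap.smul_apply]
    congr 1
    exact hD.Phi_self_adj t (ddt t) a b
  · exact exists_eigen_of_pow_eq (hdim t) hω (hcomm t) (hN t) (hv0 t) (hv t) (hconst t).symm

end cyclic

/-! ### Toda vectors -/

section todaVec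

variable {F : Type*} [NormedAddCommGroup F] [NormedSpace ℂ F] [FiniteDimensional ℂ F]
  {E : ℂˣ → Type*} [∀ t, AddCommGroup (E t)] [∀ t, Module ℂ (E t)]
  [∀ t, TopologicalSpace (E t)] [TopologicalSpace (TotalSpace F E)]
  [FiberBundle F E] [VectorBundle ℂ F E] [ContMDiffVectorBundle ω F E 𝓘(ℂ, ℂ)] {D : TTData E}
  {n : ℕ} {N : ∀ t, E t →ₗ[ℂ] E t} {S : ∀ t, E t ≃ₗ[ℂ] E t} {ω₀ θ : ℂ} {m : Fin (n + 1)}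

/-- A vector `v` of `E_t` that is the first vector of a frame `v, N v, …, N^n v` of `E_t` which
diagonalizes `S` and in which `η` has the normal form. -/
def IsTodaVec (D : TTData E) (N : ∀ t, E t →ₗ[ℂ] E t) (S : ∀ t, E t ≃ₗ[ℂ] E t) (θ : ℂ)
    (m : Fin (n + 1)) (t : ℂˣ) (v : E t) : Prop :=
  S t v = θ • v ∧ D.eta t v (powVec n (N t) v m) = 1

section

variable {t : ℂˣ} {u v : E t}

theorem IsTodaVec.ne_zero (hv : IsTodaVec D N S θ m t v) : v ≠ 0 := by
  rintro rfl
  simpa using hv.2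

variable [∀ t, FiniteDimensional ℂ (E t)]

theorem IsTodaVec.neg (hv : IsTodaVec D N S θ m t v) : IsTodaVec D N S θ m t (-v) := by
  refine ⟨by rw [map_neg, hv.1, smul_neg], ?_⟩
  rw [powVec_neg, map_neg, map_neg, LinearMap.neg_apply, neg_neg, hv.2]

/-- The eigenspace is a line and the normalization is quadratic in the vector. -/
theorem IsTodaVec.eq_or_eq_neg (hC : IsCyclicTT D N S ω₀ θ m) (hu : IsTodaVec D N S θ m t u)
    (hv : IsTodaVec D N S θ m t v) : u = v ∨ u = -v := by
  obtain ⟨x, rfl⟩ := eq_smul_of_eigen (hC.dim t) hC.prim (hC.comm t) (hC.pow t) hv.ne_zero hv.1 hu.1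
  have h := hu.2
  rw [powVec_smul, map_smul, map_smul, LinearMap.smul_apply, hv.2, smul_eq_mul, smul_eq_mul,
    mul_one] at h
  rcases mul_self_eq_one_iff.1 h with rfl | rfl
  · left; rw [one_smul]
  · right; rw [neg_smul, one_smul]

/-- The basis `v, N v, …, N^n v`. -/
def IsTodaVec.basis (hC : IsCyclicTT D N S ω₀ θ m) (hv : IsTodaVec D N S θ m t v) :
    Module.Basis (Fin (n + 1)) ℂ (E t) :=
  powBasis (hC.dim t) hC.prim (hC.comm t) (hC.pow t) hv.ne_zero hv.1

theorem IsTodaVec.basis_apply (hC : IsCyclicTT D N S ω₀ θ m) (hv : IsTodaVec D N S θ m t v)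
    (j : Fin (n + 1)) : hv.basis hC j = powVec n (N t) v j := powBasis_apply _ _ _ _ _ _ j

theorem IsTodaVec.eta_eq (hC : IsCyclicTT D N S ω₀ θ m) (hv : IsTodaVec D N S θ m t v)
    (i j : Fin (n + 1)) : D.eta t (powVec n (N t) v i) (powVec n (N t) v j) =
      if i + j = m then 1 else 0 := by
  rw [eta_powVec (hC.pow t) (hC.eta_N t)]
  split_ifs with h
  · rw [h, hv.2]
  · exact eta_powVec_eq_zero (hC.dim t) hC.prim (hC.comm t) (hC.pow t) hv.ne_zero hv.1
      (hC.eta_S t) hC.theta h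

theorem IsTodaVec.g_eq_zero (hC : IsCyclicTT D N S ω₀ θ m) (hD : D.IsTTStar F)
    (hv : IsTodaVec D N S θ m t v) {i j : Fin (n + 1)} (hij : i ≠ j) :
    D.g t (powVec n (N t) v i) (powVec n (N t) v j) = 0 :=
  g_powVec_eq_zero hC.prim (hC.comm t) hv.ne_zero hv.1 (hC.g_S t) (hD.g_pos t) hij

omit [FiniteDimensional ℂ F] [VectorBundle ℂ F E] [ContMDiffVectorBundle ω F E 𝓘(ℂ, ℂ)]
  [∀ t, FiniteDimensional ℂ (E t)] in
theorem TTData.IsTTStar.ofReal_re_g (hD : D.IsTTStar F) (a : E t) :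
    (((D.g t a a).re : ℝ) : ℂ) = D.g t a a := Complex.conj_eq_iff_re.1 (hD.g_herm t a a).symm

/-- The reality condition `κ² = 1` in a Toda frame. -/
theorem IsTodaVec.g_mul_g (hC : IsCyclicTT D N S ω₀ θ m) (hD : D.IsTTStar F)
    (hv : IsTodaVec D N S θ m t v) (i : Fin (n + 1)) :
    (D.g t (powVec n (N t) v i) (powVec n (N t) v i)).re *
      (D.g t (powVec n (N t) v (m - i)) (powVec n (N t) v (m - i))).re = 1 := by
  obtain ⟨κ, hκ, hκ2⟩ := hD.real_structure
  -- Orthogonality for `g` and the antidiagonal form of `η` force `κ` to send the `i`-th line to the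
  -- `(m - i)`-th; then `κ² = 1` gives the product of the two lengths.
  have h1 : ∀ i, κ t (powVec n (N t) v i) =
      D.g t (powVec n (N t) v i) (powVec n (N t) v i) • powVec n (N t) v (m - i) := by
    intro i
    refine sub_eq_zero.1 (hD.eta_nondeg t _ fun b => ?_)
    rw [← (hv.basis hC).sum_repr b]
    simp only [map_sum, map_smul, hv.basis_apply hC]
    refine Finset.sum_eq_zero fun j _ => ?_
    rw [map_sub, LinearMap.sub_apply, ← hκ, map_smul, LinearMap.smul_apply, hv.eta_eq hC]
    by_cases hij : i = j
    · subst hij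
      simp
    · rw [hv.g_eq_zero hC hD hij, if_neg, smul_zero, sub_zero, smul_zero]
      intro h
      exact hij (by rw [sub_add_eq_add_sub, sub_eq_iff_eq_add] at h; exact (add_left_cancel h).symm)
  have h2 := hκ2 t (powVec n (N t) v i)
  rw [h1, LinearMap.map_smulₛₗ, h1, sub_sub_cancel, smul_smul, ← hD.g_herm] at h2
  have h3 := smul_left_injective ℂ (powVec_ne_zero (hC.pow t) hv.ne_zero i)
    (h2.trans (one_smul ℂ _).symm)
  rw [← hD.ofReal_re_g, ← hD.ofReal_re_g (powVec n (N t) v (m - i))] at h3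
  exact_mod_cast h3

end

variable [∀ t, FiniteDimensional ℂ (E t)]

theorem isHolSection_powVec (hN : ∀ (U : Set ℂˣ) (a : ∀ t, E t), IsOpen U → IsHolSection F a U →
      IsHolSection F (fun t => N t (a t)) U) {U : Set ℂˣ} (hU : IsOpen U) {e : ∀ t, E t}
    (he : IsHolSection F e U) (j : Fin (n + 1)) :
    IsHolSection F (fun t => powVec n (N t) (e t) j) U := isHolSection_pow hN j U e hU he

theorem isHolFrame_powVec (hC : IsCyclicTT D N S ω₀ θ m)
    (hN : ∀ (U : Set ℂˣ) (a : ∀ t, E t), IsOpen U → IsHolSection F a U →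
      IsHolSection F (fun t => N t (a t)) U) {U : Set ℂˣ} (hU : IsOpen U) {e : ∀ t, E t}
    (he : IsHolSection F e U) (hv : ∀ t ∈ U, IsTodaVec D N S θ m t (e t)) :
    IsHolFrame F (fun (j : Fin (n + 1)) t => powVec n (N t) (e t) j) U where
  linearIndependent {t} ht := by
    have h := ((hv t ht).basis hC).linearIndependent
    rwa [show ⇑((hv t ht).basis hC) = _ from funext ((hv t ht).basis_apply hC)] at h
  generating {t} ht := by
    have h := ((hv t ht).basis hC).span_eq
    rw [show ⇑((hv t ht).basis hC) = _ from funext ((hv t ht).basis_apply hC)] at h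
    exact h.ge
  contMDiffOn j := isHolSection_powVec hN hU he j

/-- Toda vectors can be chosen holomorphically near every point. -/
theorem exists_todaVec (hC : IsCyclicTT D N S ω₀ θ m) (hD : D.IsTTStar F)
    (hN : ∀ (U : Set ℂˣ) (a : ∀ t, E t), IsOpen U → IsHolSection F a U →
      IsHolSection F (fun t => N t (a t)) U)
    (hS : ∀ (U : Set ℂˣ) (a : ∀ t, E t), IsOpen U → IsHolSection F a U →
      IsHolSection F (fun t => S t (a t)) U) (p : ℂˣ) :
    ∃ (U : Set ℂˣ) (e : ∀ t, E t), IsOpen U ∧ p ∈ U ∧ IsHolSection F e U ∧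
      ∀ t ∈ U, IsTodaVec D N S θ m t (e t) := by
  obtain ⟨v, hv0, hv⟩ := hC.eigen p
  have hθ := eigen_ne_zero hv0 hv
  obtain ⟨W, b, hW, hpW, hb, hbp⟩ := exists_holSection_eq (F := F) v
  have hSn : ∀ t (a : E t), ((S t : E t →ₗ[ℂ] E t) ^ (n + 1)) a = θ ^ (n + 1) • a := fun t a => by
    obtain ⟨v, hv0, hv⟩ := hC.eigen t
    exact pow_eigen_eq_smul (hC.dim t) hC.prim (hC.comm t) (hC.pow t) hv0 hv a
  -- Since `S^(n+1) = θ^(n+1)`, this is `n + 1` times the projection to the `θ`-eigenspace. It keeps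
  -- sections holomorphic, and at `p` it multiplies `v` by `n + 1`.
  set u : ∀ t, E t := fun t =>
    ∑ k ∈ Finset.range (n + 1), (θ⁻¹) ^ k • ((S t : E t →ₗ[ℂ] E t) ^ k) (b t) with hu
  have huS : ∀ t, S t (u t) = θ • u t := by
    intro t
    have h1 : ∀ k, θ⁻¹ ^ k • S t (((S t : E t →ₗ[ℂ] E t) ^ k) (b t)) =
        θ • (θ⁻¹ ^ (k + 1) • ((S t : E t →ₗ[ℂ] E t) ^ (k + 1)) (b t)) := fun k => by
      rw [smul_smul, pow_succ' (θ⁻¹), mul_inv_cancel_left₀ hθ, pow_succ' (S t : E t →ₗ[ℂ] E t)]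
      rfl
    simp only [hu, map_sum, map_smul, h1, ← Finset.smul_sum]
    congr 1
    rw [Finset.sum_range_succ, hSn, smul_smul, inv_pow, inv_mul_cancel₀ (pow_ne_zero _ hθ),
      one_smul, Finset.sum_range_succ']
    simp
  have huh : IsHolSection F u W := by
    rw [isHolSection_iff hW]
    intro t ht
    exact HolSecAt.sum fun k _ => HolSecAt.const_smul _ ((isHolSection_iff hW).1
      (isHolSection_pow (Ψ := fun t => (S t : E t →ₗ[ℂ] E t)) hS k W b hW hb) t ht)
  have hup : u p ≠ 0 := by
    have h1 : ∀ k : ℕ, ((S p : E p →ₗ[ℂ] E p) ^ k) v = θ ^ k • v := by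
      intro k
      induction k with
      | zero => simp
      | succ k ih =>
        rw [pow_succ', Module.End.mul_apply, ih, map_smul, LinearEquiv.coe_coe, hv,
          smul_smul, ← pow_succ]
    simp only [hu, hbp, h1, smul_smul, ← mul_pow, inv_mul_cancel₀ hθ, one_pow, one_smul,
      Finset.sum_const, Finset.card_range]
    rw [← Nat.cast_smul_eq_nsmul ℂ]
    exact smul_ne_zero (Nat.cast_ne_zero.2 (Nat.succ_ne_zero n)) hv0
  set h : ℂˣ → ℂ := fun t => D.eta t (u t) (powVec n (N t) (u t) m) with hh
  have hhol : HolAt h p := hD.holAt_eta hW huh (isHolSection_powVec hN hW huh m) hpW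
  have hhp : h p ≠ 0 := eta_powVec_ne_zero (hC.dim p) hC.prim (hC.comm p) (hC.pow p) hup (huS p)
    (hC.eta_S p) (hD.eta_nondeg p) hC.theta
  -- Dividing `u` by a square root of `η(u, N^m u)` produces the normalization.
  obtain ⟨q, hq, hqh⟩ := hhol.exists_sqrt hhp
  obtain ⟨U, hUsub, hU, hpU⟩ := eventually_nhds_iff.1
    ((hq.eventually.and hqh).and (hW.eventually_mem hpW))
  refine ⟨U, fun t => (q t)⁻¹ • u t, hU, hpU, ?_, fun t ht => ⟨?_, ?_⟩⟩
  · rw [isHolSection_iff hU]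
    intro t ht
    obtain ⟨⟨h1, -, h2⟩, h3⟩ := hUsub t ht
    exact HolSecAt.smul (h1.inv h2) ((isHolSection_iff hW).1 huh t h3)
  · rw [map_smul, huS, smul_comm]
  · obtain ⟨⟨-, h1, h2⟩, -⟩ := hUsub t ht
    rw [powVec_smul, map_smul, map_smul, LinearMap.smul_apply, smul_eq_mul, smul_eq_mul]
    change (q t)⁻¹ * ((q t)⁻¹ * h t) = 1
    rw [← h1]
    field_simp

end todaVec

/-! ### The Toda equation in a Toda frame -/

section todaEquation

variable {n : ℕ}

/-- The matrix of the cyclic shift `e_j ↦ e_{j+1}`. -/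
def shiftMatrix (n : ℕ) : Matrix (Fin (n + 1)) (Fin (n + 1)) ℂ :=
  Matrix.of fun i j => if i = j + 1 then 1 else 0

theorem inv_diagonal_exp (x : Fin (n + 1) → ℝ) :
    (Matrix.diagonal fun j => (Real.exp (x j) : ℂ))⁻¹ =
      Matrix.diagonal fun j => (Real.exp (-x j) : ℂ) := by
  refine Matrix.inv_eq_right_inv ?_
  rw [Matrix.diagonal_mul_diagonal, ← Matrix.diagonal_one]
  congr 1
  funext j
  rw [← Complex.ofReal_mul, ← Real.exp_add, add_neg_cancel, Real.exp_zero, Complex.ofReal_one]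

/-- The adjoint of the weighted shift is the weighted backward shift, so both products are diagonal:
one sees the step from `j - 1` to `j`, the other the step from `j` to `j + 1`. -/
theorem commutator_adjMatrix_shift (c : ℂ) (x : Fin (n + 1) → ℝ)
    {G A : ℂˣ → Matrix (Fin (n + 1)) (Fin (n + 1)) ℂ} {t : ℂˣ}
    (hG : G t = Matrix.diagonal fun j => (Real.exp (x j) : ℂ)) (hA : A t = c • shiftMatrix n) :
    A t * adjMatrix G A t - adjMatrix G A t * A t = (c * conj c) • Matrix.diagonal fun j =>
      ((Real.exp (x j - x (j - 1)) - Real.exp (x (j + 1) - x j) : ℝ) : ℂ) := by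
  have hadj : adjMatrix G A t = conj c • Matrix.of fun i j =>
      if j = i + 1 then (Real.exp (x j - x i) : ℂ) else 0 := by
    rw [adjMatrix, hG, hA, inv_diagonal_exp]
    ext i j
    simp only [Matrix.mul_diagonal, Matrix.diagonal_mul, Matrix.conjTranspose_apply,
      Matrix.smul_apply, shiftMatrix, Matrix.of_apply, smul_eq_mul, star_mul', RCLike.star_def]
    split_ifs with h
    · rw [sub_eq_neg_add, Real.exp_add, map_one, Complex.ofReal_mul]
      ring
    · simp
  rw [hadj, hA]
  ext i k
  simp only [shiftMatrix, Matrix.smul_mul, Matrix.mul_smul, Matrix.sub_apply, Matrix.smul_apply,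
    Matrix.mul_apply, Matrix.of_apply, smul_eq_mul, Matrix.diagonal_apply]
  have h1 : (∑ j, (if i = j + 1 then (1 : ℂ) else 0) *
      if k = j + 1 then (Real.exp (x k - x j) : ℂ) else 0) =
      if i = k then (Real.exp (x i - x (i - 1)) : ℂ) else 0 := by
    rw [Finset.sum_eq_single (i - 1)]
    · by_cases h : i = k
      · subst h; simp
      · simp [h, Ne.symm h]
    · intro j _ hj
      rw [if_neg (fun h => hj (by rw [h, add_sub_cancel_right])), zero_mul]
    · simp
  have h2 : (∑ j, (if j = i + 1 then (Real.exp (x j - x i) : ℂ) else 0) *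
      if j = k + 1 then (1 : ℂ) else 0) =
      if i = k then (Real.exp (x (i + 1) - x i) : ℂ) else 0 := by
    rw [Finset.sum_eq_single (i + 1)]
    · by_cases h : i = k
      · subst h; simp
      · simp [h]
    · intro j _ hj
      rw [if_neg hj, zero_mul]
    · simp
  rw [h1, h2]
  by_cases h : i = k
  · simp only [h, if_true, Complex.ofReal_sub]
    ring
  · simp [h]

variable {u : Fin (n + 1) → ℂˣ → ℝ}

/-- A diagonal Chern matrix consists of logarithmic derivatives; the dilation contributes `c` from
`∂` and `c̄` from `∂̄`. -/
theorem matWirtBar_chernMatrix_diagonal (hu : ∀ j s, SmoothAt (fun s => (u j s : ℂ)) s) (c t : ℂˣ) :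
    matWirtBar (chernMatrix fun s => Matrix.diagonal fun j => (Real.exp (u j (c * s)) : ℂ)) t =
      ((c : ℂ) * conj (c : ℂ)) • Matrix.diagonal fun j =>
        wirt (wirtBar fun s => (u j s : ℂ)) (c * t) := by
  have hc : ∀ j s, SmoothAt (fun s => (u j (c * s) : ℂ)) s := fun j s => smoothAt_comp_mul c (hu j _)
  have h1 : (chernMatrix fun s => Matrix.diagonal fun j => (Real.exp (u j (c * s)) : ℂ)) =
      fun s => Matrix.diagonal fun j => wirt (fun s => (u j (c * s) : ℂ)) s := by
    funext s
    have h2 : matWirt (fun s => Matrix.diagonal fun j => (Real.exp (u j (c * s)) : ℂ)) s =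
        Matrix.diagonal fun j => (Real.exp (u j (c * s)) : ℂ) *
          wirt (fun s => (u j (c * s) : ℂ)) s := by
      ext i j
      simp only [matWirt, Matrix.of_apply, Matrix.diagonal_apply]
      split_ifs with h
      · simp only [Complex.ofReal_exp]
        exact wirt_cexp (hc i s)
      · exact wirt_const _
    rw [chernMatrix, h2, inv_diagonal_exp, Matrix.diagonal_mul_diagonal]
    congr 1
    funext j
    rw [← mul_assoc, ← Complex.ofReal_mul, ← Real.exp_add, neg_add_cancel, Real.exp_zero,
      Complex.ofReal_one, one_mul]
  rw [h1]
  ext i j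
  simp only [matWirtBar, Matrix.of_apply, Matrix.smul_apply, Matrix.diagonal_apply, smul_eq_mul]
  split_ifs with h
  · have h3 : (fun s => wirt (fun s => (u i (c * s) : ℂ)) s) =
        fun s => (c : ℂ) * (wirt fun s => (u i s : ℂ)) (c * s) :=
      funext fun s => wirt_comp_mul c (hu i _)
    have hw : SmoothAt (wirt fun s => (u i s : ℂ)) (c * t) := smoothAt_wirt (hu i _)
    rw [h3, wirtBar_mul (smoothAt_const _) (smoothAt_comp_mul c hw), wirtBar_const,
      wirtBar_comp_mul c hw, wirt_wirtBar_comm (hu i _)]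
    ring
  · rw [mul_zero]
    exact wirtBar_const _

/-- For a diagonal metric in a frame that is cyclically permuted by `Φ`, the tt*-equation is the
Toda equation. -/
theorem ttEquationAt_diagonal_iff (hu : ∀ j s, SmoothAt (fun s => (u j s : ℂ)) s) {c t : ℂˣ}
    {A : ℂˣ → Matrix (Fin (n + 1)) (Fin (n + 1)) ℂ} (hA : A t = (c : ℂ) • shiftMatrix n) :
    TTEquationAt (fun s => Matrix.diagonal fun j => (Real.exp (u j (c * s)) : ℂ)) A t ↔
      ∀ j, TodaAt u j (c * t) := by
  -- The factor `|c|²` occurs both in the curvature and in the commutator, and cancels.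
  have hc : (c : ℂ) * conj (c : ℂ) ≠ 0 := by simp
  rw [TTEquationAt, neg_inj, matWirtBar_chernMatrix_diagonal hu,
    commutator_adjMatrix_shift (c : ℂ) (fun j => u j (c * t)) rfl hA, smul_right_inj hc,
    Matrix.diagonal_injective.eq_iff, funext_iff]
  rfl

theorem TTData.IsHiggsMatrix.eq_smul_shiftMatrix {E : ℂˣ → Type*} [∀ t, AddCommGroup (E t)]
    [∀ t, Module ℂ (E t)] {D : TTData E} {e : Fin (n + 1) → ∀ t, E t} {U : Set ℂˣ}
    {A : ℂˣ → Matrix (Fin (n + 1)) (Fin (n + 1)) ℂ} (hA : D.IsHiggsMatrix e U A) {t : ℂˣ}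
    (ht : t ∈ U) {c : ℂ} (hli : LinearIndependent ℂ fun j => e j t)
    (hphi : ∀ j, D.phi t (e j t) = c • e (j + 1) t) : A t = c • shiftMatrix n := by
  ext i j
  have h1 : ∑ i, A t i j • e i t = ∑ i, (c • shiftMatrix n) i j • e i t := by
    rw [← hA t ht j]
    refine (hphi j).trans ?_
    rw [Finset.sum_eq_single (j + 1)]
    · simp [shiftMatrix]
    · intro i _ hi
      simp [shiftMatrix, hi]
    · simp
  have h2 := Fintype.linearIndependent_iff.1 hli (fun i => A t i j - (c • shiftMatrix n) i j) (by
    simp only [sub_smul, Finset.sum_sub_distrib]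
    rw [h1, sub_self])
  exact sub_eq_zero.1 (h2 i)

end todaEquation

/-! ### The solution of the Toda equation -/

section todaMetric

variable {F : Type*} [NormedAddCommGroup F] [NormedSpace ℂ F] [FiniteDimensional ℂ F]
  {E : ℂˣ → Type*} [∀ t, AddCommGroup (E t)] [∀ t, Module ℂ (E t)]
  [∀ t, TopologicalSpace (E t)] [TopologicalSpace (TotalSpace F E)]
  [FiberBundle F E] [VectorBundle ℂ F E] [ContMDiffVectorBundle ω F E 𝓘(ℂ, ℂ)] {D : TTData E}
  {n : ℕ} {N : ∀ t, E t →ₗ[ℂ] E t} {S : ∀ t, E t ≃ₗ[ℂ] E t} {ω₀ θ : ℂ} {m : Fin (n + 1)}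
  {c : ℂˣ} {w : Fin (n + 1) → ℂˣ → ℝ} [∀ t, FiniteDimensional ℂ (E t)]

theorem contMDiffAt_re {f : ℂˣ → ℂ} {t : ℂˣ} (hf : SmoothAt f t) :
    ContMDiffAt 𝓘(ℝ, ℂ) 𝓘(ℝ, ℝ) ∞ (fun s => (f s).re) t :=
  contMDiffAt_units_iff.2 (Complex.reCLM.contDiff.contDiffAt.comp _ hf.contDiffAt)

theorem contMDiffAt_log {f : ℂˣ → ℝ} {t : ℂˣ} (hf : ContMDiffAt 𝓘(ℝ, ℂ) 𝓘(ℝ, ℝ) ∞ f t)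
    (h0 : f t ≠ 0) : ContMDiffAt 𝓘(ℝ, ℂ) 𝓘(ℝ, ℝ) ∞ (fun s => Real.log (f s)) t :=
  contMDiffAt_units_iff.2 ((contMDiffAt_units_iff.1 hf).log (by simpa [unitOf_coe] using h0))

/-- `e^{w_j(ct)}` is the squared length of the `j`-th vector in the Toda frames at `t`. -/
def IsTodaMetric (D : TTData E) (N : ∀ t, E t →ₗ[ℂ] E t) (S : ∀ t, E t ≃ₗ[ℂ] E t) (θ : ℂ)
    (m : Fin (n + 1)) (c : ℂˣ) (w : Fin (n + 1) → ℂˣ → ℝ) : Prop :=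
  ∀ t v, IsTodaVec D N S θ m t v → ∀ j,
    D.g t (powVec n (N t) v j) (powVec n (N t) v j) = (Real.exp (w j (c * t)) : ℂ)

/-- Lengths do not see the sign ambiguity of Toda vectors. The local functions therefore agree, and
smoothness at each point can be read off from a holomorphic choice near it. -/
theorem exists_isTodaMetric (hC : IsCyclicTT D N S ω₀ θ m) (hD : D.IsTTStar F)
    (hN : ∀ (U : Set ℂˣ) (a : ∀ t, E t), IsOpen U → IsHolSection F a U →
      IsHolSection F (fun t => N t (a t)) U)
    (hS : ∀ (U : Set ℂˣ) (a : ∀ t, E t), IsOpen U → IsHolSection F a U →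
      IsHolSection F (fun t => S t (a t)) U) (c : ℂˣ) :
    ∃ w : Fin (n + 1) → ℂˣ → ℝ, (∀ j, ContMDiff 𝓘(ℝ, ℂ) 𝓘(ℝ, ℝ) ∞ (w j)) ∧
      IsTodaMetric D N S θ m c w := by
  choose U e hU hpU he hv using exists_todaVec hC hD hN hS
  have hpos : ∀ t (v : E t), IsTodaVec D N S θ m t v → ∀ j,
      0 < (D.g t (powVec n (N t) v j) (powVec n (N t) v j)).re := fun t v hv j =>
    hD.g_pos t _ (powVec_ne_zero (hC.pow t) hv.ne_zero j)
  set r : Fin (n + 1) → ℂˣ → ℝ := fun j t =>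
    (D.g t (powVec n (N t) (e t t) j) (powVec n (N t) (e t t) j)).re with hr
  have hrv : ∀ t (v : E t), IsTodaVec D N S θ m t v → ∀ j,
      (D.g t (powVec n (N t) v j) (powVec n (N t) v j)).re = r j t := by
    intro t v hv' j
    rcases hv'.eq_or_eq_neg hC (hv t t (hpU t)) with rfl | rfl
    · rfl
    · simp [hr, powVec_neg]
  refine ⟨fun j s => Real.log (r j (c⁻¹ * s)), fun j s => ?_, fun t v hv' j => ?_⟩
  · refine ContMDiffAt.comp (f := fun s => c⁻¹ * s) (g := fun t => Real.log (r j t)) s ?_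
      (contMDiff_mul_left (I := 𝓘(ℝ, ℂ)) (a := c⁻¹)).contMDiffAt
    set t := c⁻¹ * s
    refine contMDiffAt_log ?_ (hpos t _ (hv t t (hpU t)) j).ne'
    have h1 := isHolSection_powVec hN (hU t) (he t) j
    refine (contMDiffAt_re (hD.smoothAt_g (hU t) h1 h1 (hpU t))).congr_of_eventuallyEq ?_
    filter_upwards [(hU t).mem_nhds (hpU t)] with y hy
    exact (hrv y _ (hv t y hy) j).symm
  · change _ = ((Real.exp (Real.log (r j (c⁻¹ * (c * t)))) : ℝ) : ℂ)
    rw [inv_mul_cancel_left, ← hrv t v hv', Real.exp_log (hpos t v hv' j), hD.ofReal_re_g]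

theorem isTodaFrameOn_powVec (hC : IsCyclicTT D N S ω₀ θ m) (hD : D.IsTTStar F)
    (hN : ∀ (U : Set ℂˣ) (a : ∀ t, E t), IsOpen U → IsHolSection F a U →
      IsHolSection F (fun t => N t (a t)) U)
    (hphi : ∀ t, D.phi t = (c : ℂ) • N t) (hw : IsTodaMetric D N S θ m c w) {U : Set ℂˣ}
    (hU : IsOpen U) {e : ∀ t, E t} (he : IsHolSection F e U)
    (hv : ∀ t ∈ U, IsTodaVec D N S θ m t (e t)) :
    IsTodaFrameOn F D (m + 1) c w (fun (j : Fin (n + 1)) t => powVec n (N t) (e t) j) U where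
  frame := isHolFrame_powVec hC hN hU he hv
  -- With `l = m + 1` the condition `i + j = l - 1` is `i + j = m`.
  eta_eq t ht i j := by rw [(hv t ht).eta_eq hC, add_sub_cancel_right]
  Phi_eq t ht X j := by
    rw [D.Phi_eq_smul, LinearMap.smul_apply, hphi, LinearMap.smul_apply, apply_powVec (hC.pow t),
      smul_smul, mul_comm]
    congr 2
    exact (dCoord_apply t X).symm
  g_eq t ht i j := by
    split_ifs with h
    · rw [h, hw t _ (hv t ht)]
    · exact (hv t ht).g_eq_zero hC hD h

theorem higgsMatrix_eq_smul_shiftMatrix (hC : IsCyclicTT D N S ω₀ θ m)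
    (hphi : ∀ t, D.phi t = (c : ℂ) • N t) {U : Set ℂˣ} {e : ∀ t, E t}
    (hv : ∀ t ∈ U, IsTodaVec D N S θ m t (e t))
    {A : ℂˣ → Matrix (Fin (n + 1)) (Fin (n + 1)) ℂ}
    (hA : D.IsHiggsMatrix (fun (j : Fin (n + 1)) t => powVec n (N t) (e t) j) U A) {t : ℂˣ}
    (ht : t ∈ U) : A t = (c : ℂ) • shiftMatrix n := by
  refine hA.eq_smul_shiftMatrix ht ?_ fun j => ?_
  · have h := ((hv t ht).basis hC).linearIndependent
    rwa [show ⇑((hv t ht).basis hC) = _ from funext ((hv t ht).basis_apply hC)] at h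
  · rw [hphi, LinearMap.smul_apply, apply_powVec (hC.pow t)]

theorem isTTStarTodaSolution (hC : IsCyclicTT D N S ω₀ θ m) (hD : D.IsTTStar F)
    (hN : ∀ (U : Set ℂˣ) (a : ∀ t, E t), IsOpen U → IsHolSection F a U →
      IsHolSection F (fun t => N t (a t)) U)
    (hS : ∀ (U : Set ℂˣ) (a : ∀ t, E t), IsOpen U → IsHolSection F a U →
      IsHolSection F (fun t => S t (a t)) U)
    (hphi : ∀ t, D.phi t = (c : ℂ) • N t)
    (hws : ∀ j, ContMDiff 𝓘(ℝ, ℂ) 𝓘(ℝ, ℝ) ∞ (w j)) (hw : IsTodaMetric D N S θ m c w) :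
    IsTTStarTodaSolution (m + 1) w := by
  choose U e hU hpU he hv using exists_todaVec hC hD hN hS
  refine ⟨hws, fun j s => ?_, fun j s => ?_⟩
  · set p := c⁻¹ * s
    have hs : s = c * p := (mul_inv_cancel_left c s).symm
    set f : Fin (n + 1) → ∀ t, E t := fun j t => powVec n (N t) (e p t) j
    have hA : D.IsHiggsMatrix f (U p) fun _ => (c : ℂ) • shiftMatrix n := by
      intro t ht j
      change D.phi t _ = _
      rw [hphi, LinearMap.smul_apply, apply_powVec (hC.pow t), Finset.sum_eq_single (j + 1)]
      · simp [shiftMatrix, f]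
      · intro i _ hi
        simp [shiftMatrix, hi]
      · simp
    have hfr := isHolFrame_powVec hC hN (hU p) (he p) (hv p)
    have h1 := (hD.structure_equations (hU p) hfr hA (fun _ _ _ _ => contMDiffAt_const)
      (hpU p)).1
    set G : ℂˣ → Matrix (Fin (n + 1)) (Fin (n + 1)) ℂ := fun s =>
      Matrix.diagonal fun j => (Real.exp (w j (c * s)) : ℂ)
    have hG : ∀ t ∈ U p, D.gram f t = G t := by
      intro t ht
      ext i j
      simp only [TTData.gram, Matrix.of_apply, G, Matrix.diagonal_apply]
      exact (isTodaFrameOn_powVec hC hD hN hphi hw (hU p) (he p) (hv p)).g_eq t ht i j |>.trans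
        (by split_ifs with h <;> simp [h])
    -- Equality of germs is required because the curvature differentiates the Gram matrix.
    have hGe : ∀ t ∈ U p, D.gram f =ᶠ[𝓝 t] G := fun t ht => by
      filter_upwards [(hU p).mem_nhds ht] with y hy using hG y hy
    have hch : chernMatrix (D.gram f) =ᶠ[𝓝 p] chernMatrix G := by
      filter_upwards [(hU p).mem_nhds (hpU p)] with y hy
      rw [chernMatrix, chernMatrix, matWirt_congr (hGe y hy), hG y hy]
    rw [matWirtBar_congr hch] at h1
    have h2 : adjMatrix (D.gram f) (fun _ => (c : ℂ) • shiftMatrix n) p =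
        adjMatrix G (fun _ => (c : ℂ) • shiftMatrix n) p := by
      rw [adjMatrix, adjMatrix, hG p (hpU p)]
    rw [hs]
    refine (ttEquationAt_diagonal_iff (u := w) (fun j s => smoothAt_ofReal (hws j s))
      (A := fun _ => (c : ℂ) • shiftMatrix n) rfl).1 ?_ j
    rw [TTEquationAt, neg_inj]
    exact h1.trans (by rw [h2])
  · set p := c⁻¹ * s
    have hs : s = c * p := (mul_inv_cancel_left c s).symm
    -- The reality condition pairs `j` with `m - j = l - j - 1`; a product of exponentials equal to
    -- `1` means that the exponents sum to zero.
    have h := (hv p p (hpU p)).g_mul_g hC hD j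
    have h1 := hw p _ (hv p p (hpU p))
    rw [h1, h1, Complex.ofReal_re, Complex.ofReal_re, ← Real.exp_add, Real.exp_eq_one_iff] at h
    rw [hs, show m + 1 - j - 1 = m - j by abel, h]

end todaMetric

/-! ### Rotation of Toda vectors -/

/-- Near `1` the matrix `M + 1` is invertible, and it is a factor of `M² - 1 = 0`. So `1` is
isolated among involutions. -/
theorem eventually_eq_one_of_mul_self {X ι : Type*} [TopologicalSpace X] [Fintype ι]
    [DecidableEq ι] {M : X → Matrix ι ι ℂ} {x : X} (hM : ContinuousAt M x)
    (hsq : ∀ᶠ y in 𝓝 x, M y * M y = 1) (h1 : M x = 1) : ∀ᶠ y in 𝓝 x, M y = 1 := by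
  have hdet : ContinuousAt (fun y => (M y + 1).det) x :=
    ContinuousAt.comp (f := fun y => M y + 1) (g := Matrix.det)
      (Continuous.matrix_det continuous_id).continuousAt (hM.add continuousAt_const)
  have hx : (M x + 1).det ≠ 0 := by
    rw [h1, one_add_one_eq_two, show (2 : Matrix ι ι ℂ) = (2 : ℂ) • 1 by
      rw [two_smul, one_add_one_eq_two], Matrix.det_smul, Matrix.det_one, mul_one]
    exact pow_ne_zero _ two_ne_zero
  filter_upwards [hsq, hdet.eventually_ne hx] with y hy hy2
  have hu : IsUnit (M y + 1) := (Matrix.isUnit_iff_isUnit_det _).2 (isUnit_iff_ne_zero.2 hy2)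
  have h3 : (M y + 1) * (M y - 1) = (M y + 1) * 0 := by
    rw [mul_zero, add_mul, mul_sub, hy, mul_one, one_mul, sub_add_sub_cancel, sub_self]
  exact sub_eq_zero.1 (hu.mul_left_cancel h3)

section rotation

variable {F : Type*} [NormedAddCommGroup F] [NormedSpace ℂ F] [FiniteDimensional ℂ F]
  {E : ℂˣ → Type*} [∀ t, AddCommGroup (E t)] [∀ t, Module ℂ (E t)]
  [∀ t, TopologicalSpace (E t)] [TopologicalSpace (TotalSpace F E)]
  [FiberBundle F E] [VectorBundle ℂ F E] [ContMDiffVectorBundle ω F E 𝓘(ℂ, ℂ)] {D : TTData E}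
  {n : ℕ} {N : ∀ t, E t →ₗ[ℂ] E t} {S : ∀ t, E t ≃ₗ[ℂ] E t} {ω₀ θ : ℂ} {m : Fin (n + 1)}
  {c : ℂˣ} [∀ t, FiniteDimensional ℂ (E t)]

/-- The matrix of coefficients of `u, N u, …` with respect to `v, N v, …`, for a Toda vector `v`. -/
def todaCoeff (D : TTData E) (N : ∀ t, E t →ₗ[ℂ] E t) (m : Fin (n + 1)) (t : ℂˣ) (v u : E t) :
    Matrix (Fin (n + 1)) (Fin (n + 1)) ℂ :=
  Matrix.of fun i j => D.eta t u (powVec n (N t) v (m - i + j))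

section

variable {t : ℂˣ} {u v : E t}

theorem powVec_eq_sum_todaCoeff (hC : IsCyclicTT D N S ω₀ θ m) (hD : D.IsTTStar F)
    (hv : IsTodaVec D N S θ m t v) (j : Fin (n + 1)) :
    powVec n (N t) u j = ∑ i, todaCoeff D N m t v u i j • powVec n (N t) v i := by
  refine sub_eq_zero.1 (hD.eta_nondeg t _ fun b => ?_)
  rw [← (hv.basis hC).sum_repr b]
  simp only [map_sum, map_smul, hv.basis_apply hC]
  refine Finset.sum_eq_zero fun k _ => ?_
  rw [map_sub, LinearMap.sub_apply, eta_powVec (hC.pow t) (hC.eta_N t), map_sum,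
    LinearMap.sum_apply, Finset.sum_eq_single (m - k)]
  · rw [map_smul, LinearMap.smul_apply, hv.eta_eq hC, if_pos (sub_add_cancel m k), todaCoeff,
      Matrix.of_apply, sub_sub_cancel, smul_eq_mul, smul_eq_mul, mul_one, add_comm j k, sub_self, mul_zero]
  · intro i _ hi
    rw [map_smul, LinearMap.smul_apply, hv.eta_eq hC, if_neg (fun h => hi (eq_sub_of_add_eq h)),
      smul_zero]
  · simp

/-- `η(N^(m-i) u, N^k u)` is the identity matrix by hypothesis. Expanding its second argument in the
basis of `v` leaves pairings of `u` with that basis, which are again entries of the coefficient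
matrix. -/
theorem todaCoeff_mul_self (hC : IsCyclicTT D N S ω₀ θ m) (hD : D.IsTTStar F)
    (hv : IsTodaVec D N S θ m t v)
    (hu : ∀ k, D.eta t u (powVec n (N t) u k) = if k = m then 1 else 0) :
    todaCoeff D N m t v u * todaCoeff D N m t v u = 1 := by
  ext i k
  have h1 : D.eta t (powVec n (N t) u (m - i)) (powVec n (N t) u k) = if i = k then 1 else 0 := by
    rw [eta_powVec (hC.pow t) (hC.eta_N t), hu]
    congr 1
    rw [eq_iff_iff, sub_add_eq_add_sub, sub_eq_iff_eq_add, add_right_inj, eq_comm]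
  rw [powVec_eq_sum_todaCoeff hC hD hv k] at h1
  simp only [map_sum, map_smul, eta_powVec (hC.pow t) (hC.eta_N t)] at h1
  rw [Matrix.mul_apply, Matrix.one_apply, ← h1]
  exact Finset.sum_congr rfl fun j _ => mul_comm _ _

theorem eq_of_todaCoeff_eq_one (hC : IsCyclicTT D N S ω₀ θ m) (hD : D.IsTTStar F)
    (hv : IsTodaVec D N S θ m t v) (h : todaCoeff D N m t v u = 1) : u = v := by
  have h1 := powVec_eq_sum_todaCoeff hC hD hv (u := u) 0
  rw [h, powVec_zero, Finset.sum_eq_single 0] at h1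
  · rwa [Matrix.one_apply_eq, one_smul, powVec_zero] at h1
  · intro i _ hi
    rw [Matrix.one_apply_ne hi, zero_smul]
  · simp

theorem todaCoeff_self (hC : IsCyclicTT D N S ω₀ θ m) (hv : IsTodaVec D N S θ m t v) :
    todaCoeff D N m t v v = 1 := by
  ext i j
  have h := hv.eta_eq hC 0 (m - i + j)
  rw [powVec_zero, zero_add] at h
  rw [todaCoeff, Matrix.of_apply, h, Matrix.one_apply]
  congr 1
  rw [eq_iff_iff, sub_add_eq_add_sub, sub_eq_iff_eq_add, add_right_inj, eq_comm]

omit [∀ t, FiniteDimensional ℂ (E t)] in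
theorem todaCoeff_neg : todaCoeff D N m t v (-u) = -todaCoeff D N m t v u := by
  ext i j
  simp [todaCoeff]

theorem isTodaVec_iff_todaCoeff (hC : IsCyclicTT D N S ω₀ θ m) (hD : D.IsTTStar F)
    (hv : IsTodaVec D N S θ m t v) : IsTodaVec D N S θ m t u ↔
      todaCoeff D N m t v u = 1 ∨ todaCoeff D N m t v u = -1 := by
  constructor
  · intro hu
    rcases hu.eq_or_eq_neg hC hv with rfl | rfl
    · exact Or.inl (todaCoeff_self hC hv)
    · exact Or.inr (by rw [todaCoeff_neg, todaCoeff_self hC hv])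
  · rintro (h | h)
    · rwa [eq_of_todaCoeff_eq_one hC hD hv h]
    · rw [← neg_eq_iff_eq_neg, ← todaCoeff_neg] at h
      rw [← neg_neg u, eq_of_todaCoeff_eq_one hC hD hv h]
      exact hv.neg

end

variable {T : ∀ (y : ℝ) (t : ℂˣ), (rho ((y : ℂ) * Complex.I) *ᵖ E) t ≃ₗ[ℂ] E t}

theorem powVec_rotMap (hphi : ∀ t, D.phi t = (c : ℂ) • N t) {z : ℂ}
    {Tz : ∀ t, (rho z *ᵖ E) t ≃ₗ[ℂ] E t} (h : IsTTIso F F (D.rhoAct z) D Tz) (p : ℂˣ) (a : E p)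
    (j : Fin (n + 1)) :
    powVec n (N (rho (-z) p)) (rotMap z Tz p a) j = rotMap z Tz p (powVec n (N p) a j) := by
  have h1 : ∀ a, N (rho (-z) p) (rotMap z Tz p a) = rotMap z Tz p (N p a) := fun a => by
    have h2 := h.phi_rotMap p a
    rw [hphi, hphi, LinearMap.smul_apply, LinearMap.smul_apply, map_smul] at h2
    exact smul_right_injective _ c.ne_zero h2
  have h2 : ∀ k : ℕ, (N (rho (-z) p) ^ k) (rotMap z Tz p a) = rotMap z Tz p ((N p ^ k) a) := by
    intro k
    induction k with
    | zero => rfl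
    | succ k ih => rw [pow_succ', Module.End.mul_apply, ih, h1, pow_succ', Module.End.mul_apply]
  exact h2 j

/-- The vector to which `f ∈ E_p` is rotated by `T_{iy}`, as a point of `E`. -/
def rotPath (F : Type*) (T : ∀ (y : ℝ) (t : ℂˣ), (rho ((y : ℂ) * Complex.I) *ᵖ E) t ≃ₗ[ℂ] E t)
    (p : ℂˣ) (f : E p) (y : ℝ) : TotalSpace F E :=
  TotalSpace.mk' F (rho (-((y : ℂ) * Complex.I)) p) (rotMap ((y : ℂ) * Complex.I) (T y) p f)

/-- The isomorphisms `T_{iy}` carry Toda vectors to Toda vectors, as soon as one of them does. -/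
theorem isTodaVec_rotMap (hC : IsCyclicTT D N S ω₀ θ m) (hD : D.IsTTStar F)
    (hN : ∀ (U : Set ℂˣ) (a : ∀ t, E t), IsOpen U → IsHolSection F a U →
      IsHolSection F (fun t => N t (a t)) U)
    (hS : ∀ (U : Set ℂˣ) (a : ∀ t, E t), IsOpen U → IsHolSection F a U →
      IsHolSection F (fun t => S t (a t)) U)
    (hphi : ∀ t, D.phi t = (c : ℂ) • N t)
    (hT : ∀ y : ℝ, IsTTIso F F (D.rhoAct ((y : ℂ) * Complex.I)) D (T y)) {p : ℂˣ} {f : E p}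
    (hcont : Continuous (rotPath F T p f)) {x : ℝ}
    (hx : IsTodaVec D N S θ m _ (rotMap ((x : ℂ) * Complex.I) (T x) p f)) (y : ℝ) :
    IsTodaVec D N S θ m _ (rotMap ((y : ℂ) * Complex.I) (T y) p f) := by
  -- The isomorphisms preserve `η` and commute with `N`, so these pairings do not depend on `y`.
  -- Commutation with `S` is not available; only the eigenvector condition has to be propagated by
  -- continuity.
  have hη : ∀ (y : ℝ) k, D.eta _ (rotMap ((y : ℂ) * Complex.I) (T y) p f)
      (powVec n (N _) (rotMap ((y : ℂ) * Complex.I) (T y) p f) k) =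
        D.eta p f (powVec n (N p) f k) := fun y k => by
    rw [powVec_rotMap hphi (hT y), (hT y).eta_rotMap]
  have hη' : ∀ (y : ℝ) k, D.eta _ (rotMap ((y : ℂ) * Complex.I) (T y) p f)
      (powVec n (N _) (rotMap ((y : ℂ) * Complex.I) (T y) p f) k) = if k = m then 1 else 0 := by
    intro y k
    have h := hx.eta_eq hC 0 k
    rw [powVec_zero, zero_add, hη] at h
    rw [hη, h]
  set P : Set ℝ := {y | IsTodaVec D N S θ m _ (rotMap ((y : ℂ) * Complex.I) (T y) p f)} with hP
  -- In a local Toda basis the rotated vector gives a continuous family of involutions, and it is a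
  -- Toda vector exactly when the involution is `±1`.
  have key : ∀ x : ℝ, ∃ M : ℝ → Matrix (Fin (n + 1)) (Fin (n + 1)) ℂ, ContinuousAt M x ∧
      ∀ᶠ y in 𝓝 x, M y * M y = 1 ∧ (y ∈ P ↔ M y = 1 ∨ M y = -1) := by
    intro x
    obtain ⟨U, e, hU, hpU, he, hv⟩ := exists_todaVec hC hD hN hS (rotPath F T p f x).proj
    refine ⟨fun y => todaCoeff D N m _ (e (rotPath F T p f y).proj) (rotPath F T p f y).2,
      ?_, ?_⟩
    · refine continuousAt_pi.2 fun i => continuousAt_pi.2 fun j => ?_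
      exact hD.continuousAt_eta hcont.continuousAt hU (isHolSection_powVec hN hU he (m - i + j)) hpU
    · have hproj : Continuous fun y => (rotPath F T p f y).proj :=
        (FiberBundle.continuous_proj F E).comp hcont
      filter_upwards [hproj.continuousAt (hU.mem_nhds hpU)] with y hy
      exact ⟨todaCoeff_mul_self hC hD (hv _ hy) (hη' y), isTodaVec_iff_todaCoeff hC hD (hv _ hy)⟩
  -- Being equal to `±1` is a closed condition, and among involutions also an open one.
  have hclopen : IsClopen P := by
    constructor
    · rw [← isOpen_compl_iff, isOpen_iff_mem_nhds]
      intro x hxP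
      obtain ⟨M, hM, h⟩ := key x
      have h1 := h.self_of_nhds.2.not.1 hxP
      rw [not_or] at h1
      filter_upwards [h, hM.eventually_ne h1.1, hM.eventually_ne h1.2] with y hy h2 h3
      exact fun hyP => (hy.2.1 hyP).elim h2 h3
    · rw [isOpen_iff_mem_nhds]
      intro x hxP
      obtain ⟨M, hM, h⟩ := key x
      rcases h.self_of_nhds.2.1 hxP with h1 | h1
      · filter_upwards [h, eventually_eq_one_of_mul_self hM (h.mono fun y hy => hy.1) h1]
          with y hy h2
        exact hy.2.2 (Or.inl h2)
      · filter_upwards [h, eventually_eq_one_of_mul_self hM.neg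
          (h.mono fun y hy => by rw [Pi.neg_apply, neg_mul_neg, hy.1])
          (by rw [Pi.neg_apply, h1, neg_neg])] with y hy h2
        exact hy.2.2 (Or.inr (neg_eq_iff_eq_neg.1 h2))
  have huniv : P = univ := hclopen.eq_univ ⟨x, hx⟩
  exact eq_univ_iff_forall.1 huniv y

/-- The vector of `E_p` that is carried by `T_0` to `v`. -/
theorem exists_rotMap_zero (p : ℂˣ) : ∃ h : rho (-(((0 : ℝ) : ℂ) * Complex.I)) p = p, ∀ v : E p,
    ∃ f : E p, rotMap (((0 : ℝ) : ℂ) * Complex.I) (T 0) p f = fibreCast h.symm v :=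
  ⟨Units.ext (by rw [rho_val]; simp), fun _ => (rotMap _ (T 0) p).surjective _⟩

omit [∀ t, TopologicalSpace (E t)] [∀ t, FiniteDimensional ℂ (E t)] in
theorem isTodaVec_fibreCast {p q : ℂˣ} (h : p = q) {v : E p} (hv : IsTodaVec D N S θ m p v) :
    IsTodaVec D N S θ m q (fibreCast h v) := by
  subst h
  exact hv

/-- Starting from an `f` that `T_0` sends to a Toda vector, all `T_{iy} f` are Toda vectors whose
lengths are those computed from `f`. As `T_0` need not be the identity, `f` itself need not be a
Toda vector. -/
theorem IsTodaMetric.isRadial {w : Fin (n + 1) → ℂˣ → ℝ} (hw : IsTodaMetric D N S θ m c w)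
    (hC : IsCyclicTT D N S ω₀ θ m) (hD : D.IsTTStar F)
    (hN : ∀ (U : Set ℂˣ) (a : ∀ t, E t), IsOpen U → IsHolSection F a U →
      IsHolSection F (fun t => N t (a t)) U)
    (hS : ∀ (U : Set ℂˣ) (a : ∀ t, E t), IsOpen U → IsHolSection F a U →
      IsHolSection F (fun t => S t (a t)) U)
    (hphi : ∀ t, D.phi t = (c : ℂ) • N t)
    (hT : ∀ y : ℝ, IsTTIso F F (D.rhoAct ((y : ℂ) * Complex.I)) D (T y))
    (hcont : ∀ p (f : E p), Continuous (rotPath F T p f)) : IsRadial w := by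
  have key : ∀ j (y : ℝ) p, w j (c * rho (-((y : ℂ) * Complex.I)) p) = w j (c * p) := by
    intro j y p
    obtain ⟨U, e, -, hpU, -, hv⟩ := exists_todaVec hC hD hN hS p
    obtain ⟨h0, hf⟩ := exists_rotMap_zero (T := T) p
    obtain ⟨f, hf⟩ := hf (e p)
    have h1 : IsTodaVec D N S θ m _ (rotMap (((0 : ℝ) : ℂ) * Complex.I) (T 0) p f) := by
      rw [hf]
      exact isTodaVec_fibreCast h0.symm (hv p hpU)
    have h2 := isTodaVec_rotMap hC hD hN hS hphi hT (hcont p f) h1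
    have h3 : ∀ y : ℝ, (Real.exp (w j (c * rho (-((y : ℂ) * Complex.I)) p)) : ℂ) =
        D.g p (powVec n (N p) f j) (powVec n (N p) f j) := fun y => by
      rw [← hw _ _ (h2 y) j, powVec_rotMap hphi (hT y), (hT y).g_rotMap]
    have h4 := (h3 y).trans (h3 0).symm
    rw [h0] at h4
    exact Real.exp_injective (Complex.ofReal_injective h4)
  intro j s t hst
  -- Points of equal modulus differ by `e^z` with `z` purely imaginary, that is, by one of the
  -- rotations.
  obtain ⟨z, hz⟩ := exists_expUnit (s * t⁻¹)
  have hz2 : Complex.exp z = s * (t : ℂ)⁻¹ := by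
    rw [← expUnit_val, hz, Units.val_mul, Units.val_inv_eq_inv_val]
  have hre : z.re = 0 := by
    have h := congrArg norm hz2
    rw [Complex.norm_exp, norm_mul, norm_inv, hst, mul_inv_cancel₀ (norm_ne_zero_iff.2 t.ne_zero),
      Real.exp_eq_one_iff] at h
    exact h
  have hzI : z = -(((-z.im : ℝ) : ℂ) * Complex.I) := by
    apply Complex.ext <;> simp [hre]
  have h := key j (-z.im) (c⁻¹ * t)
  rw [mul_inv_cancel_left, ← hzI] at h
  rw [← h]
  congr 1
  refine Units.ext ?_
  rw [Units.val_mul, rho_val, hz2, Units.val_mul, Units.val_inv_eq_inv_val]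
  field_simp

end rotation

/-! ### The covering of `ℂ*` by Toda vectors -/

section covering

variable {F : Type*} [NormedAddCommGroup F] [NormedSpace ℂ F] [FiniteDimensional ℂ F]
  {E : ℂˣ → Type*} [∀ t, AddCommGroup (E t)] [∀ t, Module ℂ (E t)]
  [∀ t, TopologicalSpace (E t)] [TopologicalSpace (TotalSpace F E)]
  [FiberBundle F E] [VectorBundle ℂ F E] [ContMDiffVectorBundle ω F E 𝓘(ℂ, ℂ)] {D : TTData E}
  {n : ℕ} {N : ∀ t, E t →ₗ[ℂ] E t} {S : ∀ t, E t ≃ₗ[ℂ] E t} {ω₀ θ : ℂ} {m : Fin (n + 1)}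
  {c : ℂˣ} [∀ t, FiniteDimensional ℂ (E t)]

variable (F) in
/-- The space of all Toda vectors. -/
abbrev TodaCover (D : TTData E) (N : ∀ t, E t →ₗ[ℂ] E t) (S : ∀ t, E t ≃ₗ[ℂ] E t) (θ : ℂ)
    (m : Fin (n + 1)) : Type _ :=
  {a : TotalSpace F E // IsTodaVec D N S θ m a.proj a.2}

theorem eta_powVec_todaVec (hC : IsCyclicTT D N S ω₀ θ m) {t : ℂˣ} {u v : E t}
    (hu : IsTodaVec D N S θ m t u) (hv : IsTodaVec D N S θ m t v) :
    (u = v ∧ D.eta t u (powVec n (N t) v m) = 1) ∨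
      (u = -v ∧ D.eta t u (powVec n (N t) v m) = -1) := by
  rcases hu.eq_or_eq_neg hC hv with rfl | rfl
  · exact Or.inl ⟨rfl, hv.2⟩
  · exact Or.inr ⟨rfl, by rw [map_neg, LinearMap.neg_apply, hv.2]⟩

theorem isHolSection_neg {U : Set ℂˣ} (hU : IsOpen U) {e : ∀ t, E t} (he : IsHolSection F e U) :
    IsHolSection F (fun t => -e t) U := by
  rw [isHolSection_iff hU] at he ⊢
  intro t ht
  simpa using (he t ht).const_smul (-1)

/-- Over the domain of a holomorphic Toda vector `e` the two sheets are `e` and `-e`. -/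
theorem isCoveringMap_todaCover (hC : IsCyclicTT D N S ω₀ θ m) (hD : D.IsTTStar F)
    (hN : ∀ (U : Set ℂˣ) (a : ∀ t, E t), IsOpen U → IsHolSection F a U →
      IsHolSection F (fun t => N t (a t)) U)
    (hS : ∀ (U : Set ℂˣ) (a : ∀ t, E t), IsOpen U → IsHolSection F a U →
      IsHolSection F (fun t => S t (a t)) U) :
    IsCoveringMap fun a : TodaCover F D N S θ m => a.1.proj := by
  classical
  intro p
  obtain ⟨U, e, hU, hpU, he, hv⟩ := exists_todaVec hC hD hN hS p
  have hproj : Continuous fun a : TodaCover F D N S θ m => a.1.proj :=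
    (FiberBundle.continuous_proj F E).comp continuous_subtype_val
  -- The pairing with `N^m e` is continuous with values `±1`, so it labels the sheets.
  set χ : (fun a : TodaCover F D N S θ m => a.1.proj) ⁻¹' U → ℂ := fun a =>
    D.eta a.1.1.proj a.1.1.2 (powVec n (N a.1.1.proj) (e a.1.1.proj) m) with hχ
  have hχc : Continuous χ := continuous_iff_continuousAt.2 fun a =>
    hD.continuousAt_eta (continuous_subtype_val.comp continuous_subtype_val).continuousAt hU
      (isHolSection_powVec hN hU he m) a.2
  have hχe : ∀ a, (a.1.1.2 = e a.1.1.proj ∧ χ a = 1) ∨ (a.1.1.2 = -e a.1.1.proj ∧ χ a = -1) :=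
    fun a => eta_powVec_todaVec hC a.1.2 (hv _ a.2)
  have h11 : (-1 : ℂ) ≠ 1 := by norm_num
  have hcont : ∀ b : Bool, Continuous fun t : U =>
      TotalSpace.mk' F (t : ℂˣ) (cond b (e t) (-e t)) := by
    intro b
    cases b
    · exact continuousOn_iff_continuous_domRestrict.1 (isHolSection_neg hU he).continuousOn
    · exact continuousOn_iff_continuous_domRestrict.1 he.continuousOn
  refine IsEvenlyCovered.to_isEvenlyCovered_preimage (I := Bool) ⟨inferInstance, U, hpU, hU,
    hU.preimage hproj, ?_⟩
  refine ⟨⟨⟨fun a => (⟨a.1.1.proj, a.2⟩, decide (χ a = 1)),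
    fun x => ⟨⟨TotalSpace.mk' F (x.1 : ℂˣ) (cond x.2 (e x.1) (-e x.1)), ?_⟩, x.1.2⟩, ?_, ?_⟩,
    ?_, ?_⟩, fun a => rfl⟩
  · cases x.2
    · exact (hv _ x.1.2).neg
    · exact hv _ x.1.2
  · rintro ⟨⟨⟨t, u⟩, hu⟩, ht⟩
    refine Subtype.ext (Subtype.ext ?_)
    change TotalSpace.mk' F t (cond (decide (χ ⟨⟨⟨t, u⟩, hu⟩, ht⟩ = 1)) (e t) (-e t)) = ⟨t, u⟩
    rcases hχe ⟨⟨⟨t, u⟩, hu⟩, ht⟩ with ⟨h1, h2⟩ | ⟨h1, h2⟩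
    · rw [h2, decide_eq_true rfl]
      exact congrArg (TotalSpace.mk t) h1.symm
    · rw [h2, decide_eq_false h11]
      exact congrArg (TotalSpace.mk t) h1.symm
  · rintro ⟨⟨t, ht⟩, b⟩
    refine Prod.ext rfl ?_
    cases b
    · refine decide_eq_false ?_
      change D.eta t (-e t) (powVec n (N t) (e t) m) ≠ 1
      rw [map_neg, LinearMap.neg_apply, (hv t ht).2]
      exact h11
    · exact decide_eq_true (hv t ht).2
  · refine Continuous.prodMk ((hproj.comp continuous_subtype_val).subtype_mk _) ?_
    refine continuous_discrete_rng.2 fun b => ?_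
    cases b
    · have : (fun a => decide (χ a = 1)) ⁻¹' {false} = χ ⁻¹' {1}ᶜ := by ext; simp
      rw [this]
      exact isOpen_compl_singleton.preimage hχc
    · have : (fun a => decide (χ a = 1)) ⁻¹' {true} = χ ⁻¹' {-1}ᶜ := by
        ext a
        rcases hχe a with ⟨-, h⟩ | ⟨-, h⟩ <;> simp [h, h11, h11.symm]
      rw [this]
      exact isOpen_compl_singleton.preimage hχc
  · refine Continuous.subtype_mk (Continuous.subtype_mk ?_ _) _
    exact continuous_prod_of_discrete_right.2 fun b => hcont b

omit [FiniteDimensional ℂ F] [VectorBundle ℂ F E] [ContMDiffVectorBundle ω F E 𝓘(ℂ, ℂ)]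
  [∀ t, Module ℂ (E t)] [∀ t, TopologicalSpace (E t)] [FiberBundle F E]
  [∀ t, FiniteDimensional ℂ (E t)] [TopologicalSpace (TotalSpace F E)] [∀ t, AddCommGroup (E t)] in
theorem mk_fibreCast [∀ t, AddCommGroup (E t)] [∀ t, Module ℂ (E t)] {p q : ℂˣ} (h : p = q)
    (v : E p) : TotalSpace.mk' F q (fibreCast h v) = TotalSpace.mk' F p v := by
  subst h
  rfl

/-- A continuous section that consists of Toda vectors is holomorphic. -/
theorem isHolSection_of_isTodaVec (hC : IsCyclicTT D N S ω₀ θ m) (hD : D.IsTTStar F)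
    (hN : ∀ (U : Set ℂˣ) (a : ∀ t, E t), IsOpen U → IsHolSection F a U →
      IsHolSection F (fun t => N t (a t)) U)
    (hS : ∀ (U : Set ℂˣ) (a : ∀ t, E t), IsOpen U → IsHolSection F a U →
      IsHolSection F (fun t => S t (a t)) U)
    {e : ∀ t, E t} (he : Continuous fun t => TotalSpace.mk' F t (e t))
    (hv : ∀ t, IsTodaVec D N S θ m t (e t)) : IsHolSection F e univ := by
  rw [isHolSection_iff isOpen_univ]
  intro p _
  obtain ⟨U, e', hU, hpU, he', hv'⟩ := exists_todaVec hC hD hN hS p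
  have hχ := hD.continuousAt_eta he.continuousAt hU (isHolSection_powVec hN hU he' m) hpU
  have hχe := fun t (ht : t ∈ U) => eta_powVec_todaVec hC (hv t) (hv' t ht)
  have h11 : (-1 : ℂ) ≠ 1 := by norm_num
  -- A continuous function with values `±1` is locally constant, so near `p` the section is one
  -- fixed sign times the holomorphic one.
  rcases hχe p hpU with ⟨-, h⟩ | ⟨-, h⟩
  · refine ((isHolSection_iff hU).1 he' p hpU).congr ?_
    filter_upwards [hU.mem_nhds hpU, hχ.eventually_ne (h.trans_ne h11.symm)] with t ht h1
    exact ((hχe t ht).resolve_right fun h2 => h1 h2.2).1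
  · refine ((isHolSection_iff hU).1 (isHolSection_neg hU he') p hpU).congr ?_
    filter_upwards [hU.mem_nhds hpU, hχ.eventually_ne (h.trans_ne h11)] with t ht h1
    exact ((hχe t ht).resolve_left fun h2 => h1 h2.2).1

variable {T : ∀ (y : ℝ) (t : ℂˣ), (rho ((y : ℂ) * Complex.I) *ᵖ E) t ≃ₗ[ℂ] E t}

/-- If the family of isomorphisms is `2π`-periodic, there is a global holomorphic Toda vector. -/
theorem exists_global_todaVec (hC : IsCyclicTT D N S ω₀ θ m) (hD : D.IsTTStar F)
    (hN : ∀ (U : Set ℂˣ) (a : ∀ t, E t), IsOpen U → IsHolSection F a U →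
      IsHolSection F (fun t => N t (a t)) U)
    (hS : ∀ (U : Set ℂˣ) (a : ∀ t, E t), IsOpen U → IsHolSection F a U →
      IsHolSection F (fun t => S t (a t)) U)
    (hphi : ∀ t, D.phi t = (c : ℂ) • N t)
    (hT : ∀ y : ℝ, IsTTIso F F (D.rhoAct ((y : ℂ) * Complex.I)) D (T y))
    (hcont : ∀ p (f : E p), Continuous (rotPath F T p f))
    (hper : ∀ p (f : E p), rotPath F T p f (2 * Real.pi) = rotPath F T p f 0) :
    ∃ e : ∀ t, E t, IsHolSection F e univ ∧ ∀ t, IsTodaVec D N S θ m t (e t) := by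
  have hcov := isCoveringMap_todaCover hC hD hN hS
  obtain ⟨U, e₁, -, h1U, -, hv₁⟩ := exists_todaVec hC hD hN hS (expUnit 0)
  -- The plane is simply connected, so the exponential lifts to the double covering.
  obtain ⟨L, ⟨-, hL⟩, -⟩ := hcov.existsUnique_continuousMap_lifts
    ⟨expUnit, continuous_expUnit⟩ 0 ⟨TotalSpace.mk' F (expUnit 0) (e₁ _), hv₁ _ h1U⟩ rfl
  replace hL : ∀ z, (L z).1.proj = expUnit z := fun z => congrFun hL z
  have hLper : Function.Periodic L (2 * Real.pi * Complex.I) := by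
    intro z'
    set z := z' + 2 * Real.pi * Complex.I with hz
    obtain ⟨h0, hf⟩ := exists_rotMap_zero (T := T) (L z).1.proj
    obtain ⟨f, hf⟩ := hf (L z).1.2
    have h1 : IsTodaVec D N S θ m _ (rotMap (((0 : ℝ) : ℂ) * Complex.I) (T 0) _ f) := by
      rw [hf]
      exact isTodaVec_fibreCast h0.symm (L z).2
    let Γ : ℝ → TodaCover F D N S θ m := fun y =>
      ⟨rotPath F T _ f y, isTodaVec_rotMap hC hD hN hS hphi hT (hcont _ f) h1 y⟩
    have hΓ0 : Γ 0 = L z := by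
      refine Subtype.ext ?_
      change TotalSpace.mk' F _ (rotMap _ (T 0) _ f) = _
      rw [hf]
      exact mk_fibreCast h0.symm _
    -- Both are lifts of the same circle with the same value at `0`. At `y = 2π` the periodicity of
    -- `T` closes the first path, hence also the second.
    have hΓL : Γ = fun y : ℝ => L (z - y * Complex.I) := by
      refine hcov.eq_of_comp_eq ((hcont _ f).subtype_mk _)
        (L.continuous.comp (by fun_prop)) ?_ 0 ?_
      · funext y
        change rho (-((y : ℂ) * Complex.I)) (L z).1.proj = (L (z - y * Complex.I)).1.proj
        refine Units.ext ?_
        rw [hL, hL, rho_val, expUnit_val, expUnit_val, ← Complex.exp_add]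
        congr 1
        ring
      · rw [hΓ0]
        simp
    have h2 : Γ (2 * Real.pi) = Γ 0 := Subtype.ext (hper _ f)
    have h3 : z - ((2 * Real.pi : ℝ) : ℂ) * Complex.I = z' := by
      rw [hz]
      push_cast
      ring
    rw [hΓ0, congrFun hΓL (2 * Real.pi), h3] at h2
    exact h2.symm
  have hLexp : ∀ z z', expUnit z = expUnit z' → L z = L z' := by
    intro z z' h
    obtain ⟨k, rfl⟩ := Complex.exp_eq_exp_iff_exists_int.1 (congrArg Units.val h)
    exact hLper.int_mul k z'
  have hlog : ∀ t : ℂˣ, expUnit (Complex.log t) = t := fun t => Units.ext (Complex.exp_log t.ne_zero)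
  have hLt : ∀ t : ℂˣ, (L (Complex.log t)).1.proj = t := fun t => (hL _).trans (hlog t)
  have hmk : ∀ t : ℂˣ, TotalSpace.mk' F t (fibreCast (hLt t) (L (Complex.log t)).1.2) =
      (L (Complex.log t)).1 := fun t => mk_fibreCast (hLt t) _
  have htoda : ∀ t : ℂˣ, IsTodaVec D N S θ m t (fibreCast (hLt t) (L (Complex.log t)).1.2) :=
    fun t => isTodaVec_fibreCast (hLt t) (L (Complex.log t)).2
  refine ⟨fun t => fibreCast (hLt t) (L (Complex.log t)).1.2,
    isHolSection_of_isTodaVec hC hD hN hS ?_ htoda, htoda⟩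
  rw [continuous_iff_continuousAt]
  intro p
  -- Near `p` the principal logarithm is replaced by a branch continuous there; by periodicity of
  -- `L` the value does not depend on the branch.
  have h1 : (fun t : ℂˣ => TotalSpace.mk' F t (fibreCast (hLt t) (L (Complex.log t)).1.2)) =
      fun t : ℂˣ => (L (Complex.log (t * (p : ℂ)⁻¹) + Complex.log p)).1 := by
    funext t
    rw [hmk, hLexp (Complex.log (t * (p : ℂ)⁻¹) + Complex.log p) (Complex.log t)]
    refine Units.ext ?_
    rw [expUnit_val, expUnit_val, Complex.exp_add,
      Complex.exp_log (mul_ne_zero t.ne_zero (inv_ne_zero p.ne_zero)), Complex.exp_log p.ne_zero,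
      Complex.exp_log t.ne_zero, inv_mul_cancel_right₀ p.ne_zero]
  rw [h1]
  have h2 : ContinuousAt (fun t : ℂˣ => Complex.log (t * (p : ℂ)⁻¹)) p := by
    refine ContinuousAt.clog ((continuous_unitVal.continuousAt).mul continuousAt_const) ?_
    simp
  exact (continuous_subtype_val.comp L.continuous).continuousAt.comp (h2.add continuousAt_const)

end covering

end

/-! ### Assembly of the main theorem -/

theorem proposition4p2 (n : ℕ) (E : ℂˣ → Type*)
    [∀ t, AddCommGroup (E t)] [∀ t, Module ℂ (E t)] [∀ t, TopologicalSpace (E t)]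
    [TopologicalSpace (TotalSpace (Fin (n + 1) → ℂ) E)]
    [FiberBundle (Fin (n + 1) → ℂ) E] [VectorBundle ℂ (Fin (n + 1) → ℂ) E]
    [ContMDiffVectorBundle ω (Fin (n + 1) → ℂ) E 𝓘(ℂ, ℂ)]
    -- a tt*-structure of rank `n + 1` with non-vanishing `Φ`
    (D : TTData E) (hD : D.IsTTStar (Fin (n + 1) → ℂ)) (hPhi : ∀ t, D.Phi t ≠ 0)
    -- it is isomorphic to `ω · (E, η, g, Φ)`, where `ω = exp (2πi / (n + 1))`
    (hfix : ∃ S : ∀ t, E t ≃ₗ[ℂ] E t, IsTTIso (Fin (n + 1) → ℂ) (Fin (n + 1) → ℂ) D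
      (D.scale (Complex.exp (2 * Real.pi * Complex.I / ((n : ℂ) + 1)))) S)
    -- `T y` is an isomorphism `ρ_z · (E, η, g, Φ) → (E, η, g, Φ)`, where `z = i y`
    (T : ∀ (y : ℝ) (t : ℂˣ), (rho ((y : ℂ) * Complex.I) *ᵖ E) t ≃ₗ[ℂ] E t)
    (hT : ∀ y : ℝ, IsTTIso (Fin (n + 1) → ℂ) (Fin (n + 1) → ℂ)
      (D.rhoAct ((y : ℂ) * Complex.I)) D (T y))
    (hcont : ∀ a : TotalSpace (Fin (n + 1) → ℂ) E,
      Continuous fun y : ℝ => totalMap (Fin (n + 1) → ℂ) ((y : ℂ) * Complex.I) (T y) a) :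
    ∃ (l : Fin (n + 1)) (c : ℂˣ) (w : Fin (n + 1) → ℂˣ → ℝ),
      -- `w` is a radial solution of the tt*-Toda equation
      IsTTStarTodaSolution l w ∧ IsRadial w ∧
      -- there is a Toda frame near every point, unique up to a common sign on overlaps
      (∃ (U : ℂˣ → Set ℂˣ) (e : ℂˣ → Fin (n + 1) → ∀ t, E t),
        (∀ p, IsOpen (U p) ∧ p ∈ U p ∧
          IsTodaFrameOn (Fin (n + 1) → ℂ) D l c w (e p) (U p)) ∧
        (∀ p q, ∀ t ∈ U p ∩ U q, (∀ j, e q j t = e p j t) ∨ (∀ j, e q j t = -e p j t)) ∧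
        -- for a metric that is diagonal in such a frame, the tt*-equation is the Toda equation
        (∀ p, ∀ A : ℂˣ → Matrix (Fin (n + 1)) (Fin (n + 1)) ℂ, D.IsHiggsMatrix (e p) (U p) A →
          ∀ u : Fin (n + 1) → ℂˣ → ℝ, (∀ j, ContMDiff 𝓘(ℝ, ℂ) 𝓘(ℝ, ℝ) ∞ (u j)) →
          ∀ t ∈ U p, TTEquationAt
            (fun s => Matrix.diagonal fun j => (Real.exp (u j (c * s)) : ℂ)) A t ↔
            ∀ j, TodaAt u j (c * t))) ∧
      -- if the family `T` is `2π`-periodic, there is a global Toda frame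
      (totalMap (Fin (n + 1) → ℂ) (((2 * Real.pi : ℝ) : ℂ) * Complex.I) (T (2 * Real.pi)) =
          totalMap (Fin (n + 1) → ℂ) (((0 : ℝ) : ℂ) * Complex.I) (T 0) →
        ∃ e : Fin (n + 1) → ∀ t, E t,
          IsTodaFrameOn (Fin (n + 1) → ℂ) D l c w e Set.univ) := by
  set ω₀ : ℂ := Complex.exp (2 * Real.pi * Complex.I / ((n : ℂ) + 1)) with hω₀
  obtain ⟨S, hS⟩ := hfix
  have hω : IsPrimitiveRoot ω₀ (n + 1) := by
    have h := Complex.isPrimitiveRoot_exp (n + 1) (Nat.succ_ne_zero n)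
    rwa [Nat.cast_add, Nat.cast_one, ← hω₀] at h
  let bF : Module.Basis (Fin (n + 1)) ℂ (Fin (n + 1) → ℂ) := Pi.basisFun ℂ _
  have hfin : ∀ t, FiniteDimensional ℂ (E t) := fun t => (fibreBasis bF t).finiteDimensional_of_finite
  have hdim : ∀ t, Module.finrank ℂ (E t) = n + 1 := fun t => by
    rw [Module.finrank_eq_card_basis (fibreBasis bF t), Fintype.card_fin]
  obtain ⟨a, ha, hpow⟩ := hD.exists_phi_pow_eq bF hdim hPhi hω hS T hT
  -- Any root will do: in the coordinate `s = c t` the form `Φ` becomes `N ds` with `N^(n+1) = 1`.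
  obtain ⟨c₀, hc₀⟩ := IsAlgClosed.exists_pow_nat_eq a (n := n + 1) (Nat.succ_pos n)
  have hc₀0 : c₀ ≠ 0 := fun h => ha (by rw [← hc₀, h, zero_pow (Nat.succ_ne_zero n)])
  obtain ⟨c, rfl⟩ : ∃ c : ℂˣ, (c : ℂ) = c₀ := ⟨Units.mk0 c₀ hc₀0, rfl⟩
  obtain ⟨θ, m, hC⟩ := hD.exists_isCyclic hdim hω hS hc₀0 fun t => by rw [hpow, hc₀]
  set N : ∀ t, E t →ₗ[ℂ] E t := fun t => (c : ℂ)⁻¹ • D.phi t with hN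
  have hphi : ∀ t, D.phi t = (c : ℂ) • N t := fun t => by
    rw [hN, smul_smul, mul_inv_cancel₀ hc₀0, one_smul]
  have hNhol : ∀ (U : Set ℂˣ) (a : ∀ t, E t), IsOpen U → IsHolSection (Fin (n + 1) → ℂ) a U →
      IsHolSection (Fin (n + 1) → ℂ) (fun t => N t (a t)) U := fun U a hU ha => by
    have h := hD.holSecAt_phi hU ha
    rw [isHolSection_iff hU] at h ⊢
    exact fun t ht => (h t ht).const_smul _
  have hShol : ∀ (U : Set ℂˣ) (a : ∀ t, E t), IsOpen U → IsHolSection (Fin (n + 1) → ℂ) a U →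
      IsHolSection (Fin (n + 1) → ℂ) (fun t => S t (a t)) U := fun U a hU ha => by
    rw [isHolSection_iff hU] at ha ⊢
    exact fun t ht => hS.holSecAt (ha t ht)
  have htot : ∀ p (f : E p), (fun y : ℝ => totalMap (Fin (n + 1) → ℂ) ((y : ℂ) * Complex.I) (T y)
      (TotalSpace.mk' (Fin (n + 1) → ℂ) p f)) = rotPath (Fin (n + 1) → ℂ) T p f := fun p f =>
    funext fun y => totalMap_mk _ _ _ p f
  have hrot : ∀ p (f : E p), Continuous (rotPath (Fin (n + 1) → ℂ) T p f) := fun p f =>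
    htot p f ▸ hcont _
  obtain ⟨w, hws, hw⟩ := exists_isTodaMetric hC hD hNhol hShol c
  refine ⟨m + 1, c, w, isTTStarTodaSolution hC hD hNhol hShol hphi hws hw,
    hw.isRadial hC hD hNhol hShol hphi hT hrot, ?_, fun hper => ?_⟩
  · choose U e hU hpU he hv using exists_todaVec hC hD hNhol hShol
    refine ⟨U, fun p j t => powVec n (N t) (e p t) j, fun p => ⟨hU p, hpU p,
      isTodaFrameOn_powVec hC hD hNhol hphi hw (hU p) (he p) (hv p)⟩, ?_, ?_⟩
    · intro p q t ht
      rcases (hv q t ht.2).eq_or_eq_neg hC (hv p t ht.1) with h | h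
      · exact Or.inl fun j => congrArg (powVec n (N t) · j) h
      · exact Or.inr fun j => (congrArg (powVec n (N t) · j) h).trans (powVec_neg j)
    · intro p A hA u hu t ht
      exact ttEquationAt_diagonal_iff (fun j s => smoothAt_ofReal (hu j s))
        (higgsMatrix_eq_smul_shiftMatrix hC hphi (hv p) hA ht)
  · obtain ⟨e, he, hv⟩ := exists_global_todaVec hC hD hNhol hShol hphi hT hrot fun p f => by
      have h1 := congrFun (htot p f) (2 * Real.pi)
      have h2 := congrFun (htot p f) 0
      rw [← h1, ← h2]
      exact congrFun hper _
    exact ⟨fun j t => powVec n (N t) (e t) j,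
      isTodaFrameOn_powVec hC hD hNhol hphi hw isOpen_univ he fun t _ => hv t⟩
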